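/- All graphs are finite. Let $G=(V,E)$ be an undirected chordal graph (no set of four or more vertices induces a cycle; $G$ need not be connected) and let $K\subseteq V$ be a clique, i.e. a (possibly empty) set of pairwise adjacent vertices. An acyclic moral orientation (AMO) of $G$ is an orientation of all edges of $G$ that has no directed cycle and no induced subgraph $a\to b\leftarrow c$. A linear ordering $\tau$ of $V$ represents an AMO $\alpha$ if $u$ precedes $v$ in $\tau$ for each edge $u\to v$ of $\alpha$. For a permutation $\pi(K)$ of $K$, let $G^{\pi(K)}$ be the union of all AMOs of $G$ that can be represented by an ordering beginning with $\pi(K)$ (in a union, an edge that occurs in both directions is undirected), and let $G^K=\bigcup_\pi G^{\pi(K)}$, over all permutations $\pi$ of $K$. Let $\mathcal C_G(K)$ be the set of undirected connected components of $G^K[V\setminus K]$, i.e. of the connected components (as graphs, including single vertices) of the undirected graph that is formed by the undirected edges of $G^K$ within $V\setminus K$. The modified lexicographic BFS on input $(G,K)$ works as follows. Start with the sequence of sets $\mathcal S=(K,V\setminus K)$, the empty list $\tau$ and $L=\emptyset$. While $\mathcal S$ contains a non-empty set: let $X$ be the first non-empty set of $\mathcal S$ and let $v$ be an arbitrary vertex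 of $X$; append $v$ to $\tau$; if $v$ is neither in a set in $L$ nor in $K$, add (the current value of) $X$ to $L$ and output the connected components of $G[X]$; then remove $v$ from $X$ in $\mathcal S$, replace each set $S_i$ of $\mathcal S$ by the two sets $S_i\cap N(v),\,S_i\setminus N(v)$ in this order, and remove all empty sets from $\mathcal S$. **Theorem.** For every chordal graph $G$ and every clique $K$ of $G$, the modified lexicographic BFS computes $\mathcal C_G(K)$ in time $\mathcal O(|V|+|E|)$. That is: 1. Whatever choices are made, the algorithm terminates, and the graphs that it outputs are exactly the elements of $\mathcal C_G(K)$, each output exactly once. 2. The algorithm can be implemented in linear time: there are a program for a unit-cost random access machine (whose only arithmetic is the increment and decrement by one) and a constant $c$ such that for every chordal graph $G$ with $V=\{0,\dots,n-1\}$, given by adjacency lists in any order, and every clique $K$ of $G$, given by a list in any order, the program halts after at most $c\,(|V|+|E|+1)$ steps, and its output consists of the traversal order $\tau$ and the list of output graphs (each with a list of its vertices and a list of its edges) of a complete run of the modified lexicographic BFS on $(G,K)$; in particular these graphs are exactly the elements of $\mathcal C_G(K)$. -/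

import Mathlib

namespace ModLBFS

/-! ## Chordal graphs, acyclic moral orientations, and `C_G(K)` -/

section Graphs

variable {V : Type*}

/-- A graph is chordal if no set of four or more vertices induces a cycle. -/
def IsChordal (G : SimpleGraph V) : Prop :=
  ∀ n : ℕ, 4 ≤ n → IsEmpty (SimpleGraph.cycleGraph n ↪g G)

/-- `D` is obtained from the undirected graph `G` by replacing every undirected edge with a
directed one. -/
def IsOrientation (G : SimpleGraph V) (D : Digraph V) : Prop :=
  (∀ u v, (D.Adj u v ∨ D.Adj v u) ↔ G.Adj u v) ∧ ∀ u v, ¬ (D.Adj u v ∧ D.Adj v u)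

/-- There is no directed cycle. -/
def IsAcyclic (D : Digraph V) : Prop := ∀ v, ¬ Relation.TransGen D.Adj v v

/-- There is no v-structure, that is, no induced subgraph `a → b ← c`. -/
def IsMoral (D : Digraph V) : Prop :=
  ∀ a b c, a ≠ c → D.Adj a b → D.Adj c b → D.Adj a c ∨ D.Adj c a

/-- `D` is an acyclic moral orientation (AMO) of `G`. -/
def IsAMO (G : SimpleGraph V) (D : Digraph V) : Prop :=
  IsOrientation G D ∧ IsAcyclic D ∧ IsMoral D

/-- `l` is a linear ordering (a permutation) of the elements of `X`. -/
def IsOrderingOf (l : List V) (X : Set V) : Prop := l.Nodup ∧ ∀ v, v ∈ l ↔ v ∈ X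

/-- The linear ordering `τ` of all vertices represents `D`:
`u` precedes `v` in `τ` for each edge `u → v` of `D`. -/
def Represents (τ : List V) (D : Digraph V) : Prop :=
  IsOrderingOf τ Set.univ ∧ ∀ u v, D.Adj u v → List.Sublist [u, v] τ

/-- The `π(K)`-orientation of `G`, where the list `p` is the permutation `π(K)`: the union of all
AMOs of `G` that can be represented by a topological ordering beginning with `p`. -/
def permOrientation (G : SimpleGraph V) (p : List V) : Digraph V where
  Adj u v := ∃ D : Digraph V,
    IsAMO G D ∧ (∃ τ : List V, Represents τ D ∧ List.IsPrefix p τ) ∧ D.Adj u v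

/-- `G^K`: the union of the `π(K)`-orientations of `G` over all permutations `π` of `K`. -/
def cliqueOrientation (G : SimpleGraph V) (K : Set V) : Digraph V where
  Adj u v := ∃ p : List V, IsOrderingOf p K ∧ (permOrientation G p).Adj u v

/-- A graph given by a vertex set and an edge set of ordered pairs; an undirected edge
`u - v` is the presence of both `(u, v)` and `(v, u)`. -/
@[ext]
structure PGraph (V : Type*) where
  verts : Set V
  edges : Set (V × V)

/-- The connected components (as graphs) of the subgraph `H[X]` of the undirected graph `H`
induced on `X`. -/
def components (H : SimpleGraph V) (X : Set V) : Set (PGraph V) :=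
  {C | ∃ c : (H.induce X).ConnectedComponent,
    C.verts = Subtype.val '' c.supp ∧
    C.edges = {e | e.1 ∈ C.verts ∧ e.2 ∈ C.verts ∧ H.Adj e.1 e.2}}

/-- `C_G(K)`: the undirected connected components of `G^K[V \ K]`, that is, the connected
components of the graph formed by the undirected edges of `G^K` inside `V \ K`. -/
def undirectedComponents (G : SimpleGraph V) (K : Set V) : Set (PGraph V) :=
  components (cliqueOrientation G K).toSimpleGraphStrict Kᶜ

end Graphs

/-! ## The modified lexicographic breadth-first search, with all its nondeterministic choices -/

section Algorithm

variable {V : Type*}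

/-- The variables of the algorithm: the sequence `𝓢` of sets, the traversal order `τ`,
the collection `L` of sets, and the graphs output so far. -/
structure LState (V : Type*) where
  sets : List (Set V)
  order : List V
  marked : Set (Set V)
  out : List (PGraph V)

/-- Initially `𝓢 = (K, V \ K)`, and `τ`, `L` and the output are empty. -/
def LState.init (K : Set V) : LState V := ⟨[K, Kᶜ], [], ∅, []⟩

/-- The loop ends when `𝓢` contains no non-empty set. -/
def LState.Done (s : LState V) : Prop := ∀ Y ∈ s.sets, Y = ∅

open scoped Classical in
/-- Replace each `S i` by `S i ∩ N(v), S i \ N(v)` and remove all empty sets. -/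
noncomputable def refine (G : SimpleGraph V) (v : V) (sets : List (Set V)) : List (Set V) :=
  (sets.flatMap fun Y => [Y ∩ G.neighborSet v, Y \ G.neighborSet v]).filter
    fun Y => decide Y.Nonempty

/-- One iteration of the loop: `X` is the first non-empty set of `𝓢`, and `v` is an arbitrary
vertex of `X`. If `v` is neither in a set in `L` nor in `K`, then `X` is added to `L` and the
connected components of `G[X]` are output (in any order). -/
inductive Step (G : SimpleGraph V) (K : Set V) : LState V → LState V → Prop
  | old (s : LState V) (pre post : List (Set V)) (X : Set V) (v : V)
      (hsets : s.sets = pre ++ X :: post) (hpre : ∀ Y ∈ pre, Y = ∅) (hv : v ∈ X)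
      (hold : (∃ Y ∈ s.marked, v ∈ Y) ∨ v ∈ K) :
      Step G K s
        { sets := refine G v (pre ++ (X \ {v}) :: post)
          order := s.order ++ [v]
          marked := s.marked
          out := s.out }
  | new (s : LState V) (pre post : List (Set V)) (X : Set V) (v : V) (cs : List (PGraph V))
      (hsets : s.sets = pre ++ X :: post) (hpre : ∀ Y ∈ pre, Y = ∅) (hv : v ∈ X)
      (hnew : ¬ ((∃ Y ∈ s.marked, v ∈ Y) ∨ v ∈ K))
      (hcs : cs.Nodup ∧ ∀ C, C ∈ cs ↔ C ∈ components G X) :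
      Step G K s
        { sets := refine G v (pre ++ (X \ {v}) :: post)
          order := s.order ++ [v]
          marked := insert X s.marked
          out := s.out ++ cs }

/-- `s` occurs in some run of the algorithm on `G` and `K`. -/
def Reachable (G : SimpleGraph V) (K : Set V) (s : LState V) : Prop :=
  Relation.ReflTransGen (Step G K) (LState.init K) s

end Algorithm

/-! ## The machine model

A random access machine with finitely many registers and arrays per program. The only arithmetic
is the increment and decrement by one, so all numbers that occur in a run are bounded by the input
numbers and program constants plus the running time. Every primitive operation costs one unit. -/

section Machine

/-- A memory: registers `vars x`, and arrays with cells `arrs a i`. -/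
structure Store where
  vars : ℕ → ℕ
  arrs : ℕ → ℕ → ℕ

inductive Expr
  | lit (k : ℕ)
  | var (x : ℕ)
  | read (a : ℕ) (i : Expr)
  | succ (e : Expr)
  | pred (e : Expr)

def Expr.eval (s : Store) : Expr → ℕ
  | .lit k => k
  | .var x => s.vars x
  | .read a i => s.arrs a (i.eval s)
  | .succ e => e.eval s + 1
  | .pred e => e.eval s - 1

/-- The number of primitive operations in an expression. -/
def Expr.cost : Expr → ℕ
  | .lit _ => 1
  | .var _ => 1
  | .read _ i => i.cost + 1
  | .succ e => e.cost + 1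
  | .pred e => e.cost + 1

inductive Test
  | eq (e f : Expr)
  | lt (e f : Expr)

def Test.Holds (s : Store) : Test → Prop
  | .eq e f => e.eval s = f.eval s
  | .lt e f => e.eval s < f.eval s

def Test.cost : Test → ℕ
  | .eq e f => e.cost + f.cost + 1
  | .lt e f => e.cost + f.cost + 1

inductive Prog
  | skip
  | assign (x : ℕ) (e : Expr)
  | write (a : ℕ) (i e : Expr)
  | seq (p q : Prog)
  | ite (b : Test) (p q : Prog)
  | loop (b : Test) (p : Prog)

def Store.setVar (s : Store) (x k : ℕ) : Store :=
  { s with vars := Function.update s.vars x k }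

def Store.setCell (s : Store) (a i k : ℕ) : Store :=
  { s with arrs := Function.update s.arrs a (Function.update (s.arrs a) i k) }

/-- `Exec p s T t`: the program `p` started in the memory `s` halts after `T` primitive
operations in the memory `t`. -/
inductive Exec : Prog → Store → ℕ → Store → Prop
  | skip (s : Store) : Exec .skip s 1 s
  | assign (s : Store) (x : ℕ) (e : Expr) :
      Exec (.assign x e) s (e.cost + 1) (s.setVar x (e.eval s))
  | write (s : Store) (a : ℕ) (i e : Expr) :
      Exec (.write a i e) s (i.cost + e.cost + 1) (s.setCell a (i.eval s) (e.eval s))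
  | seq {p q : Prog} {s t u : Store} {T U : ℕ} :
      Exec p s T t → Exec q t U u → Exec (.seq p q) s (T + U) u
  | iteTrue {b : Test} {p q : Prog} {s t : Store} {T : ℕ} :
      b.Holds s → Exec p s T t → Exec (.ite b p q) s (b.cost + T) t
  | iteFalse {b : Test} {p q : Prog} {s t : Store} {T : ℕ} :
      ¬ b.Holds s → Exec q s T t → Exec (.ite b p q) s (b.cost + T) t
  | loopTrue {b : Test} {p : Prog} {s t u : Store} {T U : ℕ} :
      b.Holds s → Exec p s T t → Exec (.loop b p) t U u →
      Exec (.loop b p) s (b.cost + T + U) u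
  | loopFalse {b : Test} {p : Prog} {s : Store} :
      ¬ b.Holds s → Exec (.loop b p) s b.cost s

end Machine

/-! ## Input and output formats -/

section Encoding

/-- `adj` is an adjacency list representation of `G` (each list in any order). -/
def IsAdjList {n : ℕ} (G : SimpleGraph (Fin n)) (adj : Fin n → List (Fin n)) : Prop :=
  ∀ v, IsOrderingOf (adj v) (G.neighborSet v)

/-- The array holding the list `l`, followed by zeros. -/
def ofList (l : List ℕ) (i : ℕ) : ℕ := l.getD i 0

/-- The initial memory for a graph on `{0, …, n-1}` with adjacency lists `adj` and a clique listed
as `ks`. Register `0` holds `n` and register `1` the size of the clique. Array `1` is the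
concatenation of the adjacency lists, the list of `v` occupying the cells from `arrs 0 v` up to
(excluding) `arrs 0 (v + 1)`. Array `2` lists the clique. Everything else is zero. -/
def inputStore (n : ℕ) (adj : Fin n → List (Fin n)) (ks : List (Fin n)) : Store where
  vars
    | 0 => n
    | 1 => ks.length
    | _ => 0
  arrs
    | 0 => ofList ((List.range (n + 1)).map fun i => ((List.ofFn adj).take i).flatten.length)
    | 1 => ofList ((List.ofFn adj).flatten.map Fin.val)
    | 2 => ofList (ks.map Fin.val)
    | _ => ofList []

/-- The list of the entries of the array `f` in the cells `i` with `a ≤ i < b`. -/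
def segment (f : ℕ → ℕ) (a b : ℕ) : List ℕ := (List.range' a (b - a)).map f

/-- The memory `t` holds the graph `C` as its `j`-th output: the vertices of `C` are listed in
array `4` between the positions given by array `5`; the edges of `C` are listed by their two
endpoints in arrays `6` and `7` between the positions given by array `8`. -/
def HoldsGraph {n : ℕ} (t : Store) (j : ℕ) (C : PGraph (Fin n)) : Prop :=
  ∃ (vs : List (Fin n)) (es : List (Fin n × Fin n)),
    vs.Nodup ∧ (∀ v, v ∈ vs ↔ v ∈ C.verts) ∧
    es.Nodup ∧ (∀ e, e ∈ es ↔ e ∈ C.edges) ∧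
    segment (t.arrs 4) (t.arrs 5 j) (t.arrs 5 (j + 1)) = vs.map Fin.val ∧
    segment (t.arrs 6) (t.arrs 8 j) (t.arrs 8 (j + 1)) = es.map (fun e => e.1.val) ∧
    segment (t.arrs 7) (t.arrs 8 j) (t.arrs 8 (j + 1)) = es.map (fun e => e.2.val)

/-- The memory `t` holds the traversal order `τ` (in array `3`) and the list `cs` of output graphs
(their number being in register `2`). -/
def HoldsOutput {n : ℕ} (t : Store) (τ : List (Fin n)) (cs : List (PGraph (Fin n))) : Prop :=
  segment (t.arrs 3) 0 n = τ.map Fin.val ∧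
  t.vars 2 = cs.length ∧
  ∀ (j : ℕ) (hj : j < cs.length), HoldsGraph t j cs[j]

end Encoding

end ModLBFS

/-! An AMO represented by an ordering `τ` is the orientation of `G` along `τ`, and orienting along
`τ` is moral exactly when the earlier neighbours of each vertex are pairwise adjacent. Call an
ordering good if it has this clique property and begins with a permutation of `K`. Then `u → v`
occurs in `G^K` iff `uv` is an edge and some good order puts `u` before `v`
(`cliqueOrientation_adj_iff`). So an edge is undirected in `G^K` iff the good orders disagree about
it.

Complete runs produce good orders. The search has the LexBFS property: if `a` is visited, `b` is
visited next, `c` is still unvisited, and `a` is adjacent to `c` but not to `b`, then some visited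
`d` is adjacent to `b` but not to `c`. In a chordal graph this property makes earlier neighbours of
a vertex adjacent, because a violation would give ever earlier induced paths
(`IsChordal.no_path_above`). The clique `K` is exhausted first because it is the first set.

The marked sets partition `V \ K`, and the undirected edges of `G^K` outside `K` are the edges of
`G` inside marked sets, for two reasons. Inside a marked set `X`: when `X` was marked, any of its
vertices could have been picked, and every partial run can be completed, so each of two vertices of
`X` precedes the other in some good order (`Reachable.exists_goodOrder`). Between sets: suppose that
`X` is being marked, and that `w` in `X` has an unvisited neighbour `u` outside `X`. The refinement
separated them by a visited `d` adjacent to `w` but not to `u`. Inductively `d` precedes `w` in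
every good order; if `u` also preceded `w`, then `d` and `u` would be adjacent. Hence `w` precedes
`u` in every good order (`LState.Inv.mark`). The components are therefore those of the graphs `G[X]`
(`Reachable.done_iff`).

For linear time, the sequence of sets is kept as intervals of one array of vertices. Refining by a
neighbourhood swaps each unvisited neighbour to the front of its interval, at constant cost
(`Moved.move`). The components of `G[X]` are not computed when `X` is marked but written down as
their vertices are visited: the search exhausts `X`, component by component, before it leaves it
(`BlockInv`). A vertex starts a new component iff it has no visited neighbour in `X`. Since the
abstract algorithm may output components in any order, the order of discovery can be chosen in
hindsight. Marked sets are recognised by a group number stored per interval, and an interval that is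
split off inherits it. A visit costs a constant plus a constant per neighbour, which sums to `O(|V|
+ |E|)` by the handshake lemma. -/

namespace ModLBFS

/-! ### Chordal graphs: search orders and perfect elimination -/

section Graphs

variable {V : Type*}

/-- `p 0, …, p k` is an induced path of `G`. -/
def IsInducedPath (G : SimpleGraph V) (p : ℕ → V) (k : ℕ) : Prop :=
  (∀ i j, i ≤ k → j ≤ k → p i = p j → i = j) ∧
    ∀ i j, i ≤ k → j ≤ k → (G.Adj (p i) (p j) ↔ i + 1 = j ∨ j + 1 = i)

theorem IsInducedPath.reverse {G : SimpleGraph V} {p : ℕ → V} {k : ℕ} (h : IsInducedPath G p k) :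
    IsInducedPath G (fun i => p (k - i)) k := by
  refine ⟨fun i j hi hj e => ?_, fun i j hi hj => ?_⟩
  · have := h.1 _ _ (Nat.sub_le k i) (Nat.sub_le k j) e
    omega
  · rw [h.2 _ _ (Nat.sub_le k i) (Nat.sub_le k j)]
    omega

theorem IsInducedPath.extend {G : SimpleGraph V} {p : ℕ → V} {k j : ℕ} {d : V}
    (h : IsInducedPath G p k) (hj : j ≤ k) (hd : ∀ i, i ≤ j → p i ≠ d)
    (hadj : ∀ i, i ≤ j → (G.Adj d (p i) ↔ i = j)) :
    IsInducedPath G (fun i => if i ≤ j then p i else d) (j + 1) := by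
  refine ⟨fun a b ha hb e => ?_, fun a b ha hb => ?_⟩
  · by_cases h1 : a ≤ j <;> by_cases h2 : b ≤ j <;> simp only [h1, h2, if_true, if_false] at e
    · exact h.1 _ _ (by omega) (by omega) e
    · exact absurd e (hd a h1)
    · exact absurd e.symm (hd b h2)
    · omega
  · by_cases h1 : a ≤ j <;> by_cases h2 : b ≤ j <;> simp only [h1, h2, if_true, if_false]
    · exact h.2 _ _ (by omega) (by omega)
    · rw [G.adj_comm, hadj a h1]; omega
    · rw [hadj b h2]; omega
    · simp only [SimpleGraph.irrefl, false_iff]; omega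

/-- A chordal graph has no induced path whose ends have a common neighbour that is adjacent to no
inner vertex. -/
theorem IsChordal.no_induced_cycle {G : SimpleGraph V} (hG : IsChordal G) {p : ℕ → V} {k : ℕ}
    {d : V} (hk : 2 ≤ k) (h : IsInducedPath G p k) (hd : ∀ i, i ≤ k → p i ≠ d)
    (hadj : ∀ i, i ≤ k → (G.Adj d (p i) ↔ i = 0 ∨ i = k)) : False := by
  -- The cycle is `p 0, …, p k, d`: index `k + 1` is sent to `d`, and `2 ≤ k` makes its length at
  -- least four.
  refine (hG (k + 2) (by omega)).false
    ⟨⟨fun i => if i.val ≤ k then p i.val else d, fun a b e => ?_⟩, fun {a b} => ?_⟩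
  · have ha := a.2
    have hb := b.2
    by_cases h1 : a.val ≤ k <;> by_cases h2 : b.val ≤ k <;>
      simp only [h1, h2, if_true, if_false] at e
    · exact Fin.ext (h.1 _ _ h1 h2 e)
    · exact absurd e (hd _ h1)
    · exact absurd e.symm (hd _ h2)
    · exact Fin.ext (by omega)
  · have ha := a.2
    have hb := b.2
    have key : (SimpleGraph.cycleGraph (k + 2)).Adj a b ↔ a.val + 1 = b.val ∨ b.val + 1 = a.val ∨
        (a.val = 0 ∧ b.val = k + 1) ∨ (b.val = 0 ∧ a.val = k + 1) := by
      rw [SimpleGraph.cycleGraph_adj', Fin.sub_def, Fin.sub_def]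
      simp only
      rcases lt_trichotomy a.val b.val with hlt | heq | hlt
      · rw [show k + 2 - b.val + a.val = (k + 2) - (b.val - a.val) by omega,
          show k + 2 - a.val + b.val = (b.val - a.val) + (k + 2) by omega, Nat.add_mod_right,
          Nat.mod_eq_of_lt (by omega), Nat.mod_eq_of_lt (by omega)]
        omega
      · rw [heq, show k + 2 - b.val + b.val = k + 2 by omega, Nat.mod_self]
        omega
      · rw [show k + 2 - a.val + b.val = (k + 2) - (a.val - b.val) by omega,
          show k + 2 - b.val + a.val = (a.val - b.val) + (k + 2) by omega, Nat.add_mod_right,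
          Nat.mod_eq_of_lt (by omega), Nat.mod_eq_of_lt (by omega)]
        omega
    rw [key]
    change G.Adj (if a.val ≤ k then p a.val else d) (if b.val ≤ k then p b.val else d) ↔ _
    by_cases h1 : a.val ≤ k <;> by_cases h2 : b.val ≤ k <;>
      simp only [h1, h2, if_true, if_false]
    · rw [h.2 _ _ h1 h2]; omega
    · rw [G.adj_comm, hadj _ h1]; omega
    · rw [hadj _ h2]; omega
    · simp only [SimpleGraph.irrefl, false_iff]; omega

/-- Infinite descent on the position of the later end of an induced path whose inner vertices all
come after both ends. The private neighbour `d` of that end either closes an induced cycle or yields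
a path of the same kind with an earlier later end. -/
theorem IsChordal.no_path_above {G : SimpleGraph V} (hG : IsChordal G) {pos : V → ℕ}
    (hinj : Function.Injective pos)
    (h : ∀ a b c, pos a < pos b → pos b < pos c → G.Adj a c → ¬ G.Adj a b →
      ∃ d, pos d < pos b ∧ G.Adj d b ∧ ¬ G.Adj d c) (N : ℕ) :
    ∀ (p : ℕ → V) (k : ℕ), 2 ≤ k → IsInducedPath G p k →
      (∀ i, 0 < i → i < k → pos (p 0) < pos (p i) ∧ pos (p k) < pos (p i)) →
      pos (p 0) < pos (p k) → pos (p k) ≠ N := by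
  classical
  induction N using Nat.strong_induction_on with
  | _ N ih =>
  intro p k hk hp hin hlt hN
  -- The vertex `p k` comes between `p 0` and `p 1`, although `p 1` is a neighbour of `p 0` and `p
  -- k` is not; the search property therefore applies.
  obtain ⟨d, hdk, hdadj, hd1⟩ := h (p 0) (p k) (p 1) hlt (hin 1 (by omega) (by omega)).2
    ((hp.2 _ _ (by omega) (by omega)).2 (by omega)) (fun e => by
      have := (hp.2 _ _ (by omega) (by omega)).1 e; omega)
  -- Cut the path at its first vertex after `p 0` that is adjacent to `d`. This cut makes the new
  -- cycle or path induced, and `j ≠ 1` keeps it long enough.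
  have hex : ∃ j, 1 ≤ j ∧ j ≤ k ∧ G.Adj d (p j) := ⟨k, by omega, le_rfl, hdadj⟩
  obtain ⟨hj1, hjk, hj⟩ := Nat.find_spec hex
  have hmin := fun i => @Nat.find_min _ _ hex i
  generalize Nat.find hex = j at *
  have hj2 : 2 ≤ j := by
    rcases Nat.lt_or_ge j 2 with hlt2 | hge
    · obtain rfl : j = 1 := by omega
      exact absurd hj hd1
    · exact hge
  have hpos : ∀ i, 0 < i → i ≤ k → pos (p k) ≤ pos (p i) := by
    intro i hi hik
    rcases Nat.lt_or_ge i k with h1 | h1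
    · exact (hin i hi h1).2.le
    · obtain rfl : i = k := by omega
      exact le_rfl
  have hpd : ∀ i, i ≤ j → p i ≠ d := by
    rintro i hi rfl
    rcases Nat.eq_zero_or_pos i with rfl | h0
    · exact hd1 ((hp.2 _ _ (by omega) (by omega)).2 (by omega))
    · have := hpos i h0 (by omega); omega
  have hinner : ∀ i, 0 < i → i ≤ j → (G.Adj d (p i) ↔ i = j) := by
    intro i hi hij
    refine ⟨fun hadj => ?_, fun e => e ▸ hj⟩
    by_contra hne
    exact hmin i (by omega) ⟨hi, by omega, hadj⟩
  have hpj : IsInducedPath G p j :=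
    ⟨fun a b ha hb => hp.1 a b (by omega) (by omega), fun a b ha hb => hp.2 a b (by omega) (by omega)⟩
  by_cases h0 : G.Adj d (p 0)
  · refine hG.no_induced_cycle hj2 hpj hpd fun i hi => ?_
    rcases Nat.eq_zero_or_pos i with rfl | hi0
    · simp [h0]
    · rw [hinner i hi0 hi]; omega
  · have hq : IsInducedPath G (fun i => if i ≤ j then p i else d) (j + 1) := by
      refine hp.extend hjk hpd fun i hi => ?_
      rcases Nat.eq_zero_or_pos i with rfl | hi0
      · simp only [h0, false_iff]; omega
      · exact hinner i hi0 hi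
    have hqin : ∀ i, 0 < i → i < j + 1 → pos (p k) ≤ pos (if i ≤ j then p i else d) := by
      intro i hi hij
      rw [if_pos (by omega)]
      exact hpos i hi (by omega)
    have hne : pos (p 0) ≠ pos d := fun e => hpd 0 (by omega) (hinj e)
    have hq0 : (if 0 ≤ j then p 0 else d) = p 0 := if_pos (by omega)
    have hqk : (if j + 1 ≤ j then p (j + 1) else d) = d := if_neg (by omega)
    -- Both ends `p 0` and `d` come before `p k`, so the descent works whichever is later; the path
    -- is reversed if that is `p 0`.
    rcases lt_or_gt_of_ne hne with h1 | h1
    · refine ih (pos d) (by omega) _ (j + 1) (by omega) hq (fun i hi hij => ?_) ?_ (by rw [hqk])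
      · have := hqin i hi hij
        simp only [hq0, hqk]
        omega
      · simpa only [hq0, hqk] using h1
    · refine ih (pos (p 0)) (by omega) _ (j + 1) (by omega) hq.reverse (fun i hi hij => ?_) ?_ ?_
      · have := hqin (j + 1 - i) (by omega) (by omega)
        simp only [Nat.sub_zero, Nat.sub_self, hq0, hqk]
        omega
      · simpa only [Nat.sub_zero, Nat.sub_self, hq0, hqk] using h1
      · simp only [Nat.sub_self, hq0]

/-- In a chordal graph, a search order in which a non-neighbour can only overtake a neighbour of
an earlier vertex by means of a private earlier neighbour is a reversed perfect elimination
order. -/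
theorem IsChordal.adj_of_search_order {G : SimpleGraph V} (hG : IsChordal G) {pos : V → ℕ}
    (hinj : Function.Injective pos)
    (h : ∀ a b c, pos a < pos b → pos b < pos c → G.Adj a c → ¬ G.Adj a b →
      ∃ d, pos d < pos b ∧ G.Adj d b ∧ ¬ G.Adj d c) {a b c : V} (hab : pos a < pos b)
    (hbc : pos b < pos c) (hac : G.Adj a c) (hbc' : G.Adj b c) : G.Adj a b := by
  by_contra hnab
  have h01 : a ≠ c := hac.ne
  have h12 : b ≠ c := hbc'.ne
  have h02 : a ≠ b := fun e => by simp [e] at hab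
  -- If `a` and `b` were not adjacent, `a, c, b` would be a forbidden path of length two.
  refine hG.no_path_above hinj h (pos b) (fun i => if i = 0 then a else if i = 1 then c else b) 2
    le_rfl ⟨fun i j hi hj e => ?_, fun i j hi hj => ?_⟩ (fun i h0 h2 => ?_) ?_ (by simp)
  · interval_cases i <;> interval_cases j <;> simp_all [eq_comm]
  · interval_cases i <;> interval_cases j <;> simp_all [G.adj_comm]
  · obtain rfl : i = 1 := by omega
    simp only [if_true, if_false, one_ne_zero, OfNat.ofNat_ne_zero, OfNat.ofNat_ne_one]
    omega
  · simpa using hab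

end Graphs
end ModLBFS

namespace ModLBFS

/-! ### Good orders and the orientation `G^K` -/

section Orders

variable {V : Type*}

theorem pair_sublist_iff {l : List V} {a b : V} :
    List.Sublist [a, b] l ↔ ∃ l₁ l₂, l = l₁ ++ b :: l₂ ∧ a ∈ l₁ := by
  constructor
  · intro h
    obtain ⟨r₁, r₂, rfl, ha, hb⟩ := List.cons_sublist_iff.1 h
    obtain ⟨s, t, rfl⟩ := List.append_of_mem (List.singleton_sublist.1 hb)
    exact ⟨r₁ ++ s, t, by simp, by simp [ha]⟩
  · rintro ⟨l₁, l₂, rfl, ha⟩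
    exact (List.singleton_sublist.2 ha).append ((List.Sublist.refl [b]).trans (by simp))

theorem pair_sublist_iff_idxOf [DecidableEq V] {l : List V} (hl : l.Nodup) {a b : V} (hb : b ∈ l) :
    List.Sublist [a, b] l ↔ l.idxOf a < l.idxOf b := by
  rw [pair_sublist_iff]
  constructor
  · rintro ⟨l₁, l₂, rfl, ha⟩
    have hb1 : b ∉ l₁ := fun h => (List.nodup_append.1 hl).2.2 b h b (by simp) rfl
    rw [List.idxOf_append_of_mem ha, List.idxOf_append_of_notMem hb1]
    have := List.idxOf_lt_length_iff.2 ha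
    omega
  · intro h
    obtain ⟨l₁, l₂, rfl⟩ := List.append_of_mem hb
    have hb1 : b ∉ l₁ := fun h => (List.nodup_append.1 hl).2.2 b h b (by simp) rfl
    refine ⟨l₁, l₂, rfl, ?_⟩
    by_contra ha
    rw [List.idxOf_append_of_notMem ha, List.idxOf_append_of_notMem hb1] at h
    simp at h

/-- `τ` is an ordering of the vertices that begins with a permutation of `K` and in which the
earlier neighbours of each vertex are pairwise adjacent. -/
structure IsGoodOrder (G : SimpleGraph V) (K : Set V) (τ : List V) : Prop where
  ordering : IsOrderingOf τ Set.univ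
  start : ∃ p, IsOrderingOf p K ∧ p <+: τ
  clique : ∀ a b c, List.Sublist [a, c] τ → List.Sublist [b, c] τ → a ≠ b → G.Adj a c →
    G.Adj b c → G.Adj a b

theorem IsGoodOrder.asymm {G : SimpleGraph V} {K : Set V} {τ : List V} (h : IsGoodOrder G K τ)
    {a b : V} (hab : List.Sublist [a, b] τ) : ¬ List.Sublist [b, a] τ := by
  classical
  rw [pair_sublist_iff_idxOf h.ordering.1 ((h.ordering.2 _).2 trivial)] at hab ⊢
  omega

theorem IsGoodOrder.total {G : SimpleGraph V} {K : Set V} {τ : List V} (h : IsGoodOrder G K τ)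
    {a b : V} (hab : a ≠ b) : List.Sublist [a, b] τ ∨ List.Sublist [b, a] τ := by
  classical
  rw [pair_sublist_iff_idxOf h.ordering.1 ((h.ordering.2 _).2 trivial),
    pair_sublist_iff_idxOf h.ordering.1 ((h.ordering.2 _).2 trivial)]
  have := mt (List.idxOf_inj ((h.ordering.2 a).2 trivial)).1 hab
  omega

theorem IsGoodOrder.start_before {G : SimpleGraph V} {K : Set V} {τ : List V}
    (h : IsGoodOrder G K τ) {a b : V} (ha : a ∈ K) (hb : b ∉ K) : List.Sublist [a, b] τ := by
  obtain ⟨p, hp, q, rfl⟩ := h.start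
  have hbm := (h.ordering.2 b).2 trivial
  have hbq : b ∈ q := (List.mem_append.1 hbm).resolve_left fun hbp => hb ((hp.2 b).1 hbp)
  exact (List.singleton_sublist.2 ((hp.2 a).2 ha)).append (List.singleton_sublist.2 hbq)

/-- The orientation of `G` along a linear ordering of its vertices. -/
def orientAlong (G : SimpleGraph V) (τ : List V) : Digraph V where
  Adj u v := G.Adj u v ∧ List.Sublist [u, v] τ

/-- Positions increase along arcs, which excludes cycles; two tails of arcs with a common head are
earlier neighbours of that head, hence adjacent. -/
theorem IsGoodOrder.isAMO {G : SimpleGraph V} {K : Set V} {τ : List V} (h : IsGoodOrder G K τ) :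
    IsAMO G (orientAlong G τ) := by
  classical
  refine ⟨⟨fun u v => ⟨?_, fun e => ?_⟩, fun u v e => h.asymm e.1.2 e.2.2⟩, fun v hv => ?_, ?_⟩
  · rintro (e | e)
    · exact e.1
    · exact e.1.symm
  · rcases h.total e.ne with h1 | h1
    · exact Or.inl ⟨e, h1⟩
    · exact Or.inr ⟨e.symm, h1⟩
  · have key : ∀ w, Relation.TransGen (orientAlong G τ).Adj v w → τ.idxOf v < τ.idxOf w := by
      intro w hw
      have hlt : ∀ a b, (orientAlong G τ).Adj a b → τ.idxOf a < τ.idxOf b := fun a b e =>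
        (pair_sublist_iff_idxOf h.ordering.1 ((h.ordering.2 _).2 trivial)).1 e.2
      induction hw with
      | single e => exact hlt _ _ e
      | tail _ e ih => exact ih.trans (hlt _ _ e)
    exact lt_irrefl _ (key v hv)
  · intro a b c hac hab hcb
    have e := h.clique a c b hab.2 hcb.2 hac hab.1 hcb.1
    rcases h.total hac with h1 | h1
    · exact Or.inl ⟨e, h1⟩
    · exact Or.inr ⟨e.symm, h1⟩

/-- An AMO is determined by any ordering that represents it, so the union of AMOs can be replaced by
a quantifier over orderings. Morality of the AMO is the clique property of the ordering. -/
theorem cliqueOrientation_adj_iff {G : SimpleGraph V} {K : Set V} {u v : V} :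
    (cliqueOrientation G K).Adj u v ↔
      G.Adj u v ∧ ∃ τ, IsGoodOrder G K τ ∧ List.Sublist [u, v] τ := by
  classical
  constructor
  · rintro ⟨p, hp, D, hD, ⟨τ, hτ, hpτ⟩, huv⟩
    refine ⟨(hD.1.1 u v).1 (Or.inl huv), τ, ⟨hτ.1, ⟨p, hp, hpτ⟩, ?_⟩, hτ.2 _ _ huv⟩
    have key : ∀ a c, List.Sublist [a, c] τ → G.Adj a c → D.Adj a c := by
      intro a c hac e
      refine ((hD.1.1 a c).2 e).resolve_right fun hca => ?_
      have h1 := hτ.2 _ _ hca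
      rw [pair_sublist_iff_idxOf hτ.1.1 ((hτ.1.2 _).2 trivial)] at hac h1
      omega
    intro a b c hac hbc hab eac ebc
    exact (hD.1.1 a b).1 (hD.2.2 a c b hab (key a c hac eac) (key b c hbc ebc))
  · rintro ⟨e, τ, h, huv⟩
    obtain ⟨p, hp, hpτ⟩ := h.start
    exact ⟨p, hp, orientAlong G τ, h.isAMO, ⟨τ, ⟨h.ordering, fun u v e => e.2⟩, hpτ⟩, e, huv⟩

end Orders
end ModLBFS

namespace ModLBFS

/-! ### The invariant of the search -/

section Invariant

variable {V : Type*}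

theorem mem_refine {G : SimpleGraph V} {v : V} {l : List (Set V)} {Y : Set V} :
    Y ∈ refine G v l ↔ Y.Nonempty ∧ ∃ A ∈ l, Y = A ∩ G.neighborSet v ∨ Y = A \ G.neighborSet v := by
  simp only [refine, List.mem_filter, List.mem_flatMap, List.mem_cons, List.not_mem_nil, or_false,
    decide_eq_true_eq]
  exact and_comm

theorem exists_mem_refine {G : SimpleGraph V} {v u : V} {l : List (Set V)} :
    (∃ Y ∈ refine G v l, u ∈ Y) ↔ ∃ A ∈ l, u ∈ A := by
  constructor
  · rintro ⟨Y, hY, hu⟩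
    obtain ⟨-, A, hA, rfl | rfl⟩ := mem_refine.1 hY
    · exact ⟨A, hA, hu.1⟩
    · exact ⟨A, hA, hu.1⟩
  · rintro ⟨A, hA, hu⟩
    by_cases h : u ∈ G.neighborSet v
    · exact ⟨A ∩ G.neighborSet v, mem_refine.2 ⟨⟨u, hu, h⟩, A, hA, Or.inl rfl⟩, hu, h⟩
    · exact ⟨A \ G.neighborSet v, mem_refine.2 ⟨⟨u, hu, h⟩, A, hA, Or.inr rfl⟩, hu, h⟩

/-- `r a b` holds for all `a`, `b` with the set of `a` earlier in the list than that of `b`. -/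
def SetsBefore (r : V → V → Prop) (l : List (Set V)) : Prop :=
  l.Pairwise fun A B => ∀ a ∈ A, ∀ b ∈ B, r a b

/-- Pairs in the refined list come either from two different old sets, where the old relation
persists, or from one old set split by `v`, where `v` itself separates them. -/
theorem SetsBefore.refine {G : SimpleGraph V} {v : V} {r r' : V → V → Prop} {l : List (Set V)}
    (h : SetsBefore r l) (hr : ∀ a b, r a b → r' a b)
    (hs : ∀ A ∈ l, ∀ a ∈ A, ∀ b ∈ A, G.Adj v a → ¬ G.Adj v b → r' a b) :
    SetsBefore r' (refine G v l) := by
  refine List.Pairwise.filter _ (List.pairwise_flatMap.2 ⟨fun A hA => ?_, h.imp ?_⟩)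
  · simp only [List.pairwise_cons, List.mem_singleton, List.not_mem_nil, false_imp_iff, implies_true,
      List.Pairwise.nil, and_true, forall_eq]
    exact fun a ha b hb => hs A hA a ha.1 b hb.1 ha.2 hb.2
  · intro A B hAB x hx y hy a ha b hb
    simp only [List.mem_cons, List.not_mem_nil, or_false] at hx hy
    refine hr a b (hAB a ?_ b ?_)
    · rcases hx with rfl | rfl <;> exact ha.1
    · rcases hy with rfl | rfl <;> exact hb.1

theorem SetsBefore.of_cons {r : V → V → Prop} {pre post : List (Set V)} {X : Set V}
    (hpre : ∀ Y ∈ pre, Y = ∅) (h : SetsBefore r (X :: post)) : SetsBefore r (pre ++ X :: post) := by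
  refine List.pairwise_append.2 ⟨?_, h, fun A hA B _ a ha => ?_⟩
  · refine List.pairwise_of_forall_mem_list fun A hA B _ a ha => ?_
    rw [hpre A hA] at ha
    exact ha.elim
  · rw [hpre A hA] at ha
    exact ha.elim

/-- In every good order, `u` precedes `w`. -/
def Forced (G : SimpleGraph V) (K : Set V) (u w : V) : Prop :=
  ∀ τ, IsGoodOrder G K τ → List.Sublist [u, w] τ

/-- The relation between the vertices of an earlier and those of a later set of the search. -/
def LState.Before (G : SimpleGraph V) (K : Set V) (s : LState V) (a b : V) : Prop :=
  a ≠ b ∧ (b ∈ K → a ∈ K) ∧ (∀ Y ∈ s.marked, b ∈ Y → a ∈ Y) ∧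
    ((∃ d ∈ s.order, G.Adj d a ∧ ¬ G.Adj d b) ∨ (a ∈ K ∧ b ∉ K))

/-- The relation between the vertices of one set of the search. -/
def LState.Twin (G : SimpleGraph V) (K : Set V) (s : LState V) (a b : V) : Prop :=
  (∀ d ∈ s.order, G.Adj d a ↔ G.Adj d b) ∧ (a ∈ K ↔ b ∈ K) ∧ ∀ Y ∈ s.marked, a ∈ Y ↔ b ∈ Y

/-- The invariant of the modified lexicographic breadth-first search. -/
structure LState.Inv (G : SimpleGraph V) (K : Set V) (s : LState V) : Prop where
  nodup : s.order.Nodup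
  cover : ∀ v, v ∉ s.order ↔ ∃ A ∈ s.sets, v ∈ A
  before : SetsBefore (s.Before G K) s.sets
  twin : ∀ A ∈ s.sets, ∀ a ∈ A, ∀ b ∈ A, s.Twin G K a b
  clique_first : ∃ p q, s.order = p ++ q ∧ (∀ x ∈ p, x ∈ K) ∧ (∀ x ∈ q, x ∉ K) ∧
    (q ≠ [] → ∀ x ∈ K, x ∈ p)
  search : ∀ l₁ b l₂, s.order = l₁ ++ b :: l₂ → ∀ a ∈ l₁, ∀ c, c ∉ l₁ → c ≠ b → G.Adj a c →
    ¬ G.Adj a b → ∃ d ∈ l₁, G.Adj d b ∧ ¬ G.Adj d c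
  visited_marked : ∀ x ∈ s.order, x ∉ K → ∃ Y ∈ s.marked, x ∈ Y
  marked_clique : ∀ Y ∈ s.marked, ∀ x ∈ Y, x ∉ K
  marked_disjoint : ∀ Y ∈ s.marked, ∀ Z ∈ s.marked, ∀ x ∈ Y, x ∈ Z → Y = Z
  sep : ∀ Y ∈ s.marked, ∀ w ∈ Y, ∀ u, u ∉ Y → u ∉ K → G.Adj w u → Forced G K w u ∨ Forced G K u w
  sep_unvisited : ∀ Y ∈ s.marked, ∀ w ∈ Y, ∀ u, u ∉ Y → u ∉ K → u ∉ s.order → G.Adj w u →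
    Forced G K w u
  forced : ∀ x ∈ s.order, ∀ u, u ∉ s.order → u ∉ K → G.Adj x u → (∀ Y ∈ s.marked, x ∈ Y → u ∉ Y) →
    Forced G K x u
  twin_marked : ∀ Y ∈ s.marked, ∀ a ∈ Y, ∀ b ∈ Y, a ∉ s.order → b ∉ s.order → ∀ d ∈ s.order,
    d ∉ Y → (G.Adj d a ↔ G.Adj d b)
  out_nodup : s.out.Nodup
  mem_out : ∀ C, C ∈ s.out ↔ ∃ Y ∈ s.marked, C ∈ components G Y

theorem LState.Inv.init (G : SimpleGraph V) (K : Set V) : (LState.init K).Inv G K where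
  nodup := List.nodup_nil
  cover v := by simp [LState.init, em]
  before := by
    simp only [LState.init, SetsBefore, List.pairwise_cons, List.mem_singleton, List.not_mem_nil,
      false_imp_iff, implies_true, List.Pairwise.nil, and_true, forall_eq]
    exact fun a ha b hb => ⟨fun e => hb (e ▸ ha), fun _ => ha, by simp, Or.inr ⟨ha, hb⟩⟩
  twin A hA a ha b hb := by
    simp only [LState.init, List.mem_cons, List.not_mem_nil, or_false] at hA
    refine ⟨by simp [LState.init], ?_, by simp [LState.init]⟩
    rcases hA with rfl | rfl
    · exact iff_of_true ha hb
    · exact iff_of_false ha hb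
  clique_first := ⟨[], [], by simp [LState.init]⟩
  search := by simp [LState.init]
  visited_marked := by simp [LState.init]
  marked_clique := by simp [LState.init]
  marked_disjoint := by simp [LState.init]
  sep := by simp [LState.init]
  sep_unvisited := by simp [LState.init]
  forced := by simp [LState.init]
  twin_marked := by simp [LState.init]
  out_nodup := List.nodup_nil
  mem_out := by simp [LState.init]

theorem components_verts {G : SimpleGraph V} {X : Set V} {C : PGraph V} (h : C ∈ components G X) :
    C.verts.Nonempty ∧ C.verts ⊆ X := by
  obtain ⟨c, hc, -⟩ := h
  rw [hc]
  exact ⟨c.nonempty_supp.image _, by rintro _ ⟨x, -, rfl⟩; exact x.2⟩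

section

variable {G : SimpleGraph V} {K : Set V} {s : LState V} {pre post : List (Set V)} {X : Set V} {v : V}

/-- Every unvisited vertex outside the first non-empty set lies in a later one. This dichotomy
drives all later case distinctions. -/
theorem LState.Inv.first (h : s.Inv G K) (hsets : s.sets = pre ++ X :: post)
    (hpre : ∀ Y ∈ pre, Y = ∅) {a b : V} (ha : a ∈ X) (hb : b ∉ s.order) :
    b ∈ X ∨ s.Before G K a b := by
  obtain ⟨A, hA, hbA⟩ := (h.cover b).1 hb
  have hbef := h.before
  rw [hsets] at hA hbef
  rcases List.mem_append.1 hA with hA | hA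
  · rw [hpre A hA] at hbA
    exact hbA.elim
  · rcases List.mem_cons.1 hA with rfl | hA
    · exact Or.inl hbA
    · exact Or.inr ((List.pairwise_cons.1 (List.pairwise_append.1 hbef).2.1).1 A hA a ha b hbA)

theorem LState.Inv.first_notMem (h : s.Inv G K) (hsets : s.sets = pre ++ X :: post)
    {a : V} (ha : a ∈ X) : a ∉ s.order :=
  (h.cover a).2 ⟨X, by simp [hsets], ha⟩

theorem LState.Inv.first_twin (h : s.Inv G K) (hsets : s.sets = pre ++ X :: post)
    {a b : V} (ha : a ∈ X) (hb : b ∈ X) : s.Twin G K a b :=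
  h.twin X (by simp [hsets]) a ha b hb

/-- A new step is treated as marking followed by a visit. Marking must establish `sep` and
`sep_unvisited` for `X`; edges to visited vertices are covered by `forced`, because no vertex of `X`
has been marked before. -/
theorem LState.Inv.mark (h : s.Inv G K) (hsets : s.sets = pre ++ X :: post)
    (hpre : ∀ Y ∈ pre, Y = ∅) (hv : v ∈ X) (hnew : ¬ ((∃ Y ∈ s.marked, v ∈ Y) ∨ v ∈ K))
    {cs : List (PGraph V)} (hcs : cs.Nodup ∧ ∀ C, C ∈ cs ↔ C ∈ components G X) :
    LState.Inv G K { s with marked := insert X s.marked, out := s.out ++ cs } := by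
  push Not at hnew
  have hXK : ∀ a ∈ X, a ∉ K := fun a ha haK => hnew.2 ((h.first_twin hsets hv ha).2.1.2 haK)
  have hXm : ∀ a ∈ X, ∀ Y ∈ s.marked, a ∉ Y := fun a ha Y hY haY =>
    hnew.1 Y hY (((h.first_twin hsets hv ha).2.2 Y hY).2 haY)
  -- Some visited `d` is adjacent to `w` but not to `u`, and it precedes `w` in all good orders.
  -- With `u` before `w` as well, the clique property would make `d` and `u` adjacent.
  have hunv : ∀ w ∈ X, ∀ u, u ∉ X → u ∉ s.order → G.Adj w u → Forced G K w u := by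
    intro w hw u huX hu e
    obtain ⟨-, -, -, ⟨d, hd, hdw, hdu⟩ | ⟨hwK, -⟩⟩ := (h.first hsets hpre hw hu).resolve_left huX
    · intro τ hτ
      refine (hτ.total e.ne).resolve_right fun huw => hdu ?_
      exact hτ.clique d u w (h.forced d hd w (h.first_notMem hsets hw) (hXK w hw) hdw
        (fun Y hY _ => hXm w hw Y hY) τ hτ) huw (fun e => hu (e ▸ hd)) hdw e.symm
    · exact absurd hwK (hXK w hw)
  constructor
  · exact h.nodup
  · exact h.cover
  · have hbef := h.before
    simp only [hsets] at hbef ⊢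
    refine SetsBefore.of_cons hpre ?_
    have hbef := List.pairwise_cons.1 (List.pairwise_append.1 hbef).2.1
    refine List.pairwise_cons.2 ⟨fun B hB a ha b hb => ?_, ?_⟩
    · obtain ⟨h1, h2, h3, h4⟩ := hbef.1 B hB a ha b hb
      refine ⟨h1, h2, fun Y hY hbY => ?_, h4⟩
      rcases hY with rfl | hY
      · exact ha
      · exact h3 Y hY hbY
    · refine hbef.2.imp_of_mem ?_
      intro A B _ hB hAB a ha b hb
      obtain ⟨h1, h2, h3, h4⟩ := hAB a ha b hb
      refine ⟨h1, h2, fun Y hY hbY => ?_, h4⟩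
      rcases hY with rfl | hY
      · exact absurd rfl (hbef.1 B hB b hbY b hb).1
      · exact h3 Y hY hbY
  · intro A hA a ha b hb
    obtain ⟨h1, h2, h3⟩ := h.twin A hA a ha b hb
    refine ⟨h1, h2, fun Y hY => ?_⟩
    rcases hY with rfl | hY
    -- The sets of the sequence are pairwise disjoint, so membership in the new marked set `X` is
    -- constant on each of them.
    · have hbef := h.before
      simp only [hsets] at hbef hA
      have hbef := List.pairwise_cons.1 (List.pairwise_append.1 hbef).2.1
      rcases List.mem_append.1 hA with hA | hA
      · rw [hpre A hA] at ha
        exact ha.elim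
      · rcases List.mem_cons.1 hA with rfl | hA
        · exact iff_of_true ha hb
        · exact iff_of_false (fun h => (hbef.1 A hA a h a ha).1 rfl)
            fun h => (hbef.1 A hA b h b hb).1 rfl
    · exact h3 Y hY
  · exact h.clique_first
  · exact h.search
  · intro x hx hxK
    obtain ⟨Y, hY, hxY⟩ := h.visited_marked x hx hxK
    exact ⟨Y, Or.inr hY, hxY⟩
  · rintro Y (rfl | hY)
    · exact hXK
    · exact h.marked_clique Y hY
  · rintro Y (rfl | hY) Z (rfl | hZ) x hxY hxZ
    · rfl
    · exact absurd hxZ (hXm x hxY Z hZ)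
    · exact absurd hxY (hXm x hxZ Y hY)
    · exact h.marked_disjoint Y hY Z hZ x hxY hxZ
  · rintro Y (rfl | hY) w hw u hu huK e
    · by_cases huo : u ∈ s.order
      · exact Or.inr (h.forced u huo w (h.first_notMem hsets hw) (hXK w hw) e.symm
          fun Y hY _ => hXm w hw Y hY)
      · exact Or.inl (hunv w hw u hu huo e)
    · exact h.sep Y hY w hw u hu huK e
  · rintro Y (rfl | hY) w hw u hu huK huo e
    · exact hunv w hw u hu huo e
    · exact h.sep_unvisited Y hY w hw u hu huK huo e
  · exact fun x hx u hu huK e hm => h.forced x hx u hu huK e fun Y hY => hm Y (Or.inr hY)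
  · rintro Y (rfl | hY) a ha b hb hao hbo d hd hdY
    · exact (h.first_twin hsets ha hb).1 d hd
    · exact h.twin_marked Y hY a ha b hb hao hbo d hd hdY
  · refine List.nodup_append.2 ⟨h.out_nodup, hcs.1, fun C hC D hD e => ?_⟩
    obtain ⟨Y, hY, hCY⟩ := (h.mem_out C).1 hC
    have hDX := components_verts ((hcs.2 D).1 hD)
    have hCY := components_verts hCY
    obtain ⟨x, hx⟩ := hCY.1
    exact hXm x (hDX.2 (e ▸ hx)) Y hY (hCY.2 hx)
  · intro C
    simp only [List.mem_append, h.mem_out, hcs.2, Set.mem_insert_iff, exists_eq_or_imp]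
    exact or_comm

theorem LState.Inv.order_clique (h : s.Inv G K) (hv : v ∉ s.order) (hvK : v ∈ K) {x : V}
    (hx : x ∈ s.order) : x ∈ K := by
  obtain ⟨p, q, hpq, hp, -, hK⟩ := h.clique_first
  rw [hpq] at hx hv
  rcases List.mem_append.1 hx with hx | hx
  · exact hp x hx
  · exact absurd (List.mem_append_left q (hK (List.ne_nil_of_mem hx) v hvK)) hv

/-- Visiting `v` moves it to the known side of the partition. The clauses with content are the
search property of `v` and `forced` for the new visited vertex: the latter comes from
`sep_unvisited`, or from the fact that good orders begin with `K`. -/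
theorem LState.Inv.visit (hK : G.IsClique K) (h : s.Inv G K) (hsets : s.sets = pre ++ X :: post)
    (hpre : ∀ Y ∈ pre, Y = ∅) (hv : v ∈ X) (hold : (∃ Y ∈ s.marked, v ∈ Y) ∨ v ∈ K) :
    LState.Inv G K { s with sets := refine G v (pre ++ (X \ {v}) :: post),
                            order := s.order ++ [v] } := by
  have hvo := h.first_notMem hsets hv
  have hbef := h.before
  rw [hsets] at hbef
  have hbef := List.pairwise_cons.1 (List.pairwise_append.1 hbef).2.1
  have hsub : ∀ A ∈ pre ++ (X \ {v}) :: post, ∃ B ∈ s.sets, A ⊆ B := by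
    intro A hA
    rw [hsets]
    simp only [List.mem_append, List.mem_cons] at hA ⊢
    rcases hA with hA | rfl | hA
    · exact ⟨A, Or.inl hA, subset_rfl⟩
    · exact ⟨X, Or.inr (Or.inl rfl), Set.sdiff_subset⟩
    · exact ⟨A, Or.inr (Or.inr hA), subset_rfl⟩
  constructor
  · exact List.nodup_append.2 ⟨h.nodup, List.nodup_singleton v, fun a ha b hb e => by
      rw [List.mem_singleton] at hb
      exact hvo (hb ▸ e ▸ ha)⟩
  · intro u
    change u ∉ s.order ++ [v] ↔ ∃ A ∈ refine G v _, u ∈ A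
    rw [exists_mem_refine, List.mem_append, List.mem_singleton, not_or, h.cover, hsets]
    simp only [List.mem_append, List.mem_cons]
    constructor
    · rintro ⟨⟨A, hA | rfl | hA, hu⟩, hne⟩
      · exact ⟨A, Or.inl hA, hu⟩
      · exact ⟨A \ {v}, Or.inr (Or.inl rfl), hu, hne⟩
      · exact ⟨A, Or.inr (Or.inr hA), hu⟩
    · rintro ⟨A, hA | rfl | hA, hu⟩
      · rw [hpre A hA] at hu
        exact hu.elim
      · exact ⟨⟨X, Or.inr (Or.inl rfl), hu.1⟩, hu.2⟩
      · exact ⟨⟨A, Or.inr (Or.inr hA), hu⟩, fun e => (hbef.1 A hA v hv u hu).1 e.symm⟩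
  · refine SetsBefore.refine (r := s.Before G K) (SetsBefore.of_cons hpre ?_) ?_ ?_
    · exact List.pairwise_cons.2 ⟨fun B hB a ha b hb => hbef.1 B hB a ha.1 b hb, hbef.2⟩
    · rintro a b ⟨h1, h2, h3, ⟨d, hd, hda⟩ | h4⟩
      · exact ⟨h1, h2, h3, Or.inl ⟨d, List.mem_append_left _ hd, hda⟩⟩
      · exact ⟨h1, h2, h3, Or.inr h4⟩
    · intro A hA a ha b hb hva hvb
      obtain ⟨B, hB, hAB⟩ := hsub A hA
      obtain ⟨-, h2, h3⟩ := h.twin B hB a (hAB ha) b (hAB hb)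
      exact ⟨fun e => hvb (e ▸ hva), h2.2, fun Y hY => (h3 Y hY).2, Or.inl ⟨v, by simp, hva, hvb⟩⟩
  · intro A' hA' a ha b hb
    obtain ⟨-, A, hA, hAA⟩ := mem_refine.1 hA'
    obtain ⟨B, hB, hAB⟩ := hsub A hA
    have haB : a ∈ B := hAB (by rcases hAA with rfl | rfl <;> exact ha.1)
    have hbB : b ∈ B := hAB (by rcases hAA with rfl | rfl <;> exact hb.1)
    obtain ⟨h1, h2, h3⟩ := h.twin B hB a haB b hbB
    refine ⟨fun d hd => ?_, h2, h3⟩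
    rcases List.mem_append.1 hd with hd | hd
    · exact h1 d hd
    · rw [List.mem_singleton.1 hd]
      rcases hAA with rfl | rfl
      · exact iff_of_true ha.2 hb.2
      · exact iff_of_false ha.2 hb.2
  · by_cases hvK : v ∈ K
    · refine ⟨s.order ++ [v], [], by simp, fun x hx => ?_, by simp, by simp⟩
      rcases List.mem_append.1 hx with hx | hx
      · exact h.order_clique hvo hvK hx
      · exact List.mem_singleton.1 hx ▸ hvK
    · obtain ⟨p, q, hpq, hp, hq, -⟩ := h.clique_first
      refine ⟨p, q ++ [v], by simp [hpq], hp, fun x hx => ?_, fun _ x hx => ?_⟩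
      · rcases List.mem_append.1 hx with hx | hx
        · exact hq x hx
        · exact List.mem_singleton.1 hx ▸ hvK
      · by_cases hxo : x ∈ s.order
        · exact (List.mem_append.1 (hpq ▸ hxo)).resolve_right fun hxq => hq x hxq hx
        · rcases h.first hsets hpre hv hxo with hxX | hb
          · exact absurd ((h.first_twin hsets hv hxX).2.1.2 hx) hvK
          · exact absurd (hb.2.1 hx) hvK
  -- For the last vertex `v`, an unvisited `c` in the same set has the same visited neighbours as
  -- `v`, while one in a later set is separated by some `d`. If only membership in `K` separates
  -- them, then `a` and `v` are both in the clique and adjacent.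
  · intro l₁ b l₂ hl a ha c hc hcb hac hab
    change s.order ++ [v] = _ at hl
    rcases List.eq_nil_or_concat l₂ with rfl | ⟨l₃, y, rfl⟩
    · obtain ⟨rfl, hvb⟩ := List.append_inj' hl rfl
      obtain rfl : v = b := by simpa using hvb
      rcases h.first hsets hpre hv hc with hcX | ⟨-, -, -, hd | ⟨hvK, -⟩⟩
      · exact absurd (((h.first_twin hsets hv hcX).1 a ha).2 hac) hab
      · exact hd
      · exact absurd (hK (h.order_clique hvo hvK ha) hvK fun e => hvo (e ▸ ha)) hab
    · rw [List.concat_eq_append, ← List.cons_append, ← List.append_assoc] at hl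
      exact h.search l₁ b l₃ (List.append_inj' hl rfl).1 a ha c hc hcb hac hab
  · intro x hx hxK
    rcases List.mem_append.1 hx with hx | hx
    · exact h.visited_marked x hx hxK
    · rw [List.mem_singleton.1 hx] at hxK ⊢
      exact hold.resolve_right hxK
  · exact h.marked_clique
  · exact h.marked_disjoint
  · exact h.sep
  · exact fun Y hY w hw u hu huK huo => h.sep_unvisited Y hY w hw u hu huK
      fun hm => huo (List.mem_append_left _ hm)
  · intro x hx u hu huK e hm
    rcases List.mem_append.1 hx with hx | hx
    · exact h.forced x hx u (fun hm => hu (List.mem_append_left _ hm)) huK e hm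
    · obtain rfl := List.mem_singleton.1 hx
      rcases hold with ⟨Y, hY, hxY⟩ | hxK
      · exact h.sep_unvisited Y hY x hxY u (hm Y hY hxY) huK
          (fun hm => hu (List.mem_append_left _ hm)) e
      · exact fun τ hτ => hτ.start_before hxK huK
  -- As long as `Y` contains unvisited vertices, the first set lies inside `Y`, so the vertex just
  -- visited cannot be outside `Y`.
  · intro Y hY a ha b hb hao hbo d hd hdY
    have hao' : a ∉ s.order := fun hm => hao (List.mem_append_left _ hm)
    rcases List.mem_append.1 hd with hd | hd
    · exact h.twin_marked Y hY a ha b hb hao' (fun hm => hbo (List.mem_append_left _ hm)) d hd hdY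
    · obtain rfl := List.mem_singleton.1 hd
      rcases h.first hsets hpre hv hao' with haX | hb
      · exact absurd (((h.first_twin hsets hv haX).2.2 Y hY).2 ha) hdY
      · exact absurd (hb.2.2.1 Y hY ha) hdY
  · exact h.out_nodup
  · exact h.mem_out

end

theorem Step.inv {G : SimpleGraph V} {K : Set V} (hK : G.IsClique K) {s t : LState V}
    (hst : Step G K s t) (h : s.Inv G K) : t.Inv G K := by
  cases hst with
  | old pre post X v hsets hpre hv hold => exact h.visit hK hsets hpre hv hold
  | new pre post X v cs hsets hpre hv hnew hcs =>
    exact (h.mark hsets hpre hv hnew hcs).visit hK (by exact hsets) hpre hv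
      (Or.inl ⟨X, Set.mem_insert X _, hv⟩)

theorem Reachable.inv {G : SimpleGraph V} {K : Set V} (hK : G.IsClique K) {s : LState V}
    (hs : Reachable G K s) : s.Inv G K := by
  induction hs with
  | refl => exact LState.Inv.init G K
  | tail _ hst ih => exact hst.inv hK ih

end Invariant
end ModLBFS

namespace ModLBFS

/-! ### Connected components of a union of separated sets -/

section Components

variable {V : Type*}

/-- `u` is reached from `r` by a path of `H` with all vertices after `r` in `X`. -/
def Joined (H : SimpleGraph V) (X : Set V) : V → V → Prop :=
  Relation.ReflTransGen fun a b => H.Adj a b ∧ a ∈ X ∧ b ∈ X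

theorem Joined.mem {H : SimpleGraph V} {X : Set V} {r u : V} (h : Joined H X r u) (hr : r ∈ X) :
    u ∈ X := by
  cases h with
  | refl => exact hr
  | tail _ e => exact e.2.2

theorem Joined.symm {H : SimpleGraph V} {X : Set V} {r u : V} (h : Joined H X r u) :
    Joined H X u r := by
  induction h with
  | refl => exact .refl
  | tail _ e ih => exact .head ⟨e.1.symm, e.2.2, e.2.1⟩ ih

theorem reachable_induce_iff {H : SimpleGraph V} {X : Set V} {r u : V} (hr : r ∈ X) (hu : u ∈ X) :
    (H.induce X).Reachable ⟨r, hr⟩ ⟨u, hu⟩ ↔ Joined H X r u := by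
  rw [SimpleGraph.reachable_iff_reflTransGen]
  constructor
  · intro h
    exact h.lift Subtype.val fun a b e => ⟨e, a.2, b.2⟩
  · intro h
    induction h with
    | refl => exact .refl
    | tail h e ih => exact (ih e.2.1).tail e.1

theorem mem_components_iff {H : SimpleGraph V} {X : Set V} {C : PGraph V} :
    C ∈ components H X ↔ ∃ r ∈ X, C.verts = {u | Joined H X r u} ∧
      C.edges = {e | e.1 ∈ C.verts ∧ e.2 ∈ C.verts ∧ H.Adj e.1 e.2} := by
  have key : ∀ r (hr : r ∈ X), Subtype.val '' ((H.induce X).connectedComponentMk ⟨r, hr⟩).supp =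
      {u | Joined H X r u} := by
    intro r hr
    ext u
    constructor
    · rintro ⟨x, hx, rfl⟩
      exact ((reachable_induce_iff hr x.2).1 (SimpleGraph.ConnectedComponent.exact hx).symm)
    · intro hu
      exact ⟨⟨u, hu.mem hr⟩,
        SimpleGraph.ConnectedComponent.sound ((reachable_induce_iff hr _).2 hu).symm, rfl⟩
  constructor
  · rintro ⟨c, hc, he⟩
    induction c using SimpleGraph.ConnectedComponent.ind with
    | _ r => exact ⟨r.1, r.2, hc.trans (key r.1 r.2), he⟩
  · rintro ⟨r, hr, hc, he⟩
    exact ⟨_, hc.trans (key r hr).symm, he⟩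

/-- Edges of `H` on `X` never leave a member of the partition `M`, and inside a member they are the
edges of `G`; paths in `H` therefore stay in one member. -/
theorem components_iUnion {G H : SimpleGraph V} {X : Set V} {M : Set (Set V)}
    (hM : ∀ Y ∈ M, Y ⊆ X) (hX : ∀ x ∈ X, ∃ Y ∈ M, x ∈ Y)
    (hdis : ∀ Y ∈ M, ∀ Z ∈ M, ∀ x ∈ Y, x ∈ Z → Y = Z)
    (hH : ∀ u ∈ X, ∀ w ∈ X, H.Adj u w ↔ G.Adj u w ∧ ∃ Y ∈ M, u ∈ Y ∧ w ∈ Y) (C : PGraph V) :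
    C ∈ components H X ↔ ∃ Y ∈ M, C ∈ components G Y := by
  have hadj : ∀ Y ∈ M, ∀ u ∈ Y, ∀ w ∈ Y, (H.Adj u w ↔ G.Adj u w) := by
    intro Y hY u hu w hw
    rw [hH u (hM Y hY hu) w (hM Y hY hw)]
    exact and_iff_left ⟨Y, hY, hu, hw⟩
  have key : ∀ Y ∈ M, ∀ r ∈ Y, {u | Joined H X r u} = {u | Joined G Y r u} := by
    intro Y hY r hr
    ext u
    constructor
    · intro h
      change Joined G Y r u
      induction h with
      | refl => exact .refl
      | @tail b c _ e ih =>
        obtain ⟨e, Z, hZ, hb, hc⟩ := (hH _ e.2.1 _ e.2.2).1 e.1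
        obtain rfl := hdis Y hY Z hZ b (ih.mem hr) hb
        exact ih.tail ⟨e, hb, hc⟩
    · intro h
      change Joined H X r u
      induction h with
      | refl => exact .refl
      | tail _ e ih =>
        exact ih.tail ⟨(hadj Y hY _ e.2.1 _ e.2.2).2 e.1, hM Y hY e.2.1, hM Y hY e.2.2⟩
  have key' : ∀ Y ∈ M, ∀ r ∈ Y, C.verts = {u | Joined G Y r u} →
      {e : V × V | e.1 ∈ C.verts ∧ e.2 ∈ C.verts ∧ H.Adj e.1 e.2} =
      {e : V × V | e.1 ∈ C.verts ∧ e.2 ∈ C.verts ∧ G.Adj e.1 e.2} := by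
    intro Y hY r hr hC
    ext e
    refine and_congr_right fun h1 => and_congr_right fun h2 => ?_
    rw [hC] at h1 h2
    exact hadj Y hY _ (Joined.mem h1 hr) _ (Joined.mem h2 hr)
  simp only [mem_components_iff]
  constructor
  · rintro ⟨r, hr, hv, he⟩
    obtain ⟨Y, hY, hrY⟩ := hX r hr
    rw [key Y hY r hrY] at hv
    exact ⟨Y, hY, r, hrY, hv, he.trans (key' Y hY r hrY hv)⟩
  · rintro ⟨Y, hY, r, hrY, hv, he⟩
    exact ⟨r, hM Y hY hrY, hv.trans (key Y hY r hrY).symm, he.trans (key' Y hY r hrY hv).symm⟩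

theorem exists_list_components [Finite V] (G : SimpleGraph V) (X : Set V) :
    ∃ cs : List (PGraph V), cs.Nodup ∧ ∀ C, C ∈ cs ↔ C ∈ components G X := by
  have hfin : (components G X).Finite := by
    refine (Set.finite_range fun c : (G.induce X).ConnectedComponent =>
      (⟨Subtype.val '' c.supp, {e | e.1 ∈ Subtype.val '' c.supp ∧ e.2 ∈ Subtype.val '' c.supp ∧
        G.Adj e.1 e.2}⟩ : PGraph V)).subset ?_
    rintro C ⟨c, hv, he⟩
    rw [hv] at he
    exact ⟨c, PGraph.ext hv.symm he.symm⟩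
  exact ⟨hfin.toFinset.toList, hfin.toFinset.nodup_toList, by simp⟩

end Components

/-! ### Termination and correctness of every run -/

section Correctness

variable {V : Type*} {G : SimpleGraph V} {K : Set V}

theorem exists_first_nonempty {l : List (Set V)} (h : ¬ ∀ Y ∈ l, Y = ∅) :
    ∃ pre X post, l = pre ++ X :: post ∧ (∀ Y ∈ pre, Y = ∅) ∧ X.Nonempty := by
  induction l with
  | nil => simp at h
  | cons A l ih =>
    rcases A.eq_empty_or_nonempty with rfl | hA
    · obtain ⟨pre, X, post, rfl, hpre, hX⟩ := ih (by simpa using h)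
      exact ⟨∅ :: pre, X, post, rfl, by simpa using hpre, hX⟩
    · exact ⟨[], A, l, rfl, by simp, hA⟩

theorem Step.order_eq {s t : LState V} (h : Step G K s t) : ∃ v, t.order = s.order ++ [v] := by
  cases h with
  | old pre post X v => exact ⟨v, rfl⟩
  | new pre post X v => exact ⟨v, rfl⟩

theorem exists_step_of_mem [Finite V] {s : LState V} {pre post : List (Set V)} {X : Set V} {v : V}
    (hsets : s.sets = pre ++ X :: post) (hpre : ∀ Y ∈ pre, Y = ∅) (hv : v ∈ X) :
    ∃ t, Step G K s t ∧ t.order = s.order ++ [v] := by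
  by_cases h : (∃ Y ∈ s.marked, v ∈ Y) ∨ v ∈ K
  · exact ⟨_, Step.old s pre post X v hsets hpre hv h, rfl⟩
  · obtain ⟨cs, hcs⟩ := exists_list_components G X
    exact ⟨_, Step.new s pre post X v cs hsets hpre hv h hcs, rfl⟩

theorem exists_step [Finite V] {s : LState V} (h : ¬ s.Done) : ∃ t, Step G K s t := by
  obtain ⟨pre, X, post, hsets, hpre, v, hv⟩ := exists_first_nonempty h
  obtain ⟨t, ht, -⟩ := exists_step_of_mem (G := G) (K := K) hsets hpre hv
  exact ⟨t, ht⟩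

theorem LState.Inv.length_le [Finite V] {s : LState V} (h : s.Inv G K) :
    s.order.length ≤ Nat.card V := by
  have := Fintype.ofFinite V
  rw [Nat.card_eq_fintype_card]
  exact h.nodup.length_le_card

theorem not_exists_infinite_run [Finite V] (hK : G.IsClique K) :
    ¬ ∃ f : ℕ → LState V, f 0 = LState.init K ∧ ∀ i, Step G K (f i) (f (i + 1)) := by
  rintro ⟨f, h0, hf⟩
  have hreach : ∀ i, Reachable G K (f i) ∧ (f i).order.length = i := by
    intro i
    induction i with
    | zero => rw [h0]; exact ⟨.refl, rfl⟩
    | succ i ih =>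
      obtain ⟨v, hv⟩ := (hf i).order_eq
      exact ⟨ih.1.tail (hf i), by simp [hv, ih.2]⟩
  have := ((hreach (Nat.card V + 1)).1.inv hK).length_le
  rw [(hreach _).2] at this
  omega

/-- A run cannot get stuck before it is done, and each step lengthens the order, which has no
repetitions. The prefix relation is kept so that a chosen beginning can be imposed on a complete
run. -/
theorem exists_completion [Finite V] (hK : G.IsClique K) (k : ℕ) :
    ∀ s : LState V, Reachable G K s → Nat.card V - s.order.length = k →
      ∃ t, Reachable G K t ∧ t.Done ∧ s.order <+: t.order := by
  induction k using Nat.strong_induction_on with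
  | _ k ih =>
  intro s hs hk
  by_cases hd : s.Done
  · exact ⟨s, hs, hd, List.prefix_rfl⟩
  · obtain ⟨t, ht⟩ := exists_step (G := G) (K := K) hd
    obtain ⟨v, hv⟩ := ht.order_eq
    have hlen := (Reachable.inv hK (hs.tail ht)).length_le
    rw [hv, List.length_append, List.length_singleton] at hlen
    obtain ⟨u, hu, hud, htu⟩ := ih (Nat.card V - t.order.length)
      (by rw [hv, List.length_append, List.length_singleton]; omega) t (hs.tail ht) rfl
    exact ⟨u, hu, hud, (hv ▸ List.prefix_append _ _ : s.order <+: t.order).trans htu⟩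

/-- The clause `search` is the hypothesis of `IsChordal.adj_of_search_order` in terms of list
indices, and `clique_first` provides the initial permutation of `K`. -/
theorem LState.Inv.isGoodOrder (hG : IsChordal G) {s : LState V} (h : s.Inv G K) (hd : s.Done) :
    IsGoodOrder G K s.order := by
  classical
  have hall : ∀ v, v ∈ s.order := by
    intro v
    by_contra hv
    obtain ⟨A, hA, hvA⟩ := (h.cover v).1 hv
    rw [hd A hA] at hvA
    exact hvA
  refine ⟨⟨h.nodup, fun v => iff_of_true (hall v) trivial⟩, ?_, ?_⟩
  · obtain ⟨p, q, hpq, hp, hq, hK⟩ := h.clique_first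
    refine ⟨p, ⟨(List.nodup_append.1 (hpq ▸ h.nodup)).1, fun v => ⟨hp v, fun hv => ?_⟩⟩, q, hpq.symm⟩
    exact (List.mem_append.1 (hpq ▸ hall v)).resolve_right fun hvq => hq v hvq hv
  · have hsearch : ∀ a b c, s.order.idxOf a < s.order.idxOf b → s.order.idxOf b < s.order.idxOf c →
        G.Adj a c → ¬ G.Adj a b →
        ∃ d, s.order.idxOf d < s.order.idxOf b ∧ G.Adj d b ∧ ¬ G.Adj d c := by
      intro a b c hab hbc hac hnab
      obtain ⟨l₁, l₂, hl, ha⟩ :=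
        pair_sublist_iff.1 ((pair_sublist_iff_idxOf h.nodup (hall b)).2 hab)
      have hc : c ∉ l₁ := fun hc => by
        have := (pair_sublist_iff_idxOf h.nodup (hall b)).1 (pair_sublist_iff.2 ⟨l₁, l₂, hl, hc⟩)
        omega
      obtain ⟨d, hd, hdb⟩ := h.search l₁ b l₂ hl a ha c hc (fun e => by simp [e] at hbc) hac hnab
      exact ⟨d, (pair_sublist_iff_idxOf h.nodup (hall b)).1 (pair_sublist_iff.2 ⟨l₁, l₂, hl, hd⟩),
        hdb⟩
    have hinj : Function.Injective fun v => s.order.idxOf v := fun a b e =>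
      (List.idxOf_inj (hall a)).1 e
    intro a b c hac hbc hab eac ebc
    rw [pair_sublist_iff_idxOf h.nodup (hall c)] at hac hbc
    rcases lt_trichotomy (s.order.idxOf a) (s.order.idxOf b) with h1 | h1 | h1
    · exact hG.adj_of_search_order hinj hsearch h1 hbc eac ebc
    · exact absurd (hinj h1) hab
    · exact (hG.adj_of_search_order hinj hsearch h1 hac ebc eac).symm

/-- When `Y` was marked, the search could have picked `u` instead. Completing that alternative run
gives a good order in which `u` comes before the then unvisited `w`. -/
theorem Reachable.exists_goodOrder [Finite V] (hG : IsChordal G) (hK : G.IsClique K) {s : LState V}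
    (hs : Reachable G K s) : ∀ Y ∈ s.marked, ∀ u ∈ Y, ∀ w ∈ Y, u ≠ w →
      ∃ τ, IsGoodOrder G K τ ∧ List.Sublist [u, w] τ := by
  induction hs with
  | refl => simp [LState.init]
  | @tail s t hs hst ih =>
    cases hst with
    | old => exact ih
    | new pre post X v cs hsets hpre hv hnew hcs =>
      rintro Y (rfl | hY)
      · intro u hu w hw huw
        obtain ⟨t, hst, ht⟩ := exists_step_of_mem (G := G) (K := K) hsets hpre hu
        obtain ⟨t', ht', htd, q, hq⟩ := exists_completion hK _ t (hs.tail hst) rfl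
        have hgood := (ht'.inv hK).isGoodOrder hG htd
        have hwo := (Reachable.inv hK hs).first_notMem hsets hw
        rw [ht, List.append_assoc] at hq
        refine ⟨_, hgood, (hgood.total huw).resolve_right fun h => ?_⟩
        obtain ⟨l₁, l₂, hl, hwl⟩ := pair_sublist_iff.1 h
        have hl' := hq.trans hl
        have hnd := hgood.ordering.1
        rw [← hq] at hnd
        have huq : u ∉ q := (List.nodup_cons.1 (List.nodup_append.1 hnd).2.1).1
        -- The part of the order before `u` is the order at the time of marking, which does not
        -- contain `w`.
        obtain ⟨rfl, -⟩ := (List.append_cons_inj_of_notMem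
          (Reachable.inv hK hs |>.first_notMem hsets hu) huq).1 hl'
        exact hwo hwl
      · exact ih Y hY

/-- An edge leaving a marked set points the same way in all good orders, and an edge inside one
occurs in both directions. So the marked sets satisfy the hypotheses of `components_iUnion`. -/
theorem Reachable.done_iff [Finite V] (hG : IsChordal G) (hK : G.IsClique K) {s : LState V}
    (hs : Reachable G K s) (hd : s.Done) (C : PGraph V) :
    C ∈ s.out ↔ C ∈ undirectedComponents G K := by
  have h := hs.inv hK
  have hall := (h.isGoodOrder hG hd).ordering
  rw [h.mem_out, undirectedComponents]
  refine (components_iUnion (fun Y hY x hx => h.marked_clique Y hY x hx)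
    (fun x hx => h.visited_marked x ((hall.2 x).2 trivial) hx) h.marked_disjoint
    (fun u hu w hw => ?_) C).symm
  change u ≠ w ∧ (cliqueOrientation G K).Adj u w ∧ (cliqueOrientation G K).Adj w u ↔ _
  simp only [cliqueOrientation_adj_iff]
  constructor
  · rintro ⟨-, ⟨e, τ, hτ, huw⟩, -, τ', hτ', hwu⟩
    refine ⟨e, ?_⟩
    obtain ⟨Y, hY, huY⟩ := h.visited_marked u ((hall.2 u).2 trivial) hu
    refine ⟨Y, hY, huY, ?_⟩
    by_contra hwY
    rcases h.sep Y hY u huY w hwY hw e with h1 | h1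
    · exact hτ'.asymm hwu (h1 τ' hτ')
    · exact hτ.asymm huw (h1 τ hτ)
  · rintro ⟨e, Y, hY, hu, hw⟩
    exact ⟨e.ne, ⟨e, hs.exists_goodOrder hG hK Y hY u hu w hw e.ne⟩, e.symm,
      hs.exists_goodOrder hG hK Y hY w hw u hu e.ne.symm⟩

end Correctness
end ModLBFS

namespace ModLBFS

/-! ### Listing the components while their vertices are visited -/

section Blocks

variable {V : Type*} {G : SimpleGraph V} {K : Set V}

/-- The vertex list `b.1` and the edge list `b.2` describe the graph `C`. -/
def Lists (b : List V × List (V × V)) (C : PGraph V) : Prop :=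
  b.1.Nodup ∧ (∀ v, v ∈ b.1 ↔ v ∈ C.verts) ∧ b.2.Nodup ∧ ∀ e, e ∈ b.2 ↔ e ∈ C.edges

/-- Invariant of a search that lists the components of the set `cur` that was marked last (or of
none if `cur = K`) while it visits their vertices. The blocks `fin` list the graphs `o` from
earlier marked sets, and the blocks `bs` those from `cur`, the last one possibly incomplete. -/
structure BlockInv (G : SimpleGraph V) (K : Set V) (sets : List (Set V)) (order : List V)
    (marked : Set (Set V)) (cur : Set V) (o : List (PGraph V))
    (fin bs : List (List V × List (V × V))) : Prop where
  lists : List.Forall₂ Lists fin o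
  reach_clique : marked = ∅ → Reachable G K ⟨sets, order, marked, o⟩
  reach_marked : cur ∈ marked → ∀ cs : List (PGraph V),
    (cs.Nodup ∧ ∀ C, C ∈ cs ↔ C ∈ components G cur) → Reachable G K ⟨sets, order, marked, o ++ cs⟩
  cur_cases : (marked = ∅ ∧ cur = K) ∨ cur ∈ marked
  mem_cur : ∀ a, a ∉ order → (a ∈ K ∨ ∃ Y ∈ marked, a ∈ Y) → a ∈ cur
  nil_of_clique : marked = ∅ → fin = [] ∧ bs = []
  mem_block : cur ∈ marked → ∀ a, (∃ b ∈ bs, a ∈ b.1) ↔ a ∈ order ∧ a ∈ cur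
  nodup : (bs.map Prod.fst).flatten.Nodup
  joined : ∀ b ∈ bs, ∃ r ∈ b.1, ∀ a ∈ b.1, Joined G cur r a
  edges : ∀ b ∈ bs, b.2.Nodup ∧ ∀ e : V × V, e ∈ b.2 ↔ e.1 ∈ b.1 ∧ e.2 ∈ cur ∧ G.Adj e.1 e.2
  closed : ∀ b ∈ bs.dropLast, ∀ u ∈ b.1, ∀ w ∈ cur, G.Adj u w → w ∈ b.1

section

variable {sets : List (Set V)} {order : List V} {marked : Set (Set V)} {cur : Set V}
  {o : List (PGraph V)} {fin bs : List (List V × List (V × V))}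

theorem BlockInv.exists_reachable [Finite V] (h : BlockInv G K sets order marked cur o fin bs) :
    ∃ out, Reachable G K ⟨sets, order, marked, out⟩ := by
  rcases h.cur_cases with ⟨hm, -⟩ | hc
  · exact ⟨_, h.reach_clique hm⟩
  · obtain ⟨cs, hcs⟩ := exists_list_components G cur
    exact ⟨_, h.reach_marked hc cs hcs⟩

theorem BlockInv.cur_mem_of_block (h : BlockInv G K sets order marked cur o fin bs)
    {b : List V × List (V × V)} (hb : b ∈ bs) : cur ∈ marked := by
  rcases h.cur_cases with ⟨hm, -⟩ | hc
  · rw [(h.nil_of_clique hm).2] at hb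
    simp at hb
  · exact hc

/-- Only the last block can be incomplete. If a neighbour `w` of its vertex `u` lay in an earlier,
closed block, that block would also contain `u`, contrary to disjointness. -/
theorem BlockInv.closed_of_visited (h : BlockInv G K sets order marked cur o fin bs)
    (hvis : ∀ u ∈ order, u ∈ cur → ∀ w ∈ cur, G.Adj u w → w ∈ order) :
    ∀ b ∈ bs, ∀ u ∈ b.1, ∀ w ∈ cur, G.Adj u w → w ∈ b.1 := by
  intro b hb u hu w hw e
  have hc := h.cur_mem_of_block hb
  have huo := (h.mem_block hc u).1 ⟨b, hb, hu⟩
  obtain ⟨b', hb', hwb'⟩ := (h.mem_block hc w).2 ⟨hvis u huo.1 huo.2 w hw e, hw⟩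
  rcases List.eq_nil_or_concat bs with rfl | ⟨l, b₀, rfl⟩
  · simp at hb
  have hcl := h.closed
  have hnd := h.nodup
  rw [List.concat_eq_append, List.dropLast_concat] at hcl
  rw [List.concat_eq_append, List.mem_append, List.mem_singleton] at hb hb'
  rcases hb with hb | rfl
  · exact hcl b hb u hu w hw e
  · rcases hb' with hb' | rfl
    · have hub' := hcl b' hb' w hwb' u huo.2 e.symm
      simp only [List.concat_eq_append, List.map_append, List.map_cons, List.map_nil,
        List.flatten_append, List.flatten_cons, List.flatten_nil, List.append_nil] at hnd
      exact absurd rfl ((List.nodup_append.1 hnd).2.2 u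
        (List.mem_flatten.2 ⟨b'.1, List.mem_map_of_mem hb', hub'⟩) u hu)
    · exact hwb'

theorem mem_of_joined {cur : Set V} {l : List V} {r : V} (hr : r ∈ l)
    (hcl : ∀ u ∈ l, ∀ w ∈ cur, G.Adj u w → w ∈ l) {a : V} (h : Joined G cur r a) : a ∈ l := by
  induction h with
  | refl => exact hr
  | tail _ e ih => exact hcl _ ih _ e.2.2 e.1

/-- Each block is connected and closed under neighbours in `cur`, hence a component. Once `cur` is
exhausted, the blocks give a list of its components in order of discovery, which can serve as the
output of the step that marked `cur`. -/
theorem BlockInv.exists_components (h : BlockInv G K sets order marked cur o fin bs)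
    (hc : cur ∈ marked) (hvis : ∀ a ∈ cur, a ∈ order) :
    ∃ cs : List (PGraph V), (cs.Nodup ∧ ∀ C, C ∈ cs ↔ C ∈ components G cur) ∧
      List.Forall₂ Lists bs cs := by
  have hcl := h.closed_of_visited fun _ _ _ w hw _ => hvis w hw
  have hcur : ∀ b ∈ bs, ∀ a ∈ b.1, a ∈ cur := fun b hb a ha => ((h.mem_block hc a).1 ⟨b, hb, ha⟩).2
  have hnd := List.nodup_flatten.1 h.nodup
  let f : List V × List (V × V) → PGraph V := fun b =>
    ⟨{a | a ∈ b.1}, {e | e.1 ∈ {a | a ∈ b.1} ∧ e.2 ∈ {a | a ∈ b.1} ∧ G.Adj e.1 e.2}⟩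
  have hverts : ∀ b ∈ bs, ∀ r ∈ b.1, {a | a ∈ b.1} = {u | Joined G cur r u} := by
    intro b hb r hr
    ext a
    refine ⟨fun ha => ?_, fun ha => mem_of_joined hr (hcl b hb) ha⟩
    obtain ⟨r', hr', hj⟩ := h.joined b hb
    exact (hj r hr).symm.trans (hj a ha)
  refine ⟨bs.map f, ⟨?_, fun C => ?_⟩, ?_⟩
  · refine List.pairwise_map.2 ((List.pairwise_map.1 hnd.2).imp_of_mem ?_)
    intro b b' hb hb' hd e
    obtain ⟨r, hr, -⟩ := h.joined b hb
    have hr' : r ∈ (f b').verts := by rw [← e]; exact hr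
    exact hd hr hr'
  · rw [List.mem_map, mem_components_iff]
    constructor
    · rintro ⟨b, hb, rfl⟩
      obtain ⟨r, hr, -⟩ := h.joined b hb
      exact ⟨r, hcur b hb r hr, hverts b hb r hr, rfl⟩
    · rintro ⟨r, hr, hv, he⟩
      obtain ⟨b, hb, hrb⟩ := (h.mem_block hc r).2 ⟨hvis r hr, hr⟩
      rw [← hverts b hb r hrb] at hv
      rw [hv] at he
      exact ⟨b, hb, PGraph.ext hv.symm he.symm⟩
  · refine List.forall₂_map_right_iff.2 (List.forall₂_same.2 fun b hb => ?_)
    refine ⟨hnd.1 _ (List.mem_map_of_mem hb), fun v => Iff.rfl, (h.edges b hb).1, fun e => ?_⟩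
    rw [(h.edges b hb).2]
    exact ⟨fun he => ⟨he.1, hcl b hb _ he.1 _ he.2.1 he.2.2, he.2.2⟩,
      fun he => ⟨he.1, hcur b hb _ he.2.1, he.2.2⟩⟩

theorem BlockInv.finish (h : BlockInv G K sets order marked cur o fin bs)
    (hvis : ∀ a ∈ cur, a ∈ order) :
    ∃ o', List.Forall₂ Lists (fin ++ bs) o' ∧ Reachable G K ⟨sets, order, marked, o'⟩ := by
  rcases h.cur_cases with ⟨hm, -⟩ | hc
  · refine ⟨o, ?_, h.reach_clique hm⟩
    rw [(h.nil_of_clique hm).2, List.append_nil]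
    exact h.lists
  · obtain ⟨cs, hcs, hl⟩ := h.exists_components hc hvis
    exact ⟨o ++ cs, List.rel_append h.lists hl, h.reach_marked hc cs hcs⟩

variable {pre post : List (Set V)} {X : Set V} {v : V} {es : List (V × V)}

theorem BlockInv.visit_clique [Finite V] (hK : G.IsClique K)
    (h : BlockInv G K sets order marked cur o fin bs)
    (hsets : sets = pre ++ X :: post) (hpre : ∀ Y ∈ pre, Y = ∅) (hv : v ∈ X) (hvK : v ∈ K) :
    (fin = [] ∧ bs = []) ∧
      BlockInv G K (refine G v (pre ++ (X \ {v}) :: post)) (order ++ [v]) marked cur o fin bs := by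
  obtain ⟨out, hout⟩ := h.exists_reachable
  have hi := hout.inv hK
  have hvo := hi.first_notMem hsets hv
  have hm : cur ∉ marked := fun hc => hi.marked_clique cur hc v (h.mem_cur v hvo (Or.inl hvK)) hvK
  refine ⟨h.nil_of_clique (h.cur_cases.resolve_right hm).1, h.lists, fun hm => ?_,
    fun hc => absurd hc hm, h.cur_cases,
    fun a ha => h.mem_cur a fun h => ha (List.mem_append_left _ h), h.nil_of_clique, fun hc => absurd hc hm, h.nodup,
    h.joined, h.edges, h.closed⟩
  exact (h.reach_clique hm).tail (Step.old _ pre post X v hsets hpre hv (Or.inr hvK))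

/-- Leaving `cur` means that it is exhausted. Its components can then be fixed as output, and `X`
becomes the current set with a first one-vertex block. -/
theorem BlockInv.visit_new [Finite V] (hK : G.IsClique K)
    (h : BlockInv G K sets order marked cur o fin bs)
    (hsets : sets = pre ++ X :: post) (hpre : ∀ Y ∈ pre, Y = ∅) (hv : v ∈ X) (hvc : v ∉ cur)
    (hes : es.Nodup ∧ ∀ e : V × V, e ∈ es ↔ e.1 = v ∧ e.2 ∈ X ∧ G.Adj v e.2) :
    ∃ o', BlockInv G K (refine G v (pre ++ (X \ {v}) :: post)) (order ++ [v]) (insert X marked) X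
      o' (fin ++ bs) [([v], es)] := by
  obtain ⟨out, hout⟩ := h.exists_reachable
  have hi := hout.inv hK
  have hvo := hi.first_notMem hsets hv
  have hnew : ¬ ((∃ Y ∈ marked, v ∈ Y) ∨ v ∈ K) := fun hn => hvc (h.mem_cur v hvo hn.symm)
  -- An unvisited vertex of `cur` in the first set or in a later one would force `v` into `cur` as
  -- well.
  have hvis : ∀ a ∈ cur, a ∈ order := by
    intro a ha
    by_contra hao
    rcases hi.first hsets hpre hv hao with haX | hb
    · have ht := hi.first_twin hsets hv haX
      rcases h.cur_cases with ⟨-, rfl⟩ | hc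
      · exact hvc (ht.2.1.2 ha)
      · exact hvc ((ht.2.2 cur hc).2 ha)
    · rcases h.cur_cases with ⟨-, rfl⟩ | hc
      · exact hvc (hb.2.1 ha)
      · exact hvc (hb.2.2.1 cur hc ha)
  obtain ⟨o', hl, ho'⟩ := h.finish hvis
  refine ⟨o', hl, fun hm => absurd hm (Set.insert_nonempty _ _).ne_empty, fun _ cs hcs => ?_,
    Or.inr (Set.mem_insert _ _), fun a ha hm => ?_, fun hm => absurd hm (Set.insert_nonempty _ _).ne_empty,
    fun _ a => ?_, by simp, ?_, ?_, by simp⟩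
  · exact ho'.tail (Step.new _ pre post X v cs hsets hpre hv hnew hcs)
  · have hao : a ∉ order := fun h => ha (List.mem_append_left _ h)
    rcases hm with haK | ⟨Y, rfl | hY, haY⟩
    · exact absurd (hvis a (h.mem_cur a hao (Or.inl haK))) hao
    · exact haY
    · exact absurd (hvis a (h.mem_cur a hao (Or.inr ⟨Y, hY, haY⟩))) hao
  · simp only [List.mem_singleton, exists_eq_left, List.mem_append]
    constructor
    · rintro rfl
      exact ⟨Or.inr rfl, hv⟩
    · rintro ⟨ha | ha, haX⟩
      · exact absurd ha (hi.first_notMem hsets haX)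
      · exact ha
  · simp only [List.mem_singleton, forall_eq, exists_eq_left]
    exact .refl
  · simp only [List.mem_singleton, forall_eq]
    exact ⟨hes.1, fun e => (hes.2 e).trans ⟨fun ⟨h1, h2, h3⟩ => ⟨h1, h2, h1 ▸ h3⟩,
      fun ⟨h1, h2, h3⟩ => ⟨h1, h2, h1 ▸ h3⟩⟩⟩

theorem BlockInv.cur_mem (h : BlockInv G K sets order marked cur o fin bs) (hvc : v ∈ cur)
    (hvK : v ∉ K) : cur ∈ marked :=
  h.cur_cases.resolve_left fun e => hvK (e.2 ▸ hvc)

theorem BlockInv.visit_fresh [Finite V] (hK : G.IsClique K)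
    (h : BlockInv G K sets order marked cur o fin bs)
    (hsets : sets = pre ++ X :: post) (hpre : ∀ Y ∈ pre, Y = ∅) (hv : v ∈ X) (hvc : v ∈ cur)
    (hvK : v ∉ K) (hfresh : ∀ x ∈ order, x ∈ cur → ¬ G.Adj x v)
    (hes : es.Nodup ∧ ∀ e : V × V, e ∈ es ↔ e.1 = v ∧ e.2 ∈ cur ∧ G.Adj v e.2) :
    BlockInv G K (refine G v (pre ++ (X \ {v}) :: post)) (order ++ [v]) marked cur o fin
      (bs ++ [([v], es)]) := by
  obtain ⟨out, hout⟩ := h.exists_reachable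
  have hi := hout.inv hK
  have hvo := hi.first_notMem hsets hv
  have hc := h.cur_mem hvc hvK
  -- With no visited neighbour of `v` in `cur`, the old blocks are complete. Suppose that a visited
  -- `u` in `cur` has an unvisited neighbour `w` in `cur`. If `w` is in the set of `v`, then `u` is
  -- adjacent to `v`. Otherwise some visited `d` separates `v` from `w`: inside `cur` it contradicts
  -- freshness, outside `cur` it contradicts `twin_marked`.
  have hcl := h.closed_of_visited (fun u hu huc w hw e => by
    by_contra hwo
    rcases hi.first hsets hpre hv hwo with hwX | ⟨-, -, -, ⟨d, hd, hdv, hdw⟩ | hb⟩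
    · exact hfresh u hu huc (((hi.first_twin hsets hv hwX).1 u hu).2 e)
    · by_cases hdc : d ∈ cur
      · exact hfresh d hd hdc hdv
      · exact hdw ((hi.twin_marked cur hc v hvc w hw hvo hwo d hd hdc).1 hdv)
    · exact hvK hb.1)
  refine ⟨h.lists, fun hm => absurd hc (by simp [hm]), fun _ cs hcs => ?_, h.cur_cases,
    fun a ha => h.mem_cur a fun h => ha (List.mem_append_left _ h),
    fun hm => absurd hc (by simp [hm]), fun _ a => ?_, ?_, ?_, ?_, ?_⟩
  · exact (h.reach_marked hc cs hcs).tail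
      (Step.old _ pre post X v hsets hpre hv (Or.inl ⟨cur, hc, hvc⟩))
  · have := h.mem_block hc a
    simp only [List.mem_append, List.mem_singleton, or_and_right, exists_or, exists_eq_left, this]
    constructor
    · rintro (h1 | rfl)
      · exact Or.inl h1
      · exact Or.inr ⟨rfl, hvc⟩
    · rintro (h1 | h1)
      · exact Or.inl h1
      · exact Or.inr h1.1
  · simp only [List.map_append, List.map_cons, List.map_nil, List.flatten_append, List.flatten_cons,
      List.flatten_nil, List.append_nil]
    refine List.nodup_append.2 ⟨h.nodup, List.nodup_singleton v, fun a ha b hb e => ?_⟩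
    rw [List.mem_singleton] at hb
    subst hb e
    obtain ⟨l, hl, hal⟩ := List.mem_flatten.1 ha
    obtain ⟨b, hb, rfl⟩ := List.mem_map.1 hl
    exact hvo ((h.mem_block hc a).1 ⟨b, hb, hal⟩).1
  · intro b hb
    rcases List.mem_append.1 hb with hb | hb
    · exact h.joined b hb
    · obtain rfl := List.mem_singleton.1 hb
      exact ⟨v, List.mem_singleton_self v, fun a ha => List.mem_singleton.1 ha ▸ .refl⟩
  · intro b hb
    rcases List.mem_append.1 hb with hb | hb
    · exact h.edges b hb
    · obtain rfl := List.mem_singleton.1 hb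
      refine ⟨hes.1, fun e => (hes.2 e).trans ?_⟩
      rw [List.mem_singleton]
      exact ⟨fun ⟨h1, h2, h3⟩ => ⟨h1, h2, h1 ▸ h3⟩, fun ⟨h1, h2, h3⟩ => ⟨h1, h2, h1 ▸ h3⟩⟩
  · rw [List.dropLast_concat]
    exact hcl

/-- The visited neighbour `x` must lie in the last block, since all others are closed and do not
contain `v`; so `v` continues the component under construction. -/
theorem BlockInv.visit_extend [Finite V] (hK : G.IsClique K)
    (h : BlockInv G K sets order marked cur o fin bs)
    (hsets : sets = pre ++ X :: post) (hpre : ∀ Y ∈ pre, Y = ∅) (hv : v ∈ X) (hvc : v ∈ cur)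
    (hvK : v ∉ K) {x : V} (hx : x ∈ order) (hxc : x ∈ cur) (hxv : G.Adj x v)
    (hes : es.Nodup ∧ ∀ e : V × V, e ∈ es ↔ e.1 = v ∧ e.2 ∈ cur ∧ G.Adj v e.2) :
    ∃ l b, bs = l ++ [b] ∧ BlockInv G K (refine G v (pre ++ (X \ {v}) :: post)) (order ++ [v])
      marked cur o fin (l ++ [(b.1 ++ [v], b.2 ++ es)]) := by
  obtain ⟨out, hout⟩ := h.exists_reachable
  have hi := hout.inv hK
  have hvo := hi.first_notMem hsets hv
  have hc := h.cur_mem hvc hvK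
  obtain ⟨b', hb', hxb'⟩ := (h.mem_block hc x).2 ⟨hx, hxc⟩
  rcases List.eq_nil_or_concat bs with rfl | ⟨l, b, hbs⟩
  · simp at hb'
  rw [List.concat_eq_append] at hbs
  subst hbs
  have hcl := h.closed
  rw [List.dropLast_concat] at hcl
  have hblo : ∀ c ∈ l ++ [b], v ∉ c.1 := fun c hc' hvm =>
    hvo ((h.mem_block hc v).1 ⟨c, hc', hvm⟩).1
  have hxb : x ∈ b.1 := by
    rcases List.mem_append.1 hb' with hl | hl
    · exact absurd (hcl b' hl x hxb' v hvc hxv) (hblo b' hb')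
    · exact List.mem_singleton.1 hl ▸ hxb'
  have hbm : b ∈ l ++ [b] := by simp
  refine ⟨l, b, rfl, h.lists, fun hm => absurd hc (by simp [hm]), fun _ cs hcs => ?_, h.cur_cases,
    fun a ha => h.mem_cur a fun h => ha (List.mem_append_left _ h),
    fun hm => absurd hc (by simp [hm]), fun _ a => ?_, ?_, ?_, ?_, ?_⟩
  · exact (h.reach_marked hc cs hcs).tail
      (Step.old _ pre post X v hsets hpre hv (Or.inl ⟨cur, hc, hvc⟩))
  · have := h.mem_block hc a
    simp only [List.mem_append, List.mem_singleton, or_and_right, exists_or, exists_eq_left] at this ⊢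
    rw [← or_assoc, this]
    constructor
    · rintro (h1 | rfl)
      · exact Or.inl h1
      · exact Or.inr ⟨rfl, hvc⟩
    · rintro (h1 | h1)
      · exact Or.inl h1
      · exact Or.inr h1.1
  · have hnd := h.nodup
    simp only [List.map_append, List.map_cons, List.map_nil, List.flatten_append, List.flatten_cons,
      List.flatten_nil, List.append_nil] at hnd ⊢
    rw [← List.append_assoc]
    refine List.nodup_append.2 ⟨hnd, List.nodup_singleton v, fun a ha a' hb e => ?_⟩
    rw [List.mem_singleton] at hb
    subst hb e
    rcases List.mem_append.1 ha with ha | ha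
    · obtain ⟨l', hl, hal⟩ := List.mem_flatten.1 ha
      obtain ⟨c, hcl, rfl⟩ := List.mem_map.1 hl
      exact hblo c (List.mem_append_left _ hcl) hal
    · exact hblo b hbm ha
  · intro c hc'
    rcases List.mem_append.1 hc' with hc' | hc'
    · exact h.joined c (List.mem_append_left _ hc')
    · obtain rfl := List.mem_singleton.1 hc'
      obtain ⟨r, hr, hj⟩ := h.joined b hbm
      refine ⟨r, List.mem_append_left _ hr, fun a ha => ?_⟩
      rcases List.mem_append.1 ha with ha | ha
      · exact hj a ha
      · obtain rfl := List.mem_singleton.1 ha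
        exact (hj x hxb).tail ⟨hxv, hxc, hvc⟩
  · intro c hc'
    rcases List.mem_append.1 hc' with hc' | hc'
    · exact h.edges c (List.mem_append_left _ hc')
    · obtain rfl := List.mem_singleton.1 hc'
      obtain ⟨h1, h2⟩ := h.edges b hbm
      refine ⟨List.nodup_append.2 ⟨h1, hes.1, fun e he e' he' hee => ?_⟩, fun e => ?_⟩
      · subst hee
        exact hblo b hbm (((hes.2 e).1 he').1 ▸ ((h2 e).1 he).1)
      · simp only [List.mem_append, h2, hes.2, List.mem_singleton]
        constructor
        · rintro (⟨h3, h4⟩ | ⟨h3, h4, h5⟩)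
          · exact ⟨Or.inl h3, h4⟩
          · exact ⟨Or.inr h3, h4, h3 ▸ h5⟩
        · rintro ⟨h3 | h3, h4, h5⟩
          · exact Or.inl ⟨h3, h4, h5⟩
          · exact Or.inr ⟨h3, h4, h3 ▸ h5⟩
  · rw [List.dropLast_concat]
    exact hcl

end

/-- The blocks list the graphs that the search has output so far, up to the incompleteness of the
last block. -/
def Simulates (G : SimpleGraph V) (K : Set V) (sets : List (Set V)) (order : List V)
    (marked : Set (Set V)) (cur : Set V) (blocks : List (List V × List (V × V))) : Prop :=
  ∃ o fin bs, blocks = fin ++ bs ∧ BlockInv G K sets order marked cur o fin bs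

theorem Simulates.init (G : SimpleGraph V) (K : Set V) : Simulates G K [K, Kᶜ] [] ∅ K [] :=
  ⟨[], [], [], rfl, .nil, fun _ => .refl, by simp, by simp, by simp, by simp, by simp, by simp,
    by simp, by simp, by simp⟩

variable {sets : List (Set V)} {order : List V} {marked : Set (Set V)} {cur : Set V}
  {blocks : List (List V × List (V × V))} {pre post : List (Set V)} {X : Set V} {v : V}
  {es : List (V × V)}

theorem Simulates.exists_inv [Finite V] (hK : G.IsClique K)
    (h : Simulates G K sets order marked cur blocks) :
    ∃ out, LState.Inv G K ⟨sets, order, marked, out⟩ := by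
  obtain ⟨o, fin, bs, rfl, h⟩ := h
  obtain ⟨out, hout⟩ := h.exists_reachable
  exact ⟨out, hout.inv hK⟩

theorem Simulates.visit_clique [Finite V] (hK : G.IsClique K)
    (h : Simulates G K sets order marked cur blocks)
    (hsets : sets = pre ++ X :: post) (hpre : ∀ Y ∈ pre, Y = ∅) (hv : v ∈ X) (hvK : v ∈ K) :
    blocks = [] ∧
      Simulates G K (refine G v (pre ++ (X \ {v}) :: post)) (order ++ [v]) marked cur [] := by
  obtain ⟨o, fin, bs, rfl, h⟩ := h
  obtain ⟨⟨rfl, rfl⟩, h'⟩ := h.visit_clique hK hsets hpre hv hvK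
  exact ⟨rfl, o, [], [], rfl, h'⟩

theorem Simulates.mem_cur (h : Simulates G K sets order marked cur blocks) (hv : v ∉ order)
    (hvm : v ∈ K ∨ ∃ Y ∈ marked, v ∈ Y) : v ∈ cur := by
  obtain ⟨o, fin, bs, rfl, h⟩ := h
  exact h.mem_cur v hv hvm

theorem Simulates.visit_new [Finite V] (hK : G.IsClique K)
    (h : Simulates G K sets order marked cur blocks)
    (hsets : sets = pre ++ X :: post) (hpre : ∀ Y ∈ pre, Y = ∅) (hv : v ∈ X) (hvc : v ∉ cur)
    (hes : es.Nodup ∧ ∀ e : V × V, e ∈ es ↔ e.1 = v ∧ e.2 ∈ X ∧ G.Adj v e.2) :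
    Simulates G K (refine G v (pre ++ (X \ {v}) :: post)) (order ++ [v]) (insert X marked) X
      (blocks ++ [([v], es)]) := by
  obtain ⟨o, fin, bs, rfl, h⟩ := h
  obtain ⟨o', h'⟩ := h.visit_new hK hsets hpre hv hvc hes
  exact ⟨o', fin ++ bs, _, rfl, h'⟩

theorem Simulates.visit_fresh [Finite V] (hK : G.IsClique K)
    (h : Simulates G K sets order marked cur blocks)
    (hsets : sets = pre ++ X :: post) (hpre : ∀ Y ∈ pre, Y = ∅) (hv : v ∈ X) (hvc : v ∈ cur)
    (hvK : v ∉ K) (hfresh : ∀ x ∈ order, x ∈ cur → ¬ G.Adj x v)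
    (hes : es.Nodup ∧ ∀ e : V × V, e ∈ es ↔ e.1 = v ∧ e.2 ∈ cur ∧ G.Adj v e.2) :
    Simulates G K (refine G v (pre ++ (X \ {v}) :: post)) (order ++ [v]) marked cur
      (blocks ++ [([v], es)]) := by
  obtain ⟨o, fin, bs, rfl, h⟩ := h
  exact ⟨o, fin, _, List.append_assoc _ _ _, h.visit_fresh hK hsets hpre hv hvc hvK hfresh hes⟩

theorem Simulates.visit_extend [Finite V] (hK : G.IsClique K)
    (h : Simulates G K sets order marked cur blocks)
    (hsets : sets = pre ++ X :: post) (hpre : ∀ Y ∈ pre, Y = ∅) (hv : v ∈ X) (hvc : v ∈ cur)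
    (hvK : v ∉ K) {x : V} (hx : x ∈ order) (hxc : x ∈ cur) (hxv : G.Adj x v)
    (hes : es.Nodup ∧ ∀ e : V × V, e ∈ es ↔ e.1 = v ∧ e.2 ∈ cur ∧ G.Adj v e.2) :
    ∃ l b, blocks = l ++ [b] ∧ Simulates G K (refine G v (pre ++ (X \ {v}) :: post))
      (order ++ [v]) marked cur (l ++ [(b.1 ++ [v], b.2 ++ es)]) := by
  obtain ⟨o, fin, bs, rfl, h⟩ := h
  obtain ⟨l, b, rfl, h'⟩ := h.visit_extend hK hsets hpre hv hvc hvK hx hxc hxv hes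
  exact ⟨fin ++ l, b, (List.append_assoc _ _ _).symm, o, fin, _, List.append_assoc _ _ _, h'⟩

/-- Only here is the order of the last set's output fixed, so the blocks match the output of a
genuine complete run. -/
theorem Simulates.finish [Finite V] (hK : G.IsClique K)
    (h : Simulates G K sets order marked cur blocks) (hd : ∀ Y ∈ sets, Y = ∅) :
    ∃ s : LState V, Reachable G K s ∧ s.Done ∧ s.order = order ∧
      List.Forall₂ Lists blocks s.out := by
  obtain ⟨out, hi⟩ := h.exists_inv hK
  obtain ⟨o, fin, bs, rfl, h⟩ := h
  obtain ⟨o', hl, ho'⟩ := h.finish fun a _ => by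
    by_contra hao
    obtain ⟨A, hA, haA⟩ := (hi.cover a).1 hao
    rw [hd A hA] at haA
    exact haA
  exact ⟨_, ho', hd, rfl, hl⟩

end Blocks
end ModLBFS

namespace ModLBFS

/-! ### Executing programs and bounding their time -/

section Runs

/-- The program that runs the listed programs one after the other. -/
def Prog.block : List Prog → Prog
  | [] => .skip
  | p :: l => .seq p (block l)

def Prog.LoopFree : Prog → Prop
  | .seq p q => p.LoopFree ∧ q.LoopFree
  | .ite _ p q => p.LoopFree ∧ q.LoopFree
  | .loop _ _ => False
  | _ => True

open scoped Classical in
/-- The memory after a loop-free program. -/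
noncomputable def Prog.run : Prog → Store → Store
  | .skip, s => s
  | .assign x e, s => s.setVar x (e.eval s)
  | .write a i e, s => s.setCell a (i.eval s) (e.eval s)
  | .seq p q, s => q.run (p.run s)
  | .ite b p q, s => if b.Holds s then p.run s else q.run s
  | .loop _ _, s => s

/-- A bound for the running time of a loop-free program. -/
def Prog.maxCost : Prog → ℕ
  | .skip => 1
  | .assign _ e => e.cost + 1
  | .write _ i e => i.cost + e.cost + 1
  | .seq p q => p.maxCost + q.maxCost
  | .ite b p q => b.cost + max p.maxCost q.maxCost
  | .loop _ _ => 0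

theorem Prog.LoopFree.exec {p : Prog} (h : p.LoopFree) (s : Store) :
    ∃ T, Exec p s T (p.run s) ∧ T ≤ p.maxCost := by
  induction p generalizing s with
  | skip => exact ⟨_, .skip s, le_rfl⟩
  | assign x e => exact ⟨_, .assign s x e, le_rfl⟩
  | write a i e => exact ⟨_, .write s a i e, le_rfl⟩
  | seq p q hp hq =>
    obtain ⟨T, hT, hTle⟩ := hp h.1 s
    obtain ⟨U, hU, hUle⟩ := hq h.2 (p.run s)
    exact ⟨_, .seq hT hU, add_le_add hTle hUle⟩
  | ite b p q hp hq =>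
    by_cases hb : b.Holds s
    · obtain ⟨T, hT, hTle⟩ := hp h.1 s
      refine ⟨_, .iteTrue hb (by rwa [Prog.run, if_pos hb]), ?_⟩
      exact Nat.add_le_add_left (hTle.trans (le_max_left _ _)) _
    · obtain ⟨T, hT, hTle⟩ := hq h.2 s
      refine ⟨_, .iteFalse hb (by rwa [Prog.run, if_neg hb]), ?_⟩
      exact Nat.add_le_add_left (hTle.trans (le_max_right _ _)) _
  | loop b p => exact h.elim

/-- A loop with `N` iterations and an invariant that depends on the number `j` of iterations and
on the time `τ` that they took. -/
theorem exec_loop {b : Test} {p : Prog} (I : ℕ → ℕ → Store → Prop) (N : ℕ)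
    (hb : ∀ j τ s, j ≤ N → I j τ s → (b.Holds s ↔ j < N))
    (hp : ∀ j τ s, j < N → I j τ s → ∃ T t, Exec p s T t ∧ I (j + 1) (τ + b.cost + T) t) (k : ℕ) :
    ∀ j τ s, j + k = N → I j τ s → ∃ T t, Exec (.loop b p) s T t ∧
      ∃ τ', I N τ' t ∧ τ + T = τ' + b.cost := by
  induction k with
  | zero =>
    intro j τ s hj h
    have : ¬ b.Holds s := fun hbs => by
      have := (hb j τ s (by omega) h).1 hbs
      omega
    obtain rfl : j = N := by omega
    exact ⟨_, s, .loopFalse this, τ, h, rfl⟩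
  | succ k ih =>
    intro j τ s hj h
    obtain ⟨T, t, hT, ht⟩ := hp j τ s (by omega) h
    obtain ⟨U, u, hU, τ', hu, hτ⟩ := ih (j + 1) _ t (by omega) ht
    exact ⟨_, u, .loopTrue ((hb j τ s (by omega) h).2 (by omega)) hT hU, τ', hu, by omega⟩

/-- A loop with `N` iterations that take a bounded time each. -/
theorem exec_loop_bounded {b : Test} {p : Prog} (I : ℕ → Store → Prop) (N c : ℕ)
    (hb : ∀ j s, j ≤ N → I j s → (b.Holds s ↔ j < N))
    (hp : ∀ j s, j < N → I j s → ∃ T t, Exec p s T t ∧ T ≤ c ∧ I (j + 1) t) {s : Store}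
    (hs : I 0 s) :
    ∃ T t, Exec (.loop b p) s T t ∧ I N t ∧ T ≤ N * (b.cost + c) + b.cost := by
  obtain ⟨T, t, hT, τ', ⟨ht, hτ⟩, h⟩ := exec_loop (b := b) (p := p)
    (fun j τ s => I j s ∧ τ ≤ j * (b.cost + c)) N (fun j τ s hj h => hb j s hj h.1)
    (fun j τ s hj h => by
      obtain ⟨T, t, hT, hTc, ht⟩ := hp j s hj h.1
      refine ⟨T, t, hT, ht, ?_⟩
      rw [Nat.succ_mul]
      omega) N 0 0 s (by omega) ⟨hs, by simp⟩
  exact ⟨T, t, hT, ht, by omega⟩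

@[simp] theorem Store.setVar_vars (s : Store) (x k y : ℕ) :
    (s.setVar x k).vars y = if y = x then k else s.vars y := by
  simp [Store.setVar, Function.update_apply]

@[simp] theorem Store.setVar_arrs (s : Store) (x k : ℕ) : (s.setVar x k).arrs = s.arrs := rfl

@[simp] theorem Store.setCell_vars (s : Store) (a i k : ℕ) : (s.setCell a i k).vars = s.vars := rfl

@[simp] theorem Store.setCell_arrs (s : Store) (a i k b : ℕ) :
    (s.setCell a i k).arrs b = if b = a then Function.update (s.arrs a) i k else s.arrs b := by
  simp [Store.setCell, Function.update_apply]

end Runs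

/-! ### The partition tables and the constant-time move -/

section Moves

/-- The partition of the unvisited vertices: the vertex at each position, the position and the
class of each vertex, the first position of each class, the class that was last split off from
each class, the group of each class, and the next unused class. -/
structure Tables where
  ord : ℕ → ℕ
  pos : ℕ → ℕ
  cls : ℕ → ℕ
  first : ℕ → ℕ
  target : ℕ → ℕ
  grp : ℕ → ℕ
  next : ℕ

def Store.tables (s : Store) : Tables :=
  ⟨s.arrs 3, s.arrs 9, s.arrs 10, s.arrs 11, s.arrs 12, s.arrs 13, s.vars 4⟩

/-- Move the vertex `w` to the front of its class, into the class that is split off from it in the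
present round; the classes that were made in this round are those from `base` on. -/
def Tables.move (T : Tables) (base w : ℕ) : Tables :=
  let c := T.cls w
  let p := T.first c
  -- A target below `base` is left over from an earlier round, so the class has not been split yet
  -- in this one. This test makes clearing the targets between rounds unnecessary.
  let tgt := if T.target c < base then Function.update T.target c T.next else T.target
  { ord := Function.update (Function.update T.ord p w) (T.pos w) (T.ord p)
    pos := Function.update (Function.update T.pos w p) (T.ord p) (T.pos w)
    cls := Function.update T.cls w (tgt c)
    first := Function.update
      (if T.target c < base then Function.update T.first T.next p else T.first) c (p + 1)
    target := tgt
    grp := if T.target c < base then Function.update T.grp T.next (T.grp c) else T.grp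
    next := if T.target c < base then T.next + 1 else T.next }

/-- The program for `Tables.move`, with the vertex in register `11`. -/
def moveProg : Prog := .block [
  .assign 12 (.read 10 (.var 11)),
  .assign 13 (.read 11 (.var 12)),
  .assign 15 (.read 9 (.var 11)),
  .assign 14 (.read 3 (.var 13)),
  .write 3 (.var 13) (.var 11),
  .write 3 (.var 15) (.var 14),
  .write 9 (.var 11) (.var 13),
  .write 9 (.var 14) (.var 15),
  .ite (.lt (.read 12 (.var 12)) (.var 5)) (.block [
    .write 12 (.var 12) (.var 4),
    .write 11 (.var 4) (.var 13),
    .write 13 (.var 4) (.read 13 (.var 12)),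
    .assign 4 (.succ (.var 4))]) .skip,
  .write 10 (.var 11) (.read 12 (.var 12)),
  .write 11 (.var 12) (.succ (.var 13))]

theorem moveProg_loopFree : moveProg.LoopFree := by
  simp [moveProg, Prog.block, Prog.LoopFree]

theorem run_moveProg_tables (s : Store) :
    (moveProg.run s).tables = s.tables.move (s.vars 5) (s.vars 11) := by
  by_cases h : s.arrs 12 (s.arrs 10 (s.vars 11)) < s.vars 5 <;>
    simp [moveProg, Prog.block, Prog.run, Expr.eval, Test.Holds, Store.tables, Tables.move, h]

theorem run_moveProg_vars (s : Store) {x : ℕ} (h : x ≠ 4 ∧ x ≠ 12 ∧ x ≠ 13 ∧ x ≠ 14 ∧ x ≠ 15) :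
    (moveProg.run s).vars x = s.vars x := by
  by_cases h' : s.arrs 12 (s.arrs 10 (s.vars 11)) < s.vars 5 <;>
    simp [moveProg, Prog.block, Prog.run, Expr.eval, Test.Holds, h, h']

theorem run_moveProg_arrs (s : Store) {a : ℕ}
    (h : a ≠ 3 ∧ a ≠ 9 ∧ a ≠ 10 ∧ a ≠ 11 ∧ a ≠ 12 ∧ a ≠ 13) :
    (moveProg.run s).arrs a = s.arrs a := by
  by_cases h' : s.arrs 12 (s.arrs 10 (s.vars 11)) < s.vars 5 <;>
    simp [moveProg, Prog.block, Prog.run, Expr.eval, Test.Holds, h, h']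

end Moves
end ModLBFS

namespace ModLBFS

/-! ### Correctness of partition refinement on an array -/

section Partition

variable {n : ℕ}

/-- Positions are a permutation, and the classes of the vertices from position `lo` on are
intervals with the recorded first positions. -/
structure Parts (n lo : ℕ) (T : Tables) : Prop where
  pos_lt : ∀ a : Fin n, T.pos a < n
  ord_pos : ∀ a : Fin n, T.ord (T.pos a) = a
  exists_pos : ∀ p < n, ∃ a : Fin n, T.pos a = p
  interval : ∀ a b d : Fin n, lo ≤ T.pos a → T.pos a ≤ T.pos b → T.pos b ≤ T.pos d →
    T.cls a = T.cls d → T.cls b = T.cls a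
  first_le : ∀ a : Fin n, lo ≤ T.pos a → lo ≤ T.first (T.cls a) ∧ T.first (T.cls a) ≤ T.pos a
  first_cls : ∀ a b : Fin n, lo ≤ T.pos a → T.pos b = T.first (T.cls a) → T.cls b = T.cls a
  cls_lt : ∀ a : Fin n, T.cls a < T.next
  target_lt : ∀ c, T.target c < T.next

/-- The tables `T` arise from `T₀` by moving the vertices in `D`, all of them at positions from
`lo` on. -/
structure Moved (n lo : ℕ) (T₀ : Tables) (D : Set (Fin n)) (T : Tables) : Prop where
  pos_lt : ∀ a : Fin n, T.pos a < n
  ord_pos : ∀ a : Fin n, T.ord (T.pos a) = a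
  exists_pos : ∀ p < n, ∃ a : Fin n, T.pos a = p
  low : ∀ a : Fin n, T.pos a < lo ↔ T₀.pos a < lo
  low_eq : ∀ a : Fin n, T₀.pos a < lo → T.pos a = T₀.pos a ∧ T.cls a = T₀.cls a
  same : ∀ a b : Fin n, lo ≤ T.pos a → T.pos a = T₀.pos b → T₀.cls b = T₀.cls a
  split : ∀ a : Fin n, lo ≤ T.pos a → (a ∈ D ↔ T.pos a < T.first (T₀.cls a))
  cls_mem : ∀ a : Fin n, a ∈ D → T.cls a = T.target (T₀.cls a)
  cls_notMem : ∀ a : Fin n, a ∉ D → T.cls a = T₀.cls a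
  le_target : ∀ a : Fin n, a ∈ D → T₀.next ≤ T.target (T₀.cls a)
  first_le : ∀ c, T₀.first c ≤ T.first c ∨ T₀.next ≤ c
  first_old : ∀ c < T₀.next, T.target c < T₀.next → T.first c = T₀.first c
  first_target : ∀ c < T₀.next, T₀.next ≤ T.target c → T.first (T.target c) = T₀.first c
  target_inj : ∀ c < T₀.next, ∀ d < T₀.next, T₀.next ≤ T.target c → T.target c = T.target d → c = d
  target_lt : ∀ c, T.target c < T.next
  next_le : T₀.next ≤ T.next
  grp_old : ∀ c < T₀.next, T.grp c = T₀.grp c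
  grp_target : ∀ c < T₀.next, T₀.next ≤ T.target c → T.grp (T.target c) = T₀.grp c

variable {lo : ℕ} {T₀ T : Tables} {D : Set (Fin n)}

/-- The start of a round: all targets are below `next`, so the clauses about classes made in this
round are vacuous. -/
theorem Parts.moved (h : Parts n lo T) : Moved n lo T ∅ T := by
  have hinj : ∀ a b : Fin n, T.pos a = T.pos b → a = b := fun a b e =>
    Fin.ext (by rw [← h.ord_pos a, ← h.ord_pos b, e])
  constructor
  · exact h.pos_lt
  · exact h.ord_pos
  · exact h.exists_pos
  · exact fun _ => Iff.rfl
  · exact fun _ _ => ⟨rfl, rfl⟩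
  · intro a b _ e
    rw [hinj a b e]
  · intro a ha
    have := (h.first_le a ha).2
    simp only [Set.mem_empty_iff_false, false_iff]
    omega
  · simp
  · simp
  · simp
  · exact fun c => Or.inl le_rfl
  · exact fun _ _ _ => rfl
  · intro c _ hc
    have := h.target_lt c
    omega
  · intro c _ _ _ hc
    have := h.target_lt c
    omega
  · exact h.target_lt
  · exact le_rfl
  · exact fun _ _ => rfl
  · intro c _ hc
    have := h.target_lt c
    omega

theorem Moved.pos_inj (h : Moved n lo T₀ D T) {a b : Fin n} (e : T.pos a = T.pos b) : a = b :=
  Fin.ext (by rw [← h.ord_pos a, ← h.ord_pos b, e])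

/-- Moves permute vertices within their old classes. The old occupants of the three positions have
the same old classes, so the old interval property carries over. -/
theorem Moved.cls_same (h : Moved n lo T₀ D T) (h₀ : Parts n lo T₀) {a b d : Fin n}
    (ha : lo ≤ T.pos a) (hab : T.pos a ≤ T.pos b) (hbd : T.pos b ≤ T.pos d)
    (had : T₀.cls a = T₀.cls d) : T₀.cls b = T₀.cls a := by
  obtain ⟨a', ha'⟩ := h₀.exists_pos _ (h.pos_lt a)
  obtain ⟨b', hb'⟩ := h₀.exists_pos _ (h.pos_lt b)
  obtain ⟨d', hd'⟩ := h₀.exists_pos _ (h.pos_lt d)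
  rw [← h.same a a' ha ha'.symm, ← h.same b b' (by omega) hb'.symm]
  refine h₀.interval a' b' d' (by omega) (by omega) (by omega) ?_
  rw [h.same a a' ha ha'.symm, h.same d d' (by omega) hd'.symm, had]

theorem Moved.first_le_pos (h : Moved n lo T₀ D T) (h₀ : Parts n lo T₀) {a : Fin n}
    (ha : lo ≤ T.pos a) : lo ≤ T₀.first (T₀.cls a) ∧ T₀.first (T₀.cls a) ≤ T.pos a := by
  obtain ⟨a', ha'⟩ := h₀.exists_pos _ (h.pos_lt a)
  have := h₀.first_le a' (by omega)
  rw [h.same a a' ha ha'.symm] at this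
  omega

/-- The vertices between the first position of a class and one of its members are in the class. -/
theorem Moved.cls_of_between (h : Moved n lo T₀ D T) (h₀ : Parts n lo T₀) {a b : Fin n}
    (ha : lo ≤ T.pos a) (hb : T₀.first (T₀.cls a) ≤ T.pos b) (hba : T.pos b ≤ T.pos a) :
    T₀.cls b = T₀.cls a := by
  have hf := h.first_le_pos h₀ ha
  have := h.pos_lt a
  obtain ⟨f, hf'⟩ := h₀.exists_pos (T₀.first (T₀.cls a)) (by omega)
  obtain ⟨b', hb'⟩ := h₀.exists_pos _ (h.pos_lt b)
  obtain ⟨a', ha'⟩ := h₀.exists_pos _ (h.pos_lt a)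
  have haa := h.same a a' ha ha'.symm
  have hff : T₀.cls f = T₀.cls a' := h₀.first_cls a' f (by omega) (by rw [hf', haa])
  rw [← h.same b b' (by omega) hb'.symm, ← haa, ← hff]
  exact h₀.interval f b' a' (by omega) (by omega) (by omega) hff

/-- `w` is swapped with the first unmoved vertex `x` of its old class `c`, and the boundary `first
c` advances past it. The moved vertices of `c` thus always occupy the front of the interval of `c`
and form one new class. -/
theorem Moved.move (h : Moved n lo T₀ D T) (h₀ : Parts n lo T₀) {w : Fin n} (hwD : w ∉ D)
    (hw : lo ≤ T₀.pos w) : Moved n lo T₀ (insert w D) (T.move T₀.next w) := by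
  have hwlo : lo ≤ T.pos w := by
    have := h.low w
    omega
  have hcw : T.cls w = T₀.cls w := h.cls_notMem w hwD
  have hwn := h.pos_lt w
  set c := T₀.cls w with hc
  have hcn : c < T₀.next := h₀.cls_lt w
  have hpw : T.first c ≤ T.pos w := by
    have := mt (h.split w hwlo).2 hwD
    rw [← hc] at this
    omega
  have hp0 : T₀.first c ≤ T.first c := (h.first_le c).resolve_right (by omega)
  have hplo : lo ≤ T.first c := (h.first_le_pos h₀ hwlo).1.trans hp0
  obtain ⟨x, hx⟩ := h.exists_pos (T.first c) (by omega)
  have hcx : T₀.cls x = c := h.cls_of_between h₀ hwlo (by rw [← hc]; omega) (by omega)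
  have hxD : x ∉ D := fun hxD => by
    have := (h.split x (by omega)).1 hxD
    rw [hcx] at this
    omega
  have hox : T.ord (T.first c) = x := by rw [← hx, h.ord_pos]
  have hnn := h.next_le
  -- The case `x = w` is allowed: then both branches give the same position and nothing is swapped.
  have hpos : ∀ a : Fin n, (T.move T₀.next w).pos a =
      if a = x then T.pos w else if a = w then T.first c else T.pos a := by
    intro a
    simp only [Tables.move, hcw, hox, Function.update_apply, Fin.val_inj]
  have hord : ∀ r, (T.move T₀.next w).ord r =
      if r = T.pos w then (x : ℕ) else if r = T.first c then (w : ℕ) else T.ord r := by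
    intro r
    simp only [Tables.move, hcw, hox, Function.update_apply]
  have htgt : ∀ d, (T.move T₀.next w).target d =
      if d = c ∧ T.target c < T₀.next then T.next else T.target d := by
    intro d
    by_cases hf : T.target c < T₀.next <;>
      simp [Tables.move, hcw, hf, Function.update_apply]
  have hcls : ∀ a : Fin n, (T.move T₀.next w).cls a =
      if a = w then (T.move T₀.next w).target c else T.cls a := by
    intro a
    simp only [Tables.move, hcw, Function.update_apply, Fin.val_inj]
  have hfirst : ∀ d, (T.move T₀.next w).first d =
      if d = c then T.first c + 1 else if d = T.next ∧ T.target c < T₀.next then T.first c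
      else T.first d := by
    intro d
    by_cases hf : T.target c < T₀.next <;>
      simp [Tables.move, hcw, hf, Function.update_apply]
  have hgrp : ∀ d, (T.move T₀.next w).grp d =
      if d = T.next ∧ T.target c < T₀.next then T.grp c else T.grp d := by
    intro d
    by_cases hf : T.target c < T₀.next <;>
      simp [Tables.move, hcw, hf, Function.update_apply]
  have hnext : (T.move T₀.next w).next = if T.target c < T₀.next then T.next + 1 else T.next := by
    simp only [Tables.move, hcw]
  have hinj := fun a b => @Moved.pos_inj n lo T₀ T D h a b
  generalize T.move T₀.next w = T' at *
  constructor
  · intro a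
    have := h.pos_lt a
    rw [hpos]
    split_ifs <;> omega
  · intro a
    rw [hpos]
    by_cases hax : a = x
    · rw [if_pos hax, hord, if_pos rfl, hax]
    · rw [if_neg hax]
      by_cases haw : a = w
      · rw [if_pos haw, hord, if_pos rfl, if_neg, haw]
        intro e
        exact hax (haw ▸ (hinj x w (hx.trans e)).symm)
      · rw [if_neg haw, hord, if_neg fun e => haw (hinj a w e),
          if_neg fun e => hax (hinj a x (e.trans hx.symm)), h.ord_pos]
  · intro p hp
    by_cases h1 : p = T.pos w
    · exact ⟨x, by rw [hpos, if_pos rfl, h1]⟩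
    · by_cases h2 : p = T.first c
      · refine ⟨w, ?_⟩
        rw [hpos, if_pos rfl, if_neg, h2]
        rintro rfl
        exact h1 (h2.trans hx.symm)
      · obtain ⟨a, ha⟩ := h.exists_pos p hp
        refine ⟨a, ?_⟩
        rw [hpos, if_neg, if_neg, ha]
        · rintro rfl; exact h1 ha.symm
        · rintro rfl; exact h2 (ha.symm.trans hx)
  · intro a
    rw [hpos, ← h.low]
    split_ifs with h1 h2
    · subst h1; omega
    · subst h2; omega
    · rfl
  · intro a ha
    have hl := h.low_eq a ha
    have hla := (h.low a).2 ha
    have hax : a ≠ x := by rintro rfl; omega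
    have haw : a ≠ w := by rintro rfl; omega
    rw [hpos, hcls, if_neg hax, if_neg haw, if_neg haw]
    exact hl
  · intro a b
    rw [hpos]
    split_ifs with h1 h2
    · subst h1
      intro _ e
      rw [h.same w b hwlo e, hcx]
    · subst h2
      intro _ e
      rw [h.same x b (by omega) (hx.trans e), hcx]
    · exact h.same a b
  · intro a
    rw [hpos, hfirst]
    have hca := h₀.cls_lt a
    by_cases haw : a = w
    · subst haw
      intro _
      simp only [Set.mem_insert_iff, true_or, true_iff, ← hc, if_true]
      split_ifs with h1
      · subst h1; omega
      · omega
    · rw [Set.mem_insert_iff, or_iff_right haw, if_neg haw]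
      split_ifs with h1 h2 h3 h4 h5
      · intro _
        subst h1
        have : T.pos a ≠ T.pos w := fun e => haw (hinj a w e)
        simp only [hxD, false_iff]
        omega
      · omega
      · subst h1
        exact absurd hcx h2
      · intro hl
        have : T.pos a ≠ T.first c := fun e => h1 (hinj a x (e.trans hx.symm))
        rw [h.split a hl, h4]
        omega
      · omega
      · exact h.split a
  · intro a ha
    rw [hcls, htgt, htgt]
    by_cases haw : a = w
    · subst haw
      simp [← hc]
    · rw [if_neg haw]
      have haD := ha.resolve_left haw
      have := h.le_target a haD
      rw [if_neg, h.cls_mem a haD]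
      rintro ⟨e, h2⟩
      rw [e] at this
      omega
  · intro a ha
    rw [Set.mem_insert_iff, not_or] at ha
    rw [hcls, if_neg ha.1, h.cls_notMem a ha.2]
  · intro a ha
    rw [htgt]
    split_ifs with h1
    · exact hnn
    · rcases ha with rfl | ha
      · simp only [← hc, true_and] at h1 ⊢
        omega
      · exact h.le_target a ha
  · intro d
    have := h.first_le d
    rw [hfirst]
    split_ifs with h1 h2
    · subst h1; omega
    · omega
    · exact this
  · intro d hd
    rw [htgt, hfirst]
    by_cases hdc : d = c
    · by_cases hf : T.target c < T₀.next
      · rw [if_pos ⟨hdc, hf⟩]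
        omega
      · rw [if_neg fun e => hf e.2, hdc]
        exact fun hlt => absurd hlt hf
    · rw [if_neg fun e => hdc e.1, if_neg hdc, if_neg (by omega)]
      exact h.first_old d hd
  · intro d hd
    rw [htgt]
    split_ifs with h1
    · intro _
      rw [hfirst, if_neg (by omega), if_pos ⟨rfl, h1.2⟩, h1.1, h.first_old c hcn h1.2]
    · intro hle
      have := h.target_lt d
      rw [hfirst, if_neg (by omega), if_neg (by omega), h.first_target d hd hle]
  · intro d hd d' hd'
    rw [htgt, htgt]
    have h1 := h.target_lt d
    have h2 := h.target_lt d'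
    split_ifs with h3 h4 h4
    · exact fun _ _ => h3.1.trans h4.1.symm
    · omega
    · omega
    · exact h.target_inj d hd d' hd'
  · intro d
    have := h.target_lt d
    rw [htgt, hnext]
    split_ifs <;> omega
  · rw [hnext]
    split_ifs <;> omega
  · intro d hd
    rw [hgrp, if_neg (by omega), h.grp_old d hd]
  · intro d hd
    rw [htgt]
    split_ifs with h1
    · intro _
      rw [hgrp, if_pos ⟨rfl, h1.2⟩, h.grp_old c hcn, h1.1]
    · intro hle
      have := h.target_lt d
      rw [hgrp, if_neg (by omega), h.grp_target d hd hle]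

/-- Different old classes have different new targets, all of them beyond the old class numbers;
hence each old class is split exactly into its moved and unmoved vertices. -/
theorem Moved.cls_eq_iff (h : Moved n lo T₀ D T) (h₀ : Parts n lo T₀) {a b : Fin n} :
    T.cls a = T.cls b ↔ T₀.cls a = T₀.cls b ∧ (a ∈ D ↔ b ∈ D) := by
  have hca := h₀.cls_lt a
  have hcb := h₀.cls_lt b
  by_cases ha : a ∈ D <;> by_cases hb : b ∈ D
  · rw [h.cls_mem a ha, h.cls_mem b hb]
    simp only [ha, hb, and_true]
    exact ⟨h.target_inj _ hca _ hcb (h.le_target a ha), fun e => by rw [e]⟩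
  · have := h.le_target a ha
    rw [h.cls_mem a ha, h.cls_notMem b hb]
    simp only [ha, hb, iff_false, not_true_eq_false, and_false]
    omega
  · have := h.le_target b hb
    rw [h.cls_mem b hb, h.cls_notMem a ha]
    simp only [ha, hb, iff_true, and_false, iff_false]
    omega
  · rw [h.cls_notMem a ha, h.cls_notMem b hb]
    simp [ha, hb]

/-- A class that is split off inherits the group of its parent, so membership in marked sets
survives refinement without relabelling vertices. -/
theorem Moved.grp_cls (h : Moved n lo T₀ D T) (h₀ : Parts n lo T₀) (a : Fin n) :
    T.grp (T.cls a) = T₀.grp (T₀.cls a) := by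
  have hca := h₀.cls_lt a
  by_cases ha : a ∈ D
  · rw [h.cls_mem a ha, h.grp_target _ hca (h.le_target a ha)]
  · rw [h.cls_notMem a ha, h.grp_old _ hca]

/-- Each old interval is cut at the boundary `first`: moved vertices before it, unmoved ones from it
on. Both halves are intervals with the recorded beginnings. -/
theorem Moved.parts (h : Moved n lo T₀ D T) (h₀ : Parts n lo T₀) : Parts n lo T := by
  have hfirst : ∀ a : Fin n, lo ≤ T.pos a → lo ≤ T.first (T.cls a) ∧
      T.first (T.cls a) ≤ T.pos a ∧ ∀ b : Fin n, T.pos b = T.first (T.cls a) →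
      T.cls b = T.cls a := by
    intro a ha
    have hca := h₀.cls_lt a
    have hf := h.first_le_pos h₀ ha
    have hs := h.split a ha
    have hle := (h.first_le (T₀.cls a)).resolve_right (by omega)
    by_cases haD : a ∈ D
    · have hlt := hs.1 haD
      rw [h.cls_mem a haD, h.first_target _ hca (h.le_target a haD)]
      refine ⟨hf.1, hf.2, fun b hb => ?_⟩
      have hcb := h.cls_of_between h₀ ha hb.ge (by omega)
      have hbD : b ∈ D := (h.split b (by omega)).2 (by rw [hcb]; omega)
      rw [h.cls_mem b hbD, hcb]
    · have hlt := mt hs.2 haD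
      rw [h.cls_notMem a haD]
      refine ⟨hf.1.trans hle, by omega, fun b hb => ?_⟩
      have hcb := h.cls_of_between h₀ ha (by omega) (b := b) (by omega)
      have hbD : b ∉ D := fun hbD => by
        have := (h.split b (by omega)).1 hbD
        rw [hcb] at this
        omega
      rw [h.cls_notMem b hbD, hcb]
  refine ⟨h.pos_lt, h.ord_pos, h.exists_pos, fun a b d ha hab hbd had => ?_,
    fun a ha => ⟨(hfirst a ha).1, (hfirst a ha).2.1⟩, fun a b ha hb => (hfirst a ha).2.2 b hb,
    fun a => ?_, h.target_lt⟩
  · rw [h.cls_eq_iff h₀] at had ⊢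
    have hba := h.cls_same h₀ ha hab hbd had.1
    refine ⟨hba, ?_⟩
    have h1 := h.split a ha
    have h2 := h.split b (by omega)
    have h3 := h.split d (by omega)
    rw [hba] at h2
    rw [← had.1] at h3
    have h4 := had.2
    rw [h1, h3] at h4
    rw [h1, h2]
    omega
  · by_cases haD : a ∈ D
    · rw [h.cls_mem a haD]
      exact h.target_lt _
    · rw [h.cls_notMem a haD]
      exact (h₀.cls_lt a).trans_le h.next_le

/-- The sets in the list are the classes of the vertices from position `lo` on, in the order of
their positions. -/
structure SetsRep (n lo : ℕ) (T : Tables) (l : List (Set (Fin n))) : Prop where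
  sorted : SetsBefore (fun a b : Fin n => T.pos a < T.pos b) l
  low : ∀ A ∈ l, ∀ a ∈ A, lo ≤ T.pos a
  cls : ∀ A ∈ l, ∀ a ∈ A, ∀ b : Fin n, b ∈ A ↔ lo ≤ T.pos b ∧ T.cls b = T.cls a
  cover : ∀ a : Fin n, lo ≤ T.pos a → ∃ A ∈ l, a ∈ A

theorem SetsRep.filter {l : List (Set (Fin n))} (h : SetsRep n lo T l) (p : Set (Fin n) → Bool)
    (hp : ∀ A : Set (Fin n), A.Nonempty → p A = true) : SetsRep n lo T (l.filter p) where
  sorted := h.sorted.filter p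
  low A hA := h.low A (List.mem_filter.1 hA).1
  cls A hA := h.cls A (List.mem_filter.1 hA).1
  cover a ha := by
    obtain ⟨A, hA, haA⟩ := h.cover a ha
    exact ⟨A, List.mem_filter.2 ⟨hA, hp A ⟨a, haA⟩⟩, haA⟩

/-- The order of the list agrees with the positions: neighbours are at the front of their interval,
and different intervals keep their places. -/
theorem SetsRep.split {l : List (Set (Fin n))} (hl : SetsRep n lo T₀ l) (h₀ : Parts n lo T₀)
    (h : Moved n lo T₀ D T) {N : Set (Fin n)} (hN : ∀ a : Fin n, lo ≤ T₀.pos a → (a ∈ N ↔ a ∈ D)) :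
    SetsRep n lo T (l.flatMap fun Y => [Y ∩ N, Y \ N]) := by
  have hlow : ∀ a : Fin n, lo ≤ T.pos a ↔ lo ≤ T₀.pos a := fun a => by
    have := h.low a
    omega
  -- Vertices of a set still occupy the positions that the set occupied before, so comparisons
  -- between different sets can be made in the old tables.
  have hplace : ∀ A ∈ l, ∀ a ∈ A, ∃ a' ∈ A, T₀.pos a' = T.pos a := by
    intro A hA a ha
    obtain ⟨a', ha'⟩ := h₀.exists_pos _ (h.pos_lt a)
    have hlo := hl.low A hA a ha
    refine ⟨a', (hl.cls A hA a ha a').2 ⟨?_, h.same a a' ((hlow a).2 hlo) ha'.symm⟩, ha'⟩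
    rw [ha']
    exact (hlow a).2 hlo
  constructor
  · refine List.pairwise_flatMap.2 ⟨fun A hA => ?_, hl.sorted.imp_of_mem ?_⟩
    · simp only [List.pairwise_cons, List.mem_singleton, List.not_mem_nil, false_imp_iff,
        implies_true, List.Pairwise.nil, and_true, forall_eq]
      rintro a ⟨ha, haN⟩ b ⟨hb, hbN⟩
      have hloa := hl.low A hA a ha
      have hlob := hl.low A hA b hb
      have h1 := (h.split a ((hlow a).2 hloa)).1 ((hN a hloa).1 haN)
      have h2 := mt (h.split b ((hlow b).2 hlob)).2 (mt (hN b hlob).2 hbN)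
      rw [((hl.cls A hA a ha b).1 hb).2] at h2
      omega
    · intro A B hA hB hAB x hx y hy a ha b hb
      simp only [List.mem_cons, List.not_mem_nil, or_false] at hx hy
      obtain ⟨a', ha', hae⟩ := hplace A hA a (by rcases hx with rfl | rfl <;> exact ha.1)
      obtain ⟨b', hb', hbe⟩ := hplace B hB b (by rcases hy with rfl | rfl <;> exact hb.1)
      rw [← hae, ← hbe]
      exact hAB a' ha' b' hb'
  · intro A' hA' a ha
    simp only [List.mem_flatMap, List.mem_cons, List.not_mem_nil, or_false] at hA'
    obtain ⟨A, hA, hAA⟩ := hA'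
    exact (hlow a).2 (hl.low A hA a (by rcases hAA with rfl | rfl <;> exact ha.1))
  · intro A' hA' a ha b
    simp only [List.mem_flatMap, List.mem_cons, List.not_mem_nil, or_false] at hA'
    obtain ⟨A, hA, hAA⟩ := hA'
    have haA : a ∈ A := by rcases hAA with rfl | rfl <;> exact ha.1
    have hloa := hl.low A hA a haA
    rw [h.cls_eq_iff h₀, hlow, ← and_assoc, ← hl.cls A hA a haA b]
    rcases hAA with rfl | rfl
    · rw [Set.mem_inter_iff]
      refine and_congr_right fun hb => ?_
      rw [hN b (hl.low A hA b hb), iff_true_right ((hN a hloa).1 ha.2)]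
    · rw [Set.mem_sdiff]
      refine and_congr_right fun hb => ?_
      rw [hN b (hl.low A hA b hb), iff_false_right (mt (hN a hloa).2 ha.2)]
  · intro a ha
    obtain ⟨A, hA, haA⟩ := hl.cover a ((hlow a).1 ha)
    by_cases haN : a ∈ N
    · exact ⟨A ∩ N, List.mem_flatMap.2 ⟨A, hA, by simp⟩, haA, haN⟩
    · exact ⟨A \ N, List.mem_flatMap.2 ⟨A, hA, by simp⟩, haA, haN⟩

/-- The tables after the vertex `v` at position `i` was removed from its class. -/
def Tables.remove (T : Tables) (v i : ℕ) : Tables :=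
  { T with first := Function.update T.first (T.cls v) (i + 1) }

theorem Parts.remove {i : ℕ} {v : Fin n} (h : Parts n i T) (hv : T.pos v = i) :
    Parts n (i + 1) (T.remove v i) := by
  refine ⟨h.pos_lt, h.ord_pos, h.exists_pos, fun a b d ha => h.interval a b d
    (Nat.le_of_succ_le ha), fun a ha => ?_, fun a b ha hb => ?_, h.cls_lt, h.target_lt⟩
  · change i + 1 ≤ T.pos a at ha
    change i + 1 ≤ Function.update T.first _ _ _ ∧ Function.update T.first _ _ _ ≤ T.pos a
    rw [Function.update_apply]
    split_ifs with h1
    · exact ⟨le_rfl, ha⟩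
    · have hf := h.first_le a (by omega)
      refine ⟨?_, hf.2⟩
      -- A class that began at position `i` would contain `v`, the vertex there; any other class
      -- with an unvisited vertex begins later.
      rcases Nat.lt_or_ge i (T.first (T.cls a)) with h2 | h2
      · exact h2
      · exact absurd (h.first_cls a v (by omega) (by omega)).symm h1
  · change i + 1 ≤ T.pos a at ha
    change T.pos b = Function.update T.first _ _ _ at hb
    change T.cls b = T.cls a
    rw [Function.update_apply] at hb
    split_ifs at hb with h1
    · change T.cls a = T.cls v at h1
      rw [h1]
      exact h.interval v b a hv.ge (by omega) (by omega) h1.symm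
    · exact h.first_cls a b (by omega) hb

theorem SetsRep.exists_first {i : ℕ} {v : Fin n} {l : List (Set (Fin n))} (h : SetsRep n i T l)
    (hv : T.pos v = i) : ∃ pre X post, l = pre ++ X :: post ∧ (∀ Y ∈ pre, Y = ∅) ∧ v ∈ X := by
  obtain ⟨X, hX, hvX⟩ := h.cover v hv.ge
  obtain ⟨pre, post, rfl⟩ := List.append_of_mem hX
  refine ⟨pre, X, post, rfl, fun Y hY => ?_, hvX⟩
  by_contra hne
  obtain ⟨b, hb⟩ := Set.nonempty_iff_ne_empty.2 hne
  have h1 := h.low Y (by simp [hY]) b hb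
  have h2 := (List.pairwise_append.1 h.sorted).2.2 Y hY X (by simp) b hb v hvX
  omega

theorem SetsRep.remove {i : ℕ} {v : Fin n} {pre post : List (Set (Fin n))} {X : Set (Fin n)}
    (h : SetsRep n i T (pre ++ X :: post)) (hpre : ∀ Y ∈ pre, Y = ∅) (hv : T.pos v = i)
    (hvX : v ∈ X) (hinj : ∀ a b : Fin n, T.pos a = T.pos b → a = b) :
    SetsRep n (i + 1) (T.remove v i) (pre ++ (X \ {v}) :: post) := by
  have hs := List.pairwise_cons.1 (List.pairwise_append.1 h.sorted).2.1
  have hlow : ∀ A ∈ pre ++ X :: post, ∀ a ∈ A, a ≠ v → i + 1 ≤ T.pos a := by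
    intro A hA a ha hav
    have h1 := h.low A hA a ha
    have h2 : T.pos a ≠ i := fun e => hav (hinj a v (e.trans hv.symm))
    omega
  have hpost : ∀ A ∈ post, v ∉ A := fun A hA hvA => by
    have := hs.1 A hA v hvX v hvA
    omega
  constructor
  · exact SetsBefore.of_cons hpre (List.pairwise_cons.2
      ⟨fun B hB a ha b hb => hs.1 B hB a ha.1 b hb, hs.2⟩)
  · intro A hA a ha
    simp only [List.mem_append, List.mem_cons] at hA
    rcases hA with hA | rfl | hA
    · rw [hpre A hA] at ha
      exact ha.elim
    · exact hlow X (by simp) a ha.1 ha.2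
    · exact hlow A (by simp [hA]) a ha fun e => hpost A hA (e ▸ ha)
  · intro A hA a ha b
    change b ∈ A ↔ i + 1 ≤ T.pos b ∧ T.cls b = T.cls a
    simp only [List.mem_append, List.mem_cons] at hA
    rcases hA with hA | rfl | hA
    · rw [hpre A hA] at ha
      exact ha.elim
    · have hc := h.cls X (by simp) a ha.1 b
      constructor
      · exact fun hb => ⟨hlow X (by simp) b hb.1 hb.2, (hc.1 hb.1).2⟩
      · rintro ⟨h1, h2⟩
        refine ⟨hc.2 ⟨by omega, h2⟩, ?_⟩
        rintro rfl
        omega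
    · have hc := h.cls A (by simp [hA]) a ha b
      constructor
      · exact fun hb => ⟨hlow A (by simp [hA]) b hb fun e => hpost A hA (e ▸ hb), (hc.1 hb).2⟩
      · exact fun hb => hc.2 ⟨by omega, hb.2⟩
  · intro a ha
    change i + 1 ≤ T.pos a at ha
    obtain ⟨A, hA, haA⟩ := h.cover a (by omega)
    simp only [List.mem_append, List.mem_cons] at hA ⊢
    rcases hA with hA | rfl | hA
    · exact ⟨A, Or.inl hA, haA⟩
    · refine ⟨_, Or.inr (Or.inl rfl), haA, ?_⟩
      rintro rfl
      omega
    · exact ⟨A, Or.inr (Or.inr hA), haA⟩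

end Partition
end ModLBFS

namespace ModLBFS

/-! ### Array segments and the input format -/

section Input

theorem segment_self (f : ℕ → ℕ) (a : ℕ) : segment f a a = [] := by simp [segment]

theorem segment_succ (f : ℕ → ℕ) {a b : ℕ} (h : a ≤ b) :
    segment f a (b + 1) = segment f a b ++ [f b] := by
  rw [segment, segment, show b + 1 - a = (b - a) + 1 by omega, List.range'_concat, List.map_append]
  simp [Nat.add_sub_cancel' h]

theorem segment_append (f : ℕ → ℕ) {a b c : ℕ} (hab : a ≤ b) (hbc : b ≤ c) :
    segment f a c = segment f a b ++ segment f b c := by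
  induction c, hbc using Nat.le_induction with
  | base => simp [segment_self]
  | succ c hc ih => rw [segment_succ f (hab.trans hc), segment_succ f hc, ih, List.append_assoc]

theorem segment_congr {f g : ℕ → ℕ} {a b : ℕ} (h : ∀ p < b, f p = g p) :
    segment f a b = segment g a b := by
  refine List.map_congr_left fun p hp => h p ?_
  have := List.mem_range'_1.1 hp
  omega

variable {n : ℕ}

/-- The arrays `off` and `nbr` hold the adjacency lists `adj`. -/
structure HoldsAdj (adj : Fin n → List (Fin n)) (off nbr : ℕ → ℕ) : Prop where
  succ : ∀ v : Fin n, off (v + 1) = off v + (adj v).length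
  get : ∀ (v : Fin n) (j : ℕ) (hj : j < (adj v).length), nbr (off v + j) = (adj v)[j]

theorem inputStore_holdsAdj (adj : Fin n → List (Fin n)) (ks : List (Fin n)) :
    HoldsAdj adj ((inputStore n adj ks).arrs 0) ((inputStore n adj ks).arrs 1) := by
  have hoff : ∀ v ≤ n, (inputStore n adj ks).arrs 0 v =
      ((List.ofFn adj).take v).flatten.length := by
    intro v hv
    change ofList _ v = _
    rw [ofList, List.getD_eq_getElem _ _ (by simp; omega)]
    simp
  have htake : ∀ v : Fin n, (List.ofFn adj).take (v + 1) = (List.ofFn adj).take v ++ [adj v] := by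
    intro v
    rw [List.take_add_one, List.getElem?_eq_getElem (by simp)]
    simp
  constructor
  · intro v
    rw [hoff _ v.2, hoff _ v.2.le, htake]
    simp
  · intro v j hj
    rw [hoff _ v.2.le]
    change ofList _ _ = _
    have h1 : (List.ofFn adj).flatten = ((List.ofFn adj).take v).flatten ++
        (adj v ++ ((List.ofFn adj).drop (v + 1)).flatten) := by
      conv_lhs => rw [← List.take_append_drop (v + 1) (List.ofFn adj), htake]
      simp
    have h2 : (List.ofFn adj).flatten[((List.ofFn adj).take v).flatten.length + j]? =
        some (adj v)[j] := by
      rw [h1, List.getElem?_append_right (by omega), Nat.add_sub_cancel_left,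
        List.getElem?_append_left hj, List.getElem?_eq_getElem hj]
    rw [ofList, List.getD_eq_getElem?_getD, List.getElem?_map, h2]
    rfl

theorem inputStore_clique (adj : Fin n → List (Fin n)) (ks : List (Fin n)) (j : ℕ)
    (hj : j < ks.length) : (inputStore n adj ks).arrs 2 j = ks[j] := by
  change ofList _ _ = _
  rw [ofList, List.getD_eq_getElem _ _ (by simpa using hj), List.getElem_map]

end Input

/-! ### The output arrays -/

section Output

variable {n : ℕ}

/-- The memory holds `b` as its `j`-th vertex list and edge list. -/
def HoldsBlock (s : Store) (j : ℕ) (b : List (Fin n) × List (Fin n × Fin n)) : Prop :=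
  segment (s.arrs 4) (s.arrs 5 j) (s.arrs 5 (j + 1)) = b.1.map Fin.val ∧
  segment (s.arrs 6) (s.arrs 8 j) (s.arrs 8 (j + 1)) = b.2.map (fun e => e.1.val) ∧
  segment (s.arrs 7) (s.arrs 8 j) (s.arrs 8 (j + 1)) = b.2.map (fun e => e.2.val)

/-- The memory holds the list `blocks` of vertex lists and edge lists, and the last vertex list
ends before position `i`. -/
structure HoldsBlocks (s : Store) (i : ℕ) (blocks : List (List (Fin n) × List (Fin n × Fin n))) :
    Prop where
  count : s.vars 2 = blocks.length
  verts_end : s.arrs 5 blocks.length = i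
  edges_end : s.arrs 8 blocks.length = s.vars 16
  le : ∀ j ≤ blocks.length, s.arrs 5 j ≤ i ∧ s.arrs 8 j ≤ s.vars 16
  holds : ∀ j (hj : j < blocks.length), HoldsBlock s j blocks[j]

/-- The vertex `v` and the edges `es` were appended to the output arrays. -/
structure Appended (s t : Store) (i : ℕ) (v : Fin n) (es : List (Fin n × Fin n)) : Prop where
  verts_old : ∀ p < i, t.arrs 4 p = s.arrs 4 p
  verts_new : t.arrs 4 i = v
  le : s.vars 16 ≤ t.vars 16
  fst_old : ∀ p < s.vars 16, t.arrs 6 p = s.arrs 6 p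
  snd_old : ∀ p < s.vars 16, t.arrs 7 p = s.arrs 7 p
  fst_new : segment (t.arrs 6) (s.vars 16) (t.vars 16) = es.map (fun e => e.1.val)
  snd_new : segment (t.arrs 7) (s.vars 16) (t.vars 16) = es.map (fun e => e.2.val)
  verts_end : t.arrs 5 = Function.update (s.arrs 5) (t.vars 2) (i + 1)
  edges_end : t.arrs 8 = Function.update (s.arrs 8) (t.vars 2) (t.vars 16)

variable {s t : Store} {i : ℕ} {v : Fin n} {es : List (Fin n × Fin n)}
  {blocks : List (List (Fin n) × List (Fin n × Fin n))}

/-- While `K` is visited, the end marks with index `0` are overwritten. Vertices and edges of the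
clique are thereby skipped, and the first output graph will start after them. -/
theorem HoldsBlocks.nil_of_appended (h : Appended s t i v es)
    (ht : t.vars 2 = 0) : HoldsBlocks t (i + 1) ([] : List (List (Fin n) × List (Fin n × Fin n))) := by
  have h5 := h.verts_end
  have h8 := h.edges_end
  rw [ht] at h5 h8
  refine ⟨ht, by simp [h5], by simp [h8], fun j hj => ?_, fun j hj => absurd hj (Nat.not_lt_zero j)⟩
  obtain rfl : j = 0 := by simpa using hj
  simp [h5, h8]

theorem HoldsBlock.of_appended (h : Appended s t i v es) {j : ℕ}
    {b : List (Fin n) × List (Fin n × Fin n)} (hb : HoldsBlock s j b) (hj : j + 1 < t.vars 2)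
    (h5 : s.arrs 5 (j + 1) ≤ i) (h8 : s.arrs 8 (j + 1) ≤ s.vars 16) : HoldsBlock t j b := by
  rw [HoldsBlock, h.verts_end, h.edges_end, Function.update_of_ne (by omega),
    Function.update_of_ne (by omega), Function.update_of_ne (by omega),
    Function.update_of_ne (by omega), segment_congr fun p hp => h.verts_old p (by omega),
    segment_congr fun p hp => h.fst_old p (by omega),
    segment_congr fun p hp => h.snd_old p (by omega)]
  exact hb

theorem HoldsBlocks.append (hs : HoldsBlocks s i blocks) (h : Appended s t i v es)
    (ht : t.vars 2 = s.vars 2 + 1) : HoldsBlocks t (i + 1) (blocks ++ [([v], es)]) := by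
  have hlen : t.vars 2 = blocks.length + 1 := by rw [ht, hs.count]
  have hle := h.le
  refine ⟨by simp [hlen], by simp [h.verts_end, hlen], by simp [h.edges_end, hlen],
    fun j hj => ?_, fun j hj => ?_⟩
  · rw [h.verts_end, h.edges_end]
    simp only [List.length_append, List.length_cons, List.length_nil] at hj
    by_cases hj' : j = t.vars 2
    · simp [hj']
    · rw [Function.update_of_ne hj', Function.update_of_ne hj']
      have := hs.le j (by omega)
      omega
  · simp only [List.length_append, List.length_cons, List.length_nil] at hj
    by_cases hj' : j < blocks.length
    · rw [List.getElem_append_left hj']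
      have := hs.le (j + 1) hj'
      exact (hs.holds j hj').of_appended h (by omega) this.1 this.2
    · obtain rfl : j = blocks.length := by omega
      rw [List.getElem_append_right le_rfl]
      simp only [Nat.sub_self, List.getElem_cons_zero]
      rw [HoldsBlock, h.verts_end, h.edges_end, hlen, Function.update_self, Function.update_self,
        Function.update_of_ne (by omega), Function.update_of_ne (by omega), hs.verts_end,
        hs.edges_end, h.fst_new, h.snd_new, segment_succ _ le_rfl, segment_self, h.verts_new]
      exact ⟨rfl, rfl, rfl⟩

/-- The last graph ends where the arrays end, so writing there and moving its end marks enlarges it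
in place. This is why a component has to be visited without interruption. -/
theorem HoldsBlocks.extend {l : List (List (Fin n) × List (Fin n × Fin n))}
    {b : List (Fin n) × List (Fin n × Fin n)} (hs : HoldsBlocks s i (l ++ [b]))
    (h : Appended s t i v es) (ht : t.vars 2 = s.vars 2) :
    HoldsBlocks t (i + 1) (l ++ [(b.1 ++ [v], b.2 ++ es)]) := by
  have hlen : t.vars 2 = l.length + 1 := by rw [ht, hs.count]; simp
  have hle := h.le
  have hsl : ∀ j ≤ l.length + 1, s.arrs 5 j ≤ i ∧ s.arrs 8 j ≤ s.vars 16 := fun j hj =>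
    hs.le j (by simpa using hj)
  refine ⟨by simp [hlen], by simp [h.verts_end, hlen], by simp [h.edges_end, hlen],
    fun j hj => ?_, fun j hj => ?_⟩
  · rw [h.verts_end, h.edges_end]
    simp only [List.length_append, List.length_cons, List.length_nil] at hj
    by_cases hj' : j = t.vars 2
    · simp [hj']
    · rw [Function.update_of_ne hj', Function.update_of_ne hj']
      have := hsl j (by omega)
      omega
  · simp only [List.length_append, List.length_cons, List.length_nil] at hj
    by_cases hj' : j < l.length
    · rw [List.getElem_append_left hj']
      have := hsl (j + 1) (by omega)
      have hb := hs.holds j (by simp; omega)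
      rw [List.getElem_append_left hj'] at hb
      exact hb.of_appended h (by omega) this.1 this.2
    · obtain rfl : j = l.length := by omega
      have hb := hs.holds l.length (by simp)
      rw [List.getElem_append_right le_rfl] at hb ⊢
      simp only [Nat.sub_self, List.getElem_cons_zero] at hb ⊢
      have h1 := hs.verts_end
      have h2 := hs.edges_end
      have h3 := hsl l.length (by omega)
      simp only [List.length_append, List.length_cons, List.length_nil, zero_add] at h1 h2
      rw [HoldsBlock, h1, h2] at hb
      rw [HoldsBlock, h.verts_end, h.edges_end, hlen, Function.update_self, Function.update_self,
        Function.update_of_ne (by omega), Function.update_of_ne (by omega),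
        segment_succ _ h3.1, segment_append _ h3.2 hle, segment_append (t.arrs 7) h3.2 hle,
        h.fst_new, h.snd_new, h.verts_new, segment_congr h.verts_old, segment_congr h.fst_old,
        segment_congr h.snd_old, hb.1, hb.2.1, hb.2.2]
      simp

theorem HoldsBlocks.holdsGraph (hs : HoldsBlocks s i blocks) {cs : List (PGraph (Fin n))}
    (h : List.Forall₂ Lists blocks cs) (j : ℕ) (hj : j < cs.length) : HoldsGraph s j cs[j] := by
  have hlen := h.length_eq
  have hl : Lists blocks[j] cs[j] := h.get (by omega) hj
  have hb := hs.holds j (by omega)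
  exact ⟨blocks[j].1, blocks[j].2, hl.1, hl.2.1, hl.2.2.1, hl.2.2.2, hb⟩

end Output

/-! ### Group numbers for the marked sets -/

section Groups

variable {V : Type*} {G : SimpleGraph V} {K : Set V}

/-- The group numbers `Γ` describe the marked sets: `K` has number `1`, the unmarked vertices have
number `0`, and the set `cur` has the greatest number `g`. -/
structure Groups (K : Set V) (marked : Set (Set V)) (cur : Set V) (Γ : V → ℕ) (g : ℕ) : Prop where
  ne_zero : ∀ a, Γ a ≠ 0 ↔ a ∈ K ∨ ∃ Y ∈ marked, a ∈ Y
  eq_one : ∀ a, Γ a = 1 ↔ a ∈ K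
  mem_cur : ∀ a, a ∈ cur ↔ Γ a = g
  le : ∀ a, Γ a ≤ g
  one_le : 1 ≤ g

variable {sets : List (Set V)} {order : List V} {marked : Set (Set V)} {cur : Set V}
  {blocks : List (List V × List (V × V))} {pre post : List (Set V)} {X : Set V} {v : V}
  {Γ Γ' : V → ℕ} {g g' : ℕ}

/-- Translates the decisions of the program into the kinds of visit. Group `0` means a new marked
set; group `1` means the clique; otherwise a visited neighbour in the same group decides between
extending the last component and starting another. -/
theorem Simulates.visit [Finite V] (hK : G.IsClique K)
    (h : Simulates G K sets order marked cur blocks) (hg : Groups K marked cur Γ g)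
    (hsets : sets = pre ++ X :: post) (hpre : ∀ Y ∈ pre, Y = ∅) (hv : v ∈ X)
    (hold : Γ v ≠ 0 → g' = g ∧ ∀ a, Γ' a = Γ a)
    (hnew : Γ v = 0 → g' = g + 1 ∧ ∀ a, (a ∈ X → Γ' a = g + 1) ∧ (a ∉ X → Γ' a = Γ a))
    {es : List (V × V)}
    (hes : es.Nodup ∧ ∀ e : V × V, e ∈ es ↔ e.1 = v ∧ Γ' e.2 = g' ∧ G.Adj v e.2) :
    ∃ marked' cur', Groups K marked' cur' Γ' g' ∧ Γ' v = g' ∧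
      (g' = 1 → blocks = [] ∧ Simulates G K (refine G v (pre ++ (X \ {v}) :: post)) (order ++ [v])
        marked' cur' []) ∧
      (g' ≠ 1 → (¬ ∃ x ∈ order, Γ' x = g' ∧ G.Adj v x) →
        Simulates G K (refine G v (pre ++ (X \ {v}) :: post)) (order ++ [v]) marked' cur'
          (blocks ++ [([v], es)])) ∧
      (g' ≠ 1 → (∃ x ∈ order, Γ' x = g' ∧ G.Adj v x) → ∃ l b, blocks = l ++ [b] ∧
        Simulates G K (refine G v (pre ++ (X \ {v}) :: post)) (order ++ [v]) marked' cur'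
          (l ++ [(b.1 ++ [v], b.2 ++ es)])) := by
  obtain ⟨out, hi⟩ := h.exists_inv hK
  have hvo := hi.first_notMem hsets hv
  have hg1 := hg.one_le
  by_cases h0 : Γ v = 0
  · obtain ⟨rfl, hΓ⟩ := hnew h0
    have hvm : ¬ (v ∈ K ∨ ∃ Y ∈ marked, v ∈ Y) := fun hm => (hg.ne_zero v).2 hm h0
    push Not at hvm
    have hXm : ∀ a ∈ X, Γ a = 0 := by
      intro a ha
      by_contra hne
      have ht := hi.first_twin hsets hv ha
      rcases (hg.ne_zero a).1 hne with haK | ⟨Y, hY, haY⟩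
      · exact hvm.1 (ht.2.1.2 haK)
      · exact hvm.2 Y hY ((ht.2.2 Y hY).2 haY)
    have hX : ∀ a, a ∈ X ↔ Γ' a = g + 1 := by
      intro a
      refine ⟨(hΓ a).1, fun e => ?_⟩
      by_contra ha
      rw [(hΓ a).2 ha] at e
      have := hg.le a
      omega
    have hvc : v ∉ cur := fun hvc => by
      have := (hg.mem_cur v).1 hvc
      omega
    have hnv : ¬ ∃ x ∈ order, Γ' x = g + 1 ∧ G.Adj v x := by
      rintro ⟨x, hx, hxg, -⟩
      exact hi.first_notMem hsets ((hX x).2 hxg) hx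
    refine ⟨insert X marked, X, ⟨fun a => ?_, fun a => ?_, hX, fun a => ?_, by omega⟩, (hX v).1 hv,
      fun e => by omega, fun _ _ => ?_, fun _ hx => absurd hx hnv⟩
    · by_cases ha : a ∈ X
      · rw [(hΓ a).1 ha]
        exact iff_of_true (by omega) (Or.inr ⟨X, Set.mem_insert _ _, ha⟩)
      · rw [(hΓ a).2 ha, hg.ne_zero]
        simp [ha]
    · by_cases ha : a ∈ X
      · rw [(hΓ a).1 ha, ← hg.eq_one, hXm a ha]
        omega
      · rw [(hΓ a).2 ha, hg.eq_one]
    · by_cases ha : a ∈ X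
      · rw [(hΓ a).1 ha]
      · rw [(hΓ a).2 ha]
        have := hg.le a
        omega
    · refine h.visit_new hK hsets hpre hv hvc ⟨hes.1, fun e => ?_⟩
      rw [hes.2, hX]
  · obtain ⟨rfl, hΓ⟩ := hold h0
    obtain rfl : Γ' = Γ := funext hΓ
    have hvc := h.mem_cur hvo ((hg.ne_zero v).1 h0)
    have hvg := (hg.mem_cur v).1 hvc
    have hes' : es.Nodup ∧ ∀ e : V × V, e ∈ es ↔ e.1 = v ∧ e.2 ∈ cur ∧ G.Adj v e.2 :=
      ⟨hes.1, fun e => by rw [hes.2, hg.mem_cur]⟩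
    refine ⟨marked, cur, hg, hvg, fun e => ?_, fun hne hx => ?_, fun hne hx => ?_⟩
    · exact h.visit_clique hK hsets hpre hv ((hg.eq_one v).1 (hvg.trans e))
    · have hvK : v ∉ K := fun hvK => hne (hvg.symm.trans ((hg.eq_one v).2 hvK))
      refine h.visit_fresh hK hsets hpre hv hvc hvK (fun x hxo hxc e => ?_) hes'
      exact hx ⟨x, hxo, (hg.mem_cur x).1 hxc, e.symm⟩
    · have hvK : v ∉ K := fun hvK => hne (hvg.symm.trans ((hg.eq_one v).2 hvK))
      obtain ⟨x, hxo, hxg, e⟩ := hx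
      exact h.visit_extend hK hsets hpre hv hvc hvK hxo ((hg.mem_cur x).2 hxg) e.symm hes'

end Groups
end ModLBFS

namespace ModLBFS

/-! ### Scanning the neighbours of the visited vertex -/

section Scan

/-- Output the edge from register `6` to register `11` if it is in the group in register `17`, and
clear register `8` if register `11` is then a visited vertex. -/
def edgeProg : Prog :=
  .ite (.eq (.read 13 (.read 10 (.var 11))) (.var 17)) (.block [
    .write 6 (.var 16) (.var 6),
    .write 7 (.var 16) (.var 11),
    .assign 16 (.succ (.var 16)),
    .ite (.lt (.read 9 (.var 11)) (.var 3)) (.assign 8 (.lit 0)) .skip]) .skip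

def moveUnvisitedProg : Prog := .ite (.lt (.var 3) (.read 9 (.var 11))) moveProg .skip

def scanBody : Prog := .block [
  .assign 11 (.read 1 (.var 10)), edgeProg, moveUnvisitedProg, .assign 10 (.succ (.var 10))]

def scanTest : Test := .lt (.var 10) (.read 0 (.succ (.var 6)))

theorem scanBody_loopFree : scanBody.LoopFree := by
  simp [scanBody, Prog.block, edgeProg, moveUnvisitedProg, Prog.LoopFree, moveProg_loopFree]

variable {n : ℕ}

theorem run_edgeProg (s : Store) :
    (edgeProg.run s).tables = s.tables ∧
    (∀ x, x ≠ 8 → x ≠ 16 → (edgeProg.run s).vars x = s.vars x) ∧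
    (∀ a, a ≠ 6 → a ≠ 7 → (edgeProg.run s).arrs a = s.arrs a) ∧
    (s.tables.grp (s.tables.cls (s.vars 11)) = s.vars 17 →
      (edgeProg.run s).arrs 6 = Function.update (s.arrs 6) (s.vars 16) (s.vars 6) ∧
      (edgeProg.run s).arrs 7 = Function.update (s.arrs 7) (s.vars 16) (s.vars 11) ∧
      (edgeProg.run s).vars 16 = s.vars 16 + 1 ∧
      (edgeProg.run s).vars 8 = if s.tables.pos (s.vars 11) < s.vars 3 then 0 else s.vars 8) ∧
    (s.tables.grp (s.tables.cls (s.vars 11)) ≠ s.vars 17 → edgeProg.run s = s) := by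
  by_cases h : s.arrs 13 (s.arrs 10 (s.vars 11)) = s.vars 17
  · by_cases h' : s.arrs 9 (s.vars 11) < s.vars 3 <;>
      refine ⟨?_, fun x h8 h16 => ?_, fun a h6 h7 => ?_, fun _ => ?_, fun hne => absurd h hne⟩ <;>
        simp [edgeProg, Prog.block, Prog.run, Expr.eval, Test.Holds, Store.tables, *]
  · have : edgeProg.run s = s := by
      simp [edgeProg, Prog.run, Expr.eval, Test.Holds, h]
    exact ⟨by rw [this], fun _ _ _ => by rw [this], fun _ _ _ => by rw [this],
      fun e => absurd e h, fun _ => this⟩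

theorem run_moveUnvisitedProg (s : Store) :
    (moveUnvisitedProg.run s).tables = (if s.vars 3 < s.tables.pos (s.vars 11) then
      s.tables.move (s.vars 5) (s.vars 11) else s.tables) ∧
    (∀ x, x ≠ 4 ∧ x ≠ 12 ∧ x ≠ 13 ∧ x ≠ 14 ∧ x ≠ 15 →
      (moveUnvisitedProg.run s).vars x = s.vars x) ∧
    (∀ a, a ≠ 3 ∧ a ≠ 9 ∧ a ≠ 10 ∧ a ≠ 11 ∧ a ≠ 12 ∧ a ≠ 13 →
      (moveUnvisitedProg.run s).arrs a = s.arrs a) := by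
  by_cases h : s.vars 3 < s.arrs 9 (s.vars 11)
  · have : moveUnvisitedProg.run s = moveProg.run s := by
      simp [moveUnvisitedProg, Prog.run, Expr.eval, Test.Holds, h]
    rw [this]
    exact ⟨(run_moveProg_tables s).trans (if_pos h).symm, fun x hx => run_moveProg_vars s hx,
      fun a ha => run_moveProg_arrs s ha⟩
  · have : moveUnvisitedProg.run s = s := by
      simp [moveUnvisitedProg, Prog.run, Expr.eval, Test.Holds, h]
    rw [this]
    exact ⟨(if_neg h).symm, fun _ _ => rfl, fun _ _ => rfl⟩

/-- The edges from `v` to the listed vertices in the group `g`. -/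
def groupEdges (T : Tables) (g : ℕ) (v : Fin n) (l : List (Fin n)) : List (Fin n × Fin n) :=
  (l.filter fun w : Fin n => T.grp (T.cls w) = g).map fun w => (v, w)

open scoped Classical in
/-- Invariant of the scan of the neighbours of the vertex `v` at position `i`, which started in the
memory `s` and reached the memory `t` after `j` neighbours. -/
structure ScanInv (l : List (Fin n)) (v : Fin n) (i : ℕ) (s : Store) (j : ℕ) (t : Store) :
    Prop where
  vars : ∀ x, (x = 0 ∨ x = 2 ∨ x = 3 ∨ x = 5 ∨ x = 6 ∨ x = 9 ∨ x = 17) → t.vars x = s.vars x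
  arrs : ∀ a, (a = 0 ∨ a = 1 ∨ a = 4 ∨ a = 5 ∨ a = 8) → t.arrs a = s.arrs a
  idx : t.vars 10 = s.arrs 0 v + j
  moved : Moved n (i + 1) s.tables {a | a ∈ l.take j ∧ i + 1 ≤ s.tables.pos a} t.tables
  fresh : t.vars 8 = if ∃ x ∈ l.take j, s.tables.grp (s.tables.cls x) = s.vars 17 ∧
    s.tables.pos x < i then 0 else 1
  le : s.vars 16 ≤ t.vars 16
  fst_old : ∀ p < s.vars 16, t.arrs 6 p = s.arrs 6 p
  snd_old : ∀ p < s.vars 16, t.arrs 7 p = s.arrs 7 p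
  fst_new : segment (t.arrs 6) (s.vars 16) (t.vars 16) =
    (groupEdges s.tables (s.vars 17) v (l.take j)).map (fun e => e.1.val)
  snd_new : segment (t.arrs 7) (s.vars 16) (t.vars 16) =
    (groupEdges s.tables (s.vars 17) v (l.take j)).map (fun e => e.2.val)

/-- Refinement and output can share one pass because moves preserve groups (`Moved.grp_cls`) and do
not touch visited positions. The tests on the current tables therefore agree with tests on the
tables at the start of the scan. -/
theorem ScanInv.step {adj : Fin n → List (Fin n)} {v : Fin n} {i j : ℕ} {s t : Store}
    (h : ScanInv (adj v) v i s j t) (hadj : HoldsAdj adj (s.arrs 0) (s.arrs 1))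
    (hnd : (adj v).Nodup) (hvv : v ∉ adj v) (hparts : Parts n (i + 1) s.tables)
    (hpos : s.tables.pos v = i) (h3 : s.vars 3 = i) (h5 : s.vars 5 = s.tables.next)
    (h6 : s.vars 6 = v) (hj : j < (adj v).length) :
    ScanInv (adj v) v i s (j + 1) (scanBody.run t) := by
  classical
  set w := (adj v)[j] with hw
  have hwl : w ∈ adj v := List.getElem_mem hj
  have hwv : w ≠ v := fun e => hvv (e ▸ hwl)
  have htake : (adj v).take (j + 1) = (adj v).take j ++ [w] := by
    rw [List.take_add_one, List.getElem?_eq_getElem hj]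
    rfl
  have hwt : w ∉ (adj v).take j := by
    have := hnd.sublist (List.take_sublist (j + 1) (adj v))
    rw [htake] at this
    exact fun hm => (List.nodup_append.1 this).2.2 w hm w (by simp) rfl
  have hread : t.arrs 1 (t.vars 10) = w := by
    rw [h.idx, h.arrs 1 (by simp), hadj.get v j hj]
  have hsi : s.tables.pos w ≠ i := fun e =>
    hwv (Fin.ext (by rw [← hparts.ord_pos w, ← hparts.ord_pos v, e, hpos]))
  have hti : t.tables.pos w < i ↔ s.tables.pos w < i := by
    have h1 := h.moved.low w
    have h2 := h.moved.low_eq w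
    omega
  have hti' : i < t.tables.pos w ↔ i + 1 ≤ s.tables.pos w := by
    have h1 := h.moved.low w
    have h2 := h.moved.low_eq w
    omega
  have hgrp : t.tables.grp (t.tables.cls w) = s.tables.grp (s.tables.cls w) :=
    h.moved.grp_cls hparts w
  set a := t.setVar 11 w with ha
  have hrun : scanBody.run t = (moveUnvisitedProg.run (edgeProg.run a)).setVar 10
      ((moveUnvisitedProg.run (edgeProg.run a)).vars 10 + 1) := by
    simp only [scanBody, Prog.block, Prog.run, Expr.eval, hread, ← ha]
  have hatab : a.tables = t.tables := rfl
  have hav : ∀ x, x ≠ 11 → a.vars x = t.vars x := fun x hx => by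
    rw [ha, Store.setVar_vars, if_neg hx]
  have ha11 : a.vars 11 = w := by simp [ha]
  have haa : ∀ x, a.arrs x = t.arrs x := fun x => rfl
  obtain ⟨etab, evar, earr, epos, eneg⟩ := run_edgeProg a
  obtain ⟨mtab, mvar, marr⟩ := run_moveUnvisitedProg (edgeProg.run a)
  have h17 : a.vars 17 = s.vars 17 := by rw [hav _ (by simp), h.vars 17 (by simp)]
  have ha3 : a.vars 3 = i := by rw [hav _ (by simp), h.vars 3 (by simp), h3]
  rw [etab, hatab, evar 3 (by simp) (by simp), evar 11 (by simp) (by simp),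
    evar 5 (by simp) (by simp), ha11, ha3, hav 5 (by simp), h.vars 5 (by simp), h5] at mtab
  rw [hatab, ha11, hgrp, h17, ha3, hav 16 (by simp), hav 6 (by simp), hav 8 (by simp),
    h.vars 6 (by simp), h6, haa, haa] at epos
  rw [hatab, ha11, hgrp, h17] at eneg
  have hedges : groupEdges s.tables (s.vars 17) v ((adj v).take (j + 1)) =
      groupEdges s.tables (s.vars 17) v ((adj v).take j) ++
        if s.tables.grp (s.tables.cls w) = s.vars 17 then [(v, w)] else [] := by
    rw [htake, groupEdges, groupEdges, List.filter_append, List.map_append]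
    by_cases hc : s.tables.grp (s.tables.cls w) = s.vars 17 <;> simp [hc]
  generalize edgeProg.run a = b at *
  generalize moveUnvisitedProg.run b = d at *
  rw [hrun]
  have hout : ∀ p, (∀ x, x = 8 ∨ x = 16 → (d.setVar 10 p).vars x = b.vars x) ∧
      (∀ x, x = 6 ∨ x = 7 → (d.setVar 10 p).arrs x = b.arrs x) := by
    intro p
    constructor
    · rintro x (rfl | rfl) <;> simp [mvar]
    · rintro x (rfl | rfl) <;> simp [marr]
  have hfresh : (∃ x ∈ (adj v).take (j + 1), s.tables.grp (s.tables.cls x) = s.vars 17 ∧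
      s.tables.pos x < i) ↔ (∃ x ∈ (adj v).take j, s.tables.grp (s.tables.cls x) = s.vars 17 ∧
      s.tables.pos x < i) ∨ (s.tables.grp (s.tables.cls w) = s.vars 17 ∧ s.tables.pos w < i) := by
    rw [htake]
    simp only [List.mem_append, List.mem_singleton, or_and_right, exists_or, exists_eq_left]
  have hle := h.le
  constructor
  · rintro x (rfl | rfl | rfl | rfl | rfl | rfl | rfl) <;>
      rw [Store.setVar_vars, if_neg (by simp), mvar _ (by simp), evar _ (by simp) (by simp),
        hav _ (by simp), h.vars _ (by simp)]
  · rintro x (rfl | rfl | rfl | rfl | rfl) <;>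
      rw [Store.setVar_arrs, marr _ (by simp), earr _ (by simp) (by simp), haa,
        h.arrs _ (by simp)]
  · rw [Store.setVar_vars, if_pos rfl, mvar _ (by simp), evar _ (by simp) (by simp),
        hav _ (by simp), h.idx, Nat.add_assoc]
  · have hd : (d.setVar 10 (d.vars 10 + 1)).tables = d.tables := by
      simp [Store.tables]
    rw [hd, mtab, htake]
    split_ifs with hc
    · have hD : {a | a ∈ (adj v).take j ++ [w] ∧ i + 1 ≤ s.tables.pos a} =
          insert w {a | a ∈ (adj v).take j ∧ i + 1 ≤ s.tables.pos a} := by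
        ext x
        simp only [List.mem_append, List.mem_singleton, Set.mem_ofPred_eq, Set.mem_insert_iff]
        constructor
        · rintro ⟨hx | hx, h2⟩
          · exact Or.inr ⟨hx, h2⟩
          · exact Or.inl hx
        · rintro (rfl | ⟨hx, h2⟩)
          · exact ⟨Or.inr rfl, hti'.1 hc⟩
          · exact ⟨Or.inl hx, h2⟩
      rw [hD]
      exact h.moved.move hparts (fun hm => hwt hm.1) (hti'.1 hc)
    · have hD : {a | a ∈ (adj v).take j ++ [w] ∧ i + 1 ≤ s.tables.pos a} =
          {a | a ∈ (adj v).take j ∧ i + 1 ≤ s.tables.pos a} := by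
        ext x
        simp only [List.mem_append, List.mem_singleton, Set.mem_ofPred_eq]
        constructor
        · rintro ⟨hx | rfl, h2⟩
          · exact ⟨hx, h2⟩
          · exact absurd (hti'.2 h2) hc
        · rintro ⟨hx, h2⟩
          exact ⟨Or.inl hx, h2⟩
      rw [hD]
      exact h.moved
  · rw [(hout _).1 8 (by simp)]
    simp only [hfresh]
    by_cases hc : s.tables.grp (s.tables.cls w) = s.vars 17
    · rw [(epos hc).2.2.2, h.fresh]
      simp only [hti, hc, true_and]
      by_cases hp : s.tables.pos w < i <;> simp [hp]
    · rw [eneg hc, hav _ (by simp), h.fresh]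
      simp only [hc, false_and, or_false]
  · rw [(hout _).1 16 (by simp)]
    by_cases hc : s.tables.grp (s.tables.cls w) = s.vars 17
    · rw [(epos hc).2.2.1]
      omega
    · rw [eneg hc, hav _ (by simp)]
      exact hle
  · intro p hp
    rw [(hout _).2 6 (by simp)]
    by_cases hc : s.tables.grp (s.tables.cls w) = s.vars 17
    · rw [(epos hc).1, Function.update_of_ne (by omega), h.fst_old p hp]
    · rw [eneg hc, haa, h.fst_old p hp]
  · intro p hp
    rw [(hout _).2 7 (by simp)]
    by_cases hc : s.tables.grp (s.tables.cls w) = s.vars 17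
    · rw [(epos hc).2.1, Function.update_of_ne (by omega), h.snd_old p hp]
    · rw [eneg hc, haa, h.snd_old p hp]
  · rw [(hout _).2 6 (by simp), (hout _).1 16 (by simp), hedges]
    by_cases hc : s.tables.grp (s.tables.cls w) = s.vars 17
    · rw [(epos hc).1, (epos hc).2.2.1, segment_succ _ hle, Function.update_self, if_pos hc,
        segment_congr (g := t.arrs 6) fun p hp => Function.update_of_ne (by omega) _ _, h.fst_new]
      simp
    · rw [eneg hc, haa, hav _ (by simp), h.fst_new, if_neg hc, List.append_nil]
  · rw [(hout _).2 7 (by simp), (hout _).1 16 (by simp), hedges]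
    by_cases hc : s.tables.grp (s.tables.cls w) = s.vars 17
    · rw [(epos hc).2.1, (epos hc).2.2.1, segment_succ _ hle, Function.update_self, if_pos hc,
        segment_congr (g := t.arrs 7) fun p hp => Function.update_of_ne (by omega) _ _, h.snd_new]
      simp
    · rw [eneg hc, haa, hav _ (by simp), h.snd_new, if_neg hc, List.append_nil]

theorem exec_scan {adj : Fin n → List (Fin n)} {v : Fin n} {i : ℕ} {s : Store}
    (hadj : HoldsAdj adj (s.arrs 0) (s.arrs 1)) (hnd : (adj v).Nodup) (hvv : v ∉ adj v)
    (hparts : Parts n (i + 1) s.tables) (hpos : s.tables.pos v = i) (h3 : s.vars 3 = i)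
    (h5 : s.vars 5 = s.tables.next) (h6 : s.vars 6 = v) (h8 : s.vars 8 = 1)
    (h10 : s.vars 10 = s.arrs 0 v) :
    ∃ T t, Exec (.loop scanTest scanBody) s T t ∧ ScanInv (adj v) v i s (adj v).length t ∧
      T ≤ (adj v).length * (scanTest.cost + scanBody.maxCost) + scanTest.cost := by
  refine exec_loop_bounded (ScanInv (adj v) v i s) _ _ (fun j t hj h => ?_)
    (fun j t hj h => ?_) ?_
  · simp only [scanTest, Test.Holds, Expr.eval]
    rw [h.idx, h.arrs 0 (by simp), h.vars 6 (by simp), h6, hadj.succ]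
    omega
  · obtain ⟨T, hT, hTle⟩ := scanBody_loopFree.exec t
    exact ⟨T, _, hT, hTle, h.step hadj hnd hvv hparts hpos h3 h5 h6 hj⟩
  · have he : {a : Fin n | a ∈ (adj v).take 0 ∧ i + 1 ≤ s.tables.pos a} = ∅ := by simp
    exact ⟨fun _ _ => rfl, fun _ _ => rfl, h10, by rw [he]; exact hparts.moved, by simp [h8], le_rfl,
      fun _ _ => rfl, fun _ _ => rfl, by simp [segment_self, groupEdges],
      by simp [segment_self, groupEdges]⟩

end Scan
end ModLBFS

namespace ModLBFS

/-! ### One iteration of the main loop -/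

section Visit

/-- Take the next vertex, remove it from its class and open a new group if it has none. -/
def preludeProg : Prog := .block [
  .assign 6 (.read 3 (.var 3)),
  .assign 7 (.read 10 (.var 6)),
  .write 11 (.var 7) (.succ (.var 3)),
  .assign 5 (.var 4),
  .write 4 (.var 3) (.var 6),
  .ite (.eq (.read 13 (.var 7)) (.lit 0)) (.block [
    .assign 9 (.succ (.var 9)),
    .write 13 (.var 7) (.var 9)]) .skip,
  .assign 17 (.read 13 (.var 7)),
  .assign 8 (.lit 1),
  .assign 10 (.read 0 (.var 6))]

/-- Open a new output graph if necessary, and move the end marks of the last one. -/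
def closeProg : Prog := .block [
  .ite (.eq (.var 17) (.lit 1)) .skip
    (.ite (.eq (.var 8) (.lit 1)) (.assign 2 (.succ (.var 2))) .skip),
  .assign 3 (.succ (.var 3)),
  .write 5 (.var 2) (.var 3),
  .write 8 (.var 2) (.var 16)]

def visitProg : Prog := .block [preludeProg, .loop scanTest scanBody, closeProg]

theorem preludeProg_loopFree : preludeProg.LoopFree := by
  simp [preludeProg, Prog.block, Prog.LoopFree]

theorem closeProg_loopFree : closeProg.LoopFree := by
  simp [closeProg, Prog.block, Prog.LoopFree]

theorem run_preludeProg (s : Store) {v i : ℕ} (hi : s.vars 3 = i) (hv : s.arrs 3 i = v) :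
    let t := preludeProg.run s
    let c := s.tables.cls v
    (t.tables = { s.tables.remove v i with
      grp := if s.tables.grp c = 0 then Function.update s.tables.grp c (s.vars 9 + 1)
        else s.tables.grp }) ∧
    (∀ x, x = 0 ∨ x = 2 ∨ x = 3 ∨ x = 16 → t.vars x = s.vars x) ∧
    (∀ a, a = 0 ∨ a = 1 ∨ a = 5 ∨ a = 6 ∨ a = 7 ∨ a = 8 → t.arrs a = s.arrs a) ∧
    t.arrs 4 = Function.update (s.arrs 4) i v ∧ t.vars 5 = s.tables.next ∧ t.vars 6 = v ∧
    t.vars 8 = 1 ∧ t.vars 9 = (if s.tables.grp c = 0 then s.vars 9 + 1 else s.vars 9) ∧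
    t.vars 10 = s.arrs 0 v ∧ t.vars 17 = t.tables.grp c := by
  subst hi hv
  by_cases h : s.arrs 13 (s.arrs 10 (s.arrs 3 (s.vars 3))) = 0 <;>
    refine ⟨?_, ?_, ?_, ?_, ?_, ?_, ?_, ?_, ?_, ?_⟩
  all_goals first
    | (rintro x (rfl | rfl | rfl | rfl | rfl | rfl)) | (rintro x (rfl | rfl | rfl | rfl)) | skip
  all_goals
    simp [preludeProg, Prog.block, Prog.run, Expr.eval, Test.Holds, Store.tables, Tables.remove, h]

theorem run_closeProg (s : Store) :
    let t := closeProg.run s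
    t.tables = s.tables ∧ (∀ x, x ≠ 2 → x ≠ 3 → t.vars x = s.vars x) ∧
    (∀ a, a ≠ 5 → a ≠ 8 → t.arrs a = s.arrs a) ∧ t.vars 3 = s.vars 3 + 1 ∧
    t.vars 2 = (if s.vars 17 = 1 then s.vars 2 else if s.vars 8 = 1 then s.vars 2 + 1
      else s.vars 2) ∧
    t.arrs 5 = Function.update (s.arrs 5) (t.vars 2) (s.vars 3 + 1) ∧
    t.arrs 8 = Function.update (s.arrs 8) (t.vars 2) (s.vars 16) := by
  by_cases h : s.vars 17 = 1 <;> by_cases h' : s.vars 8 = 1 <;>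
    refine ⟨?_, fun x hx hx' => ?_, fun x hx hx' => ?_, ?_, ?_, ?_, ?_⟩ <;>
    simp [closeProg, Prog.block, Prog.run, Expr.eval, Test.Holds, Store.tables, *]

variable {n : ℕ}

theorem Parts.of_grp {lo : ℕ} {T : Tables} (h : Parts n lo T) (f : ℕ → ℕ) :
    Parts n lo { T with grp := f } :=
  ⟨h.pos_lt, h.ord_pos, h.exists_pos, h.interval, h.first_le, h.first_cls, h.cls_lt, h.target_lt⟩

theorem SetsRep.of_grp {lo : ℕ} {T : Tables} {l : List (Set (Fin n))} (h : SetsRep n lo T l)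
    (f : ℕ → ℕ) : SetsRep n lo { T with grp := f } l :=
  ⟨h.sorted, h.low, h.cls, h.cover⟩

theorem Moved.ord_low {lo : ℕ} {T₀ T : Tables} {D : Set (Fin n)} (h : Moved n lo T₀ D T)
    (h₀ : Parts n lo T₀) {p : ℕ} (hp : p < lo) (hpn : p < n) : T.ord p = T₀.ord p := by
  obtain ⟨a, rfl⟩ := h₀.exists_pos p hpn
  rw [h₀.ord_pos, ← (h.low_eq a hp).1, h.ord_pos]

variable {G : SimpleGraph (Fin n)} {K : Set (Fin n)} {adj : Fin n → List (Fin n)}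

/-- Invariant of the main loop after `i` visits. -/
structure MainInv (G : SimpleGraph (Fin n)) (K : Set (Fin n)) (adj : Fin n → List (Fin n)) (i : ℕ)
    (s : Store) (sets : List (Set (Fin n))) (order : List (Fin n)) (marked : Set (Set (Fin n)))
    (cur : Set (Fin n)) (blocks : List (List (Fin n) × List (Fin n × Fin n))) : Prop where
  size : s.vars 0 = n
  input : HoldsAdj adj (s.arrs 0) (s.arrs 1)
  idx : s.vars 3 = i
  parts : Parts n i s.tables
  sets_rep : SetsRep n i s.tables sets
  simulates : Simulates G K sets order marked cur blocks
  order_eq : segment (s.arrs 3) 0 i = order.map Fin.val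
  mem_order : ∀ a : Fin n, a ∈ order ↔ s.tables.pos a < i
  groups : Groups K marked cur (fun a : Fin n => s.tables.grp (s.tables.cls a)) (s.vars 9)
  holds : HoldsBlocks s i blocks

theorem mem_groupEdges {T : Tables} {g : ℕ} {v : Fin n} {l : List (Fin n)} {e : Fin n × Fin n} :
    e ∈ groupEdges T g v l ↔ e.1 = v ∧ T.grp (T.cls e.2) = g ∧ e.2 ∈ l := by
  simp only [groupEdges, List.mem_map, List.mem_filter, decide_eq_true_eq]
  constructor
  · rintro ⟨w, ⟨hw, hg⟩, rfl⟩
    exact ⟨rfl, hg, hw⟩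
  · rintro ⟨h1, hg, hw⟩
    exact ⟨e.2, ⟨hw, hg⟩, by rw [← h1]⟩

/-- The time is a constant plus a constant per neighbour of the visited vertex; this form of the
bound allows summation over the degrees. -/
theorem MainInv.step (hK : G.IsClique K) (hadj : IsAdjList G adj) {i : ℕ} {s : Store}
    {sets : List (Set (Fin n))} {order : List (Fin n)} {marked : Set (Set (Fin n))}
    {cur : Set (Fin n)} {blocks : List (List (Fin n) × List (Fin n × Fin n))}
    (h : MainInv G K adj i s sets order marked cur blocks) (hi : i < n) :
    ∃ T t v sets' marked' cur' blocks', Exec visitProg s T t ∧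
      T ≤ preludeProg.maxCost + ((adj v).length * (scanTest.cost + scanBody.maxCost) + scanTest.cost) +
        closeProg.maxCost + 1 ∧
      MainInv G K adj (i + 1) t sets' (order ++ [v]) marked' cur' blocks' := by
  classical
  obtain ⟨v, hv⟩ := h.parts.exists_pos i hi
  have hov : s.arrs 3 i = v := by
    have := h.parts.ord_pos v
    rwa [hv] at this
  obtain ⟨ptab, pvar, parr, p4, p5, p6, p8, p9, p10, p17⟩ := run_preludeProg s h.idx hov
  obtain ⟨T₁, hT₁, hle₁⟩ := preludeProg_loopFree.exec s
  generalize preludeProg.run s = s₁ at *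
  have hcls : ∀ a, s₁.tables.cls a = s.tables.cls a := fun a => by rw [ptab]; rfl
  have hpos : ∀ a, s₁.tables.pos a = s.tables.pos a := fun a => by rw [ptab]; rfl
  have hord : ∀ p, s₁.tables.ord p = s.tables.ord p := fun a => by rw [ptab]; rfl
  have hparts : Parts n (i + 1) s₁.tables := by
    rw [ptab]
    exact (h.parts.remove hv).of_grp _
  have hinput : HoldsAdj adj (s₁.arrs 0) (s₁.arrs 1) := by
    rw [parr 0 (by simp), parr 1 (by simp)]
    exact h.input
  have hvv : v ∉ adj v := fun hm => G.irrefl (((hadj v).2 v).1 hm)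
  obtain ⟨T₂, t₁, hT₂, hscan, hle₂⟩ := exec_scan hinput (hadj v).1 hvv hparts
    ((hpos v).trans hv) ((pvar 3 (by simp)).trans h.idx)
    (p5.trans (by rw [ptab]; rfl)) p6 p8 (p10.trans (by rw [parr 0 (by simp)]))
  have hmoved := hscan.moved
  have hfresh := hscan.fresh
  have hfst := hscan.fst_new
  have hsnd := hscan.snd_new
  rw [List.take_length] at hmoved hfresh hfst hsnd
  obtain ⟨ctab, cvar, carr, c3, c2, c5, c8⟩ := run_closeProg t₁
  obtain ⟨T₃, hT₃, hle₃⟩ := closeProg_loopFree.exec t₁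
  generalize closeProg.run t₁ = t at *
  obtain ⟨pre, X, post, rfl, hpre, hvX⟩ := h.sets_rep.exists_first hv
  have hinj : ∀ a b : Fin n, s.tables.pos a = s.tables.pos b → a = b := fun a b e =>
    Fin.ext (by rw [← h.parts.ord_pos a, ← h.parts.ord_pos b, e])
  have hrep : SetsRep n (i + 1) s₁.tables (pre ++ (X \ {v}) :: post) := by
    rw [ptab]
    exact (h.sets_rep.remove hpre hv hvX hinj).of_grp _
  have hrep' : SetsRep n (i + 1) t.tables (refine G v (pre ++ (X \ {v}) :: post)) := by
    rw [ctab]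
    refine (hrep.split hparts hmoved (N := G.neighborSet v) fun a ha => ?_).filter _ fun A hA => ?_
    · rw [← (hadj v).2 a]
      exact ⟨fun hm => ⟨hm, ha⟩, fun hm => hm.1⟩
    · simpa using hA
  have hmem : ∀ x, x ∈ adj v ↔ G.Adj v x := fun x => (hadj v).2 x
  obtain ⟨out, hinv⟩ := h.simulates.exists_inv hK
  -- Visited vertices belong to `K` or to a marked set and have a non-zero group. A class of group
  -- `0` thus has no visited members, and labelling the class labels exactly `X`.
  have hgX : ∀ a : Fin n, s.tables.grp (s.tables.cls v) = 0 →
      (s.tables.cls a = s.tables.cls v ↔ a ∈ X) := by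
    intro a h0
    rw [h.sets_rep.cls X (by simp) v hvX a]
    refine ⟨fun e => ⟨?_, e⟩, fun e => e.2⟩
    by_contra hlt
    have hao := (h.mem_order a).2 (by omega)
    refine (h.groups.ne_zero a).2 ?_ (by rw [e, h0])
    by_cases haK : a ∈ K
    · exact Or.inl haK
    · exact Or.inr (hinv.visited_marked a hao haK)
  have hvo := hinv.first_notMem rfl hvX
  -- Group numbers are given out in increasing order, and the search leaves a group only when it is
  -- exhausted; hence the group of `v` is always the most recent number.
  have hg17 : s₁.vars 17 = s₁.vars 9 := by
    rw [p17, p9, ptab]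
    by_cases h0 : s.tables.grp (s.tables.cls v) = 0
    · simp only [if_pos h0, Function.update_self]
    · simp only [if_neg h0]
      exact (h.groups.mem_cur v).1 (h.simulates.mem_cur hvo ((h.groups.ne_zero v).1 h0))
  obtain ⟨marked', cur', hgroups, hgv, hcl, hnew, hext⟩ := h.simulates.visit hK h.groups rfl hpre hvX
    (Γ' := fun a : Fin n => s₁.tables.grp (s₁.tables.cls a)) (g' := s₁.vars 9)
    (es := groupEdges s₁.tables (s₁.vars 17) v (adj v))
    (fun h0 => by
      refine ⟨p9.trans (if_neg h0), fun a => ?_⟩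
      rw [hcls, ptab]
      simp only [if_neg h0])
    (fun h0 => by
      refine ⟨p9.trans (if_pos h0), fun a => ?_⟩
      rw [← hgX a h0, hcls, ptab]
      simp only [if_pos h0, Function.update_apply]
      exact ⟨fun e => if_pos e, fun e => if_neg e⟩)
    ⟨((hadj v).1.filter _).map fun _ _ e => (Prod.ext_iff.1 e).2,
      fun e => by rw [mem_groupEdges, hg17, hmem]⟩
  have happ : Appended s t i v (groupEdges s₁.tables (s₁.vars 17) v (adj v)) := by
    have h16 : t.vars 16 = t₁.vars 16 := cvar 16 (by simp) (by simp)
    have h4 : t.arrs 4 = Function.update (s.arrs 4) i v := by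
      rw [carr 4 (by simp) (by simp), hscan.arrs 4 (by simp), p4]
    have hs16 := pvar 16 (by simp)
    have hle := hscan.le
    rw [hs16] at hle hfst hsnd
    refine ⟨fun p hp => ?_, ?_, by omega, fun p hp => ?_, fun p hp => ?_, ?_, ?_, ?_, ?_⟩
    · rw [h4, Function.update_of_ne (by omega)]
    · rw [h4, Function.update_self]
    · rw [carr 6 (by simp) (by simp), hscan.fst_old p (by omega), parr 6 (by simp)]
    · rw [carr 7 (by simp) (by simp), hscan.snd_old p (by omega), parr 7 (by simp)]
    · rw [carr 6 (by simp) (by simp), h16, hfst]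
    · rw [carr 7 (by simp) (by simp), h16, hsnd]
    · rw [c5, hscan.arrs 5 (by simp), parr 5 (by simp), hscan.vars 3 (by simp), pvar 3 (by simp),
        h.idx]
    · rw [c8, hscan.arrs 8 (by simp), parr 8 (by simp), h16]
  have hfresh' : (∃ x ∈ adj v, s₁.tables.grp (s₁.tables.cls x) = s₁.vars 17 ∧ s₁.tables.pos x < i) ↔
      ∃ x ∈ order, s₁.tables.grp (s₁.tables.cls x) = s₁.vars 9 ∧ G.Adj v x := by
    simp only [hmem, h.mem_order, hg17, hpos]
    exact ⟨fun ⟨x, h1, h2, h3⟩ => ⟨x, h3, h2, h1⟩, fun ⟨x, h1, h2, h3⟩ => ⟨x, h3, h2, h1⟩⟩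
  have h2 : t₁.vars 2 = s.vars 2 := by rw [hscan.vars 2 (by simp), pvar 2 (by simp)]
  rw [hscan.vars 17 (by simp), hg17, h2] at c2
  have hblocks : ∃ blocks', Simulates G K (refine G v (pre ++ (X \ {v}) :: post)) (order ++ [v])
      marked' cur' blocks' ∧ HoldsBlocks t (i + 1) blocks' := by
    by_cases h1 : s₁.vars 9 = 1
    · obtain ⟨rfl, hs⟩ := hcl h1
      rw [if_pos h1, h.holds.count] at c2
      exact ⟨[], hs, HoldsBlocks.nil_of_appended happ c2⟩
    · rw [if_neg h1] at c2
      by_cases hx : ∃ x ∈ order, s₁.tables.grp (s₁.tables.cls x) = s₁.vars 9 ∧ G.Adj v x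
      · rw [if_pos (hfresh'.2 hx)] at hfresh
        obtain ⟨l, b, rfl, hs⟩ := hext h1 hx
        rw [hfresh, if_neg (by simp)] at c2
        exact ⟨_, hs, h.holds.extend happ c2⟩
      · rw [if_neg (mt hfresh'.1 hx)] at hfresh
        rw [hfresh, if_pos rfl] at c2
        exact ⟨_, hnew h1 hx, h.holds.append happ c2⟩
  obtain ⟨blocks', hs, hb⟩ := hblocks
  have hex : Exec visitProg s (T₁ + (T₂ + (T₃ + 1))) t :=
    .seq hT₁ (.seq hT₂ (.seq hT₃ (.skip t)))
  refine ⟨_, t, v, _, marked', cur', blocks', hex, by omega, ?_, ?_, ?_, ?_, hrep', hs, ?_, fun a => ?_,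
    ?_, hb⟩
  · rw [cvar 0 (by simp) (by simp), hscan.vars 0 (by simp), pvar 0 (by simp), h.size]
  · rw [carr 0 (by simp) (by simp), carr 1 (by simp) (by simp), hscan.arrs 0 (by simp),
      hscan.arrs 1 (by simp)]
    exact hinput
  · rw [c3, hscan.vars 3 (by simp), pvar 3 (by simp), h.idx]
  · rw [ctab]
    exact hmoved.parts hparts
  · have hlow : ∀ p < i + 1, t.arrs 3 p = s.arrs 3 p := by
      intro p hp
      change t.tables.ord p = s.tables.ord p
      rw [ctab, hmoved.ord_low hparts hp (by omega), hord]
    rw [segment_congr hlow, segment_succ _ (Nat.zero_le i), h.order_eq, hov]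
    simp
  · have hl := hmoved.low a
    rw [ctab, List.mem_append, List.mem_singleton, h.mem_order]
    rw [hpos] at hl
    constructor
    · rintro (ha | rfl)
      · exact hl.2 (by omega)
      · exact hl.2 (by omega)
    · intro ha
      rcases Nat.lt_or_ge (s.tables.pos a) i with h3 | h3
      · exact Or.inl h3
      · have := hl.1 ha
        exact Or.inr (hinj a v (by omega))
  · have hgrp : (fun a : Fin n => t.tables.grp (t.tables.cls a)) =
        fun a : Fin n => s₁.tables.grp (s₁.tables.cls a) := by
      funext a
      rw [ctab, hmoved.grp_cls hparts]
    rw [hgrp, cvar 9 (by simp) (by simp), hscan.vars 9 (by simp)]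
    exact hgroups

end Visit
end ModLBFS

namespace ModLBFS

/-! ### Initialisation -/

section Init

variable {n : ℕ}

def identityBody : Prog := .block [
  .write 3 (.var 3) (.var 3),
  .write 9 (.var 3) (.var 3),
  .assign 3 (.succ (.var 3))]

def identityTest : Test := .lt (.var 3) (.var 0)

/-- Class `0` holds all vertices, so the next unused class is `1`. With base `1`, the zero targets
count as not yet split. -/
def resetProg : Prog := .block [.assign 4 (.lit 1), .assign 5 (.lit 1), .assign 10 (.lit 0)]

def cliqueBody : Prog := .block [
  .assign 11 (.read 2 (.var 10)), moveProg, .assign 10 (.succ (.var 10))]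

def cliqueTest : Test := .lt (.var 10) (.var 1)

/-- Give the class of the clique, if there is one, the group `1`. -/
def groupProg : Prog := .block [
  .ite (.lt (.lit 0) (.var 1)) (.write 13 (.read 12 (.lit 0)) (.lit 1)) .skip,
  .assign 9 (.lit 1), .assign 3 (.lit 0)]

theorem identityBody_loopFree : identityBody.LoopFree := by
  simp [identityBody, Prog.block, Prog.LoopFree]

theorem resetProg_loopFree : resetProg.LoopFree := by
  simp [resetProg, Prog.block, Prog.LoopFree]

theorem cliqueBody_loopFree : cliqueBody.LoopFree := by
  simp [cliqueBody, Prog.block, Prog.LoopFree, moveProg_loopFree]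

theorem groupProg_loopFree : groupProg.LoopFree := by
  simp [groupProg, Prog.block, Prog.LoopFree]

theorem exec_identity {s : Store} (h0 : s.vars 0 = n) (h3 : s.vars 3 = 0) :
    ∃ T t, Exec (.loop identityTest identityBody) s T t ∧
      ((∀ x, x ≠ 3 → t.vars x = s.vars x) ∧ (∀ a, a ≠ 3 → a ≠ 9 → t.arrs a = s.arrs a) ∧
        t.vars 3 = n ∧ ∀ p < n, t.arrs 3 p = p ∧ t.arrs 9 p = p) ∧
      T ≤ n * (identityTest.cost + identityBody.maxCost) + identityTest.cost := by
  refine exec_loop_bounded (fun j t => (∀ x, x ≠ 3 → t.vars x = s.vars x) ∧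
    (∀ a, a ≠ 3 → a ≠ 9 → t.arrs a = s.arrs a) ∧ t.vars 3 = j ∧
    ∀ p < j, t.arrs 3 p = p ∧ t.arrs 9 p = p) n _ (fun j t hj h => ?_) (fun j t hj h => ?_) ?_
  · simp [identityTest, Test.Holds, Expr.eval, h.1, h.2.2.1, h0]
  · obtain ⟨T, hT, hle⟩ := identityBody_loopFree.exec t
    obtain ⟨h1, h2, h3, h4⟩ := h
    refine ⟨T, _, hT, hle, fun x hx => ?_, fun a ha ha' => ?_, ?_, fun p hp => ?_⟩
    · simp [identityBody, Prog.block, Prog.run, Expr.eval, hx, h1]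
    · simp [identityBody, Prog.block, Prog.run, Expr.eval, ha, ha', h2]
    · simp [identityBody, Prog.block, Prog.run, Expr.eval, h3]
    · by_cases hpj : p = j
      · simp [identityBody, Prog.block, Prog.run, Expr.eval, h3, hpj]
      · have := h4 p (by omega)
        simp [identityBody, Prog.block, Prog.run, Expr.eval, h3, hpj, this]
  · exact ⟨fun _ _ => rfl, fun _ _ _ => rfl, h3, fun p hp => absurd hp (Nat.not_lt_zero p)⟩

/-- The tables with all vertices in class `0`, in the natural order. -/
structure Initial (n : ℕ) (T : Tables) : Prop where
  ord : ∀ p < n, T.ord p = p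
  pos : ∀ p < n, T.pos p = p
  cls : ∀ p, T.cls p = 0
  first : ∀ c, T.first c = 0
  target : ∀ c, T.target c = 0
  grp : ∀ c, T.grp c = 0
  next : T.next = 1

theorem Initial.parts {T : Tables} (h : Initial n T) : Parts n 0 T where
  pos_lt a := by rw [h.pos a a.2]; exact a.2
  ord_pos a := by rw [h.pos a a.2, h.ord a a.2]
  exists_pos p hp := ⟨⟨p, hp⟩, h.pos p hp⟩
  interval a b d _ _ _ _ := by rw [h.cls, h.cls]
  first_le a _ := by rw [h.first]; omega
  first_cls a b _ _ := by rw [h.cls, h.cls]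
  cls_lt a := by rw [h.cls, h.next]; exact one_pos
  target_lt c := by rw [h.target, h.next]; exact one_pos

theorem Initial.setsRep {T : Tables} (h : Initial n T) :
    SetsRep n 0 T [(Set.univ : Set (Fin n))] where
  sorted := List.pairwise_singleton _ _
  low _ _ _ _ := Nat.zero_le _
  cls A hA a _ b := by
    rw [List.mem_singleton.1 hA, h.cls, h.cls]
    simp
  cover a _ := ⟨Set.univ, List.mem_singleton_self _, trivial⟩

theorem exec_clique {ks : List (Fin n)} (hks : ks.Nodup) {s : Store} (h : Initial n s.tables)
    (h1 : s.vars 1 = ks.length) (h5 : s.vars 5 = 1) (h10 : s.vars 10 = 0)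
    (h2 : ∀ j (hj : j < ks.length), s.arrs 2 j = ks[j]) :
    ∃ T t, Exec (.loop cliqueTest cliqueBody) s T t ∧
      ((∀ x, (x = 0 ∨ x = 1 ∨ x = 2 ∨ x = 5 ∨ x = 16) → t.vars x = s.vars x) ∧
        (∀ a, (a = 0 ∨ a = 1 ∨ a = 2 ∨ a = 5 ∨ a = 8) → t.arrs a = s.arrs a) ∧
        t.vars 10 = ks.length ∧
        Moved n 0 s.tables {a | a ∈ ks.take ks.length} t.tables) ∧
      T ≤ ks.length * (cliqueTest.cost + cliqueBody.maxCost) + cliqueTest.cost := by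
  refine exec_loop_bounded (fun j t =>
    (∀ x, (x = 0 ∨ x = 1 ∨ x = 2 ∨ x = 5 ∨ x = 16) → t.vars x = s.vars x) ∧
    (∀ a, (a = 0 ∨ a = 1 ∨ a = 2 ∨ a = 5 ∨ a = 8) → t.arrs a = s.arrs a) ∧
    t.vars 10 = j ∧ Moved n 0 s.tables {a | a ∈ ks.take j} t.tables) ks.length _
    (fun j t hj h => ?_) (fun j t hj ht => ?_) ?_
  · simp only [cliqueTest, Test.Holds, Expr.eval]
    rw [h.1 1 (by simp), h1, h.2.2.1]
  · obtain ⟨T, hT, hle⟩ := cliqueBody_loopFree.exec t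
    obtain ⟨hv, ha, h10, hm⟩ := ht
    have hread : t.arrs 2 (t.vars 10) = ks[j] := by rw [ha 2 (by simp), h10, h2 j hj]
    have hrun : cliqueBody.run t = (moveProg.run (t.setVar 11 ks[j])).setVar 10
        ((moveProg.run (t.setVar 11 ks[j])).vars 10 + 1) := by
      simp only [cliqueBody, Prog.block, Prog.run, Expr.eval, hread]
    have htake : ks.take (j + 1) = ks.take j ++ [ks[j]] := by
      rw [List.take_add_one, List.getElem?_eq_getElem hj]
      rfl
    have hnot : ks[j] ∉ ks.take j := by
      have := hks.sublist (List.take_sublist (j + 1) ks)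
      rw [htake] at this
      exact fun hm => (List.nodup_append.1 this).2.2 _ hm ks[j] (by simp) rfl
    refine ⟨T, _, hT, hle, ?_, ?_, ?_, ?_⟩
    · rintro x (rfl | rfl | rfl | rfl | rfl) <;>
        rw [hrun, Store.setVar_vars, if_neg (by simp), run_moveProg_vars _ (by simp),
          Store.setVar_vars, if_neg (by simp), hv _ (by simp)]
    · rintro x (rfl | rfl | rfl | rfl | rfl) <;>
        rw [hrun, Store.setVar_arrs, run_moveProg_arrs _ (by simp), Store.setVar_arrs,
          ha _ (by simp)]
    · rw [hrun, Store.setVar_vars, if_pos rfl, run_moveProg_vars _ (by simp), Store.setVar_vars,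
        if_neg (by simp), h10]
    · have htab : (cliqueBody.run t).tables = t.tables.move s.tables.next ks[j] := by
        rw [hrun]
        have h11 : (t.setVar 11 ks[j]).vars 11 = ks[j] := by simp
        have h5' : (t.setVar 11 ks[j]).vars 5 = s.tables.next := by
          rw [Store.setVar_vars, if_neg (by simp), hv 5 (by simp), h5, h.next]
        have := run_moveProg_tables (t.setVar 11 ks[j])
        rw [h11, h5'] at this
        have hsv : ∀ r : Store, ∀ k, (r.setVar 10 k).tables = r.tables := fun r k => by
          simp [Store.tables]
        rw [hsv, this]
        rfl
      have hD : {a | a ∈ ks.take (j + 1)} = insert ks[j] {a | a ∈ ks.take j} := by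
        ext x
        rw [Set.mem_insert_iff, Set.mem_ofPred_eq, Set.mem_ofPred_eq, htake, List.mem_append,
          List.mem_singleton, or_comm]
      rw [htab, hD]
      exact hm.move h.parts hnot (Nat.zero_le _)
  · have he : {a : Fin n | a ∈ ks.take 0} = ∅ := by simp
    exact ⟨fun _ _ => rfl, fun _ _ => rfl, h10, by rw [he]; exact h.parts.moved⟩

theorem run_groupProg (s : Store) :
    let t := groupProg.run s
    t.tables = { s.tables with
      grp := if 0 < s.vars 1 then Function.update s.tables.grp (s.tables.target 0) 1
        else s.tables.grp } ∧
    (∀ x, x ≠ 3 → x ≠ 9 → t.vars x = s.vars x) ∧ t.vars 3 = 0 ∧ t.vars 9 = 1 ∧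
    ∀ a, a ≠ 13 → t.arrs a = s.arrs a := by
  by_cases h : 0 < s.vars 1 <;>
    refine ⟨?_, fun x hx hx' => ?_, ?_, ?_, fun a ha => ?_⟩ <;>
    simp [groupProg, Prog.block, Prog.run, Expr.eval, Test.Holds, Store.tables, *]

/-- The part of the program before the main loop. -/
def initProg : Prog := .block [
  .loop identityTest identityBody, resetProg, .loop cliqueTest cliqueBody, groupProg]

/-- The sequence `(K, V \ K)` arises from one class by the same moves as in a refinement, with `K`
in the role of the neighbourhood. The clique gets group `1`, so later groups start at `2`. -/
theorem exec_init (G : SimpleGraph (Fin n)) {K : Set (Fin n)} (adj : Fin n → List (Fin n))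
    {ks : List (Fin n)} (hks : IsOrderingOf ks K) :
    ∃ T t, Exec initProg (inputStore n adj ks) T t ∧
      T ≤ n * (identityTest.cost + identityBody.maxCost) +
        n * (cliqueTest.cost + cliqueBody.maxCost) +
        (identityTest.cost + resetProg.maxCost + cliqueTest.cost + groupProg.maxCost + 1) ∧
      MainInv G K adj 0 t [K, Kᶜ] [] ∅ K [] := by
  set s₀ := inputStore n adj ks with hs₀
  obtain ⟨T₁, s₁, hT₁, ⟨v1, a1, -, hid⟩, hle₁⟩ := exec_identity (n := n) (s := s₀) rfl rfl
  obtain ⟨T₂, hT₂, hle₂⟩ := resetProg_loopFree.exec s₁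
  have v2 : ∀ x, (resetProg.run s₁).vars x =
      if x = 10 then 0 else if x = 5 then 1 else if x = 4 then 1 else s₁.vars x := fun x => by
    simp [resetProg, Prog.block, Prog.run, Expr.eval]
  have a2 : (resetProg.run s₁).arrs = s₁.arrs := by
    simp [resetProg, Prog.block, Prog.run, Expr.eval]
  generalize resetProg.run s₁ = s₂ at *
  have hzero : ∀ a, a ≠ 0 → a ≠ 1 → a ≠ 2 → ∀ p, s₀.arrs a p = 0 := by
    intro a h0 h1 h2 p
    obtain ⟨k, rfl⟩ : ∃ k, a = k + 3 := ⟨a - 3, by omega⟩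
    simp [hs₀, inputStore, ofList]
  have hzero₂ : ∀ a, 9 < a → ∀ p, s₂.arrs a p = 0 := fun a ha p => by
    rw [a2, a1 a (by omega) (by omega), hzero a (by omega) (by omega) (by omega)]
  have hinit : Initial n s₂.tables := by
    refine ⟨fun p hp => ?_, fun p hp => ?_, fun p => ?_, fun p => ?_, fun p => ?_, fun p => ?_, ?_⟩
    · exact (congrFun (congrFun a2 3) p).trans (hid p hp).1
    · exact (congrFun (congrFun a2 9) p).trans (hid p hp).2
    · exact hzero₂ 10 (by simp) p
    · exact hzero₂ 11 (by simp) p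
    · exact hzero₂ 12 (by simp) p
    · exact hzero₂ 13 (by simp) p
    · exact (v2 4).trans (by simp)
  have harr : ∀ a, a = 0 ∨ a = 1 ∨ a = 2 ∨ a = 5 ∨ a = 8 → s₂.arrs a = s₀.arrs a := by
    rintro a (rfl | rfl | rfl | rfl | rfl) <;> rw [a2, a1 _ (by simp) (by simp)]
  obtain ⟨T₃, s₃, hT₃, ⟨v3, a3, -, hm⟩, hle₃⟩ := exec_clique hks.1 hinit
    (by rw [v2, if_neg (by simp), if_neg (by simp), if_neg (by simp), v1 _ (by simp)]; rfl)
    (by simp [v2]) (by simp [v2])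
    (fun j hj => by rw [harr 2 (by simp)]; exact inputStore_clique adj ks j hj)
  rw [List.take_length] at hm
  obtain ⟨T₄, hT₄, hle₄⟩ := groupProg_loopFree.exec s₃
  obtain ⟨t4, v4, h3, h9, a4⟩ := run_groupProg s₃
  generalize groupProg.run s₃ = t at *
  have hvar : ∀ x, x = 0 ∨ x = 1 ∨ x = 2 ∨ x = 16 → s₃.vars x = s₀.vars x := by
    rintro x (rfl | rfl | rfl | rfl) <;>
      rw [v3 _ (by simp), v2, if_neg (by simp), if_neg (by simp), if_neg (by simp), v1 _ (by simp)]
  have hex : Exec initProg s₀ (T₁ + (T₂ + (T₃ + (T₄ + 1)))) t :=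
    .seq hT₁ (.seq hT₂ (.seq hT₃ (.seq hT₄ (.skip t))))
  have hlen : ks.length ≤ n := by
    have := hks.1.length_le_card
    rwa [Fintype.card_fin] at this
  have hle : ks.length * (cliqueTest.cost + cliqueBody.maxCost) ≤
      n * (cliqueTest.cost + cliqueBody.maxCost) := Nat.mul_le_mul_right _ hlen
  have hk : s₃.vars 1 = ks.length := hvar 1 (by simp)
  have hD : ∀ a : Fin n, a ∈ K ↔ a ∈ {a | a ∈ ks} := fun a => (hks.2 a).symm
  have hrep : SetsRep n 0 t.tables [K, Kᶜ] := by
    rw [t4]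
    have := hinit.setsRep.split hinit.parts hm (N := K) fun a _ => hD a
    simp only [List.flatMap_cons, List.flatMap_nil, List.append_nil, Set.univ_inter,
      ← Set.compl_eq_univ_sdiff] at this
    exact this.of_grp _
  have hgrp : ∀ a : Fin n, (a ∈ K → t.tables.grp (t.tables.cls a) = 1) ∧
      (a ∉ K → t.tables.grp (t.tables.cls a) = 0) := by
    intro a
    have hzero : s₃.tables.grp (s₃.tables.cls a) = 0 := by
      rw [hm.grp_cls hinit.parts, hinit.grp]
    rw [t4]
    constructor
    · intro ha
      have hpos : 0 < s₃.vars 1 := by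
        rw [hk]
        exact List.length_pos_of_mem ((hks.2 a).2 ha)
      have hc := hm.cls_mem a ((hD a).1 ha)
      rw [hinit.cls] at hc
      simp only [if_pos hpos, hc, Function.update_self]
    · intro ha
      have hc := hm.cls_notMem a (mt (hD a).2 ha)
      rw [hinit.cls] at hc
      simp only
      -- For a non-empty clique the target of class `0` is a new class, so the write does not affect
      -- the group of class `0`. For an empty clique the target would still be `0`, which is why the
      -- program tests for this case.
      split_ifs with hpos
      · rw [hk] at hpos
        obtain ⟨b, hb⟩ := List.exists_mem_of_length_pos hpos
        have hb' := hm.le_target b hb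
        rw [hinit.cls, hinit.next] at hb'
        rw [Function.update_of_ne (by omega)]
        exact hzero
      · exact hzero
  have h5 : t.arrs 5 0 = 0 := by
    rw [a4 5 (by simp), a3 5 (by simp), harr 5 (by simp)]
    exact hzero 5 (by simp) (by simp) (by simp) 0
  have h8 : t.arrs 8 0 = 0 := by
    rw [a4 8 (by simp), a3 8 (by simp), harr 8 (by simp)]
    exact hzero 8 (by simp) (by simp) (by simp) 0
  have h16 : t.vars 16 = 0 := by rw [v4 _ (by simp) (by simp), hvar 16 (by simp)]; rfl
  refine ⟨_, t, hex, by omega, ?_, ?_, h3, ?_, hrep, Simulates.init G K, by simp [segment_self],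
    by simp, ⟨fun a => ?_, fun a => ?_, fun a => ?_, fun a => ?_, by omega⟩, ?_, ?_, ?_, ?_, ?_⟩
  · rw [v4 _ (by simp) (by simp), hvar 0 (by simp)]
    rfl
  · rw [a4 0 (by simp), a4 1 (by simp), a3 0 (by simp), a3 1 (by simp), harr 0 (by simp),
      harr 1 (by simp)]
    exact inputStore_holdsAdj adj ks
  · rw [t4]
    exact (hm.parts hinit.parts).of_grp _
  · by_cases ha : a ∈ K
    · simp [ha, (hgrp a).1 ha]
    · simp [ha, (hgrp a).2 ha]
  · by_cases ha : a ∈ K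
    · simp [ha, (hgrp a).1 ha]
    · simp [ha, (hgrp a).2 ha]
  · by_cases ha : a ∈ K
    · simp [ha, (hgrp a).1 ha, h9]
    · simp [ha, (hgrp a).2 ha, h9]
  · by_cases ha : a ∈ K
    · simp [(hgrp a).1 ha, h9]
    · simp [(hgrp a).2 ha]
  · rw [v4 _ (by simp) (by simp), hvar 2 (by simp)]
    rfl
  · exact h5
  · exact h8.trans h16.symm
  · intro j hj
    obtain rfl : j = 0 := by simpa using hj
    omega
  · simp

end Init

/-! ### The linear time bound -/

section Main

variable {n : ℕ}

def mainTest : Test := .lt (.var 3) (.var 0)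

/-- A linear-time implementation of the modified lexicographic breadth-first search. -/
def searchProg : Prog := .seq initProg (.loop mainTest visitProg)

/-- The part of an iteration that does not depend on the degree, including the test of the main
loop; the final `1` pays for the `skip` that ends the block. -/
def visitCost : ℕ :=
  mainTest.cost + preludeProg.maxCost + scanTest.cost + closeProg.maxCost + 1

def neighbourCost : ℕ := scanTest.cost + scanBody.maxCost

def initCost : ℕ :=
  identityTest.cost + identityBody.maxCost + cliqueTest.cost + cliqueBody.maxCost +
    resetProg.maxCost + groupProg.maxCost + 1 + mainTest.cost

theorem IsAdjList.sum_length {G : SimpleGraph (Fin n)} {adj : Fin n → List (Fin n)}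
    (h : IsAdjList G adj) : ∑ v, (adj v).length = 2 * G.edgeSet.ncard := by
  classical
  have hdeg : ∀ v, (adj v).length = G.degree v := by
    intro v
    rw [← List.toFinset_card_of_nodup (h v).1]
    refine congrArg _ (Finset.ext fun w => ?_)
    rw [List.mem_toFinset, (h v).2, SimpleGraph.mem_neighborFinset, SimpleGraph.mem_neighborSet]
  simp only [hdeg]
  rw [SimpleGraph.sum_degrees_eq_twice_card_edges, ← SimpleGraph.coe_edgeFinset,
    Set.ncard_coe_finset]

/-- The per-visit bounds are summed over the order, which lists each vertex once, and the degrees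
add up to twice the number of edges. -/
theorem exec_search {G : SimpleGraph (Fin n)} {K : Set (Fin n)} {adj : Fin n → List (Fin n)}
    {ks : List (Fin n)} (hK : G.IsClique K) (hadj : IsAdjList G adj) (hks : IsOrderingOf ks K) :
    ∃ T t s, Exec searchProg (inputStore n adj ks) T t ∧
      T ≤ (visitCost + 2 * neighbourCost + initCost) * (n + G.edgeSet.ncard + 1) ∧
      Reachable G K s ∧ s.Done ∧ HoldsOutput t s.order s.out := by
  obtain ⟨T₁, s₁, hT₁, hle₁, h₁⟩ := exec_init G adj hks
  -- The invariant bounds the elapsed time by the total charge of the vertices visited so far, since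
  -- no uniform bound per iteration would be linear. The last, failing test is charged to
  -- `initCost`.
  obtain ⟨T₂, t, hT₂, τ, ⟨sets, order, marked, cur, blocks, h, hτ⟩, hT⟩ :=
    exec_loop (b := mainTest) (p := visitProg)
    (fun i τ s => ∃ sets order marked cur blocks, MainInv G K adj i s sets order marked cur blocks ∧
      τ ≤ (order.map fun v => visitCost + (adj v).length * neighbourCost).sum) n
    (fun i τ s hi ⟨sets, order, marked, cur, blocks, h, hτ⟩ => by
      simp only [mainTest, Test.Holds, Expr.eval]
      rw [h.idx, h.size])
    (fun i τ s hi ⟨sets, order, marked, cur, blocks, h, hτ⟩ => by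
      obtain ⟨T, t, v, sets', marked', cur', blocks', hT, hle, h'⟩ := h.step hK hadj hi
      refine ⟨T, t, hT, sets', _, marked', cur', blocks', h', ?_⟩
      rw [List.map_append, List.sum_append, List.map_singleton, List.sum_singleton]
      simp only [visitCost, neighbourCost] at hτ ⊢
      omega)
    n 0 0 s₁ (Nat.zero_add n) ⟨_, _, _, _, _, h₁, Nat.zero_le _⟩
  have hdone : ∀ Y ∈ sets, Y = ∅ := by
    intro Y hY
    refine Set.eq_empty_of_forall_notMem fun a ha => ?_
    have h1 := h.sets_rep.low Y hY a ha
    have h2 := h.parts.pos_lt a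
    omega
  obtain ⟨s, hs, hd, rfl, hl⟩ := h.simulates.finish hK hdone
  refine ⟨_, t, s, .seq hT₁ hT₂, ?_, hs, hd, h.order_eq, ?_, h.holds.holdsGraph hl⟩
  · have hall : ∀ a, a ∈ s.order := fun a => (h.mem_order a).2 (h.parts.pos_lt a)
    have hsum : (s.order.map fun v => visitCost + (adj v).length * neighbourCost).sum =
        n * visitCost + 2 * G.edgeSet.ncard * neighbourCost := by
      have huniv : s.order.toFinset = Finset.univ :=
        Finset.eq_univ_of_forall fun a => List.mem_toFinset.2 (hall a)
      rw [← List.sum_toFinset _ (hs.inv hK).nodup, huniv,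
        Finset.sum_add_distrib, ← Finset.sum_mul, hadj.sum_length]
      simp
    rw [hsum] at hτ
    have hinit : T₁ + mainTest.cost ≤ (n + 1) * initCost := by
      refine (Nat.add_le_add_right hle₁ _).trans ?_
      rw [initCost]
      ring_nf
      omega
    have h1 : (n + 1) * initCost ≤ (n + G.edgeSet.ncard + 1) * initCost :=
      Nat.mul_le_mul_right _ (by omega)
    have h2 : n * visitCost ≤ (n + G.edgeSet.ncard + 1) * visitCost :=
      Nat.mul_le_mul_right _ (by omega)
    have h3 : 2 * G.edgeSet.ncard * neighbourCost ≤
        (n + G.edgeSet.ncard + 1) * (2 * neighbourCost) := by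
      rw [mul_comm 2, mul_assoc]
      exact Nat.mul_le_mul_right _ (by omega)
    rw [mul_comm, mul_add, mul_add]
    omega
  · rw [h.holds.count, hl.length_eq]

end Main
end ModLBFS

theorem mainTheorem9 :
    -- every run of the algorithm, whatever choices are made, stops with output `C_G(K)`
    (∀ (V : Type*) [Finite V] (G : SimpleGraph V) (K : Set V),
      ModLBFS.IsChordal G → G.IsClique K →
        (¬ ∃ f : ℕ → ModLBFS.LState V,
          f 0 = ModLBFS.LState.init K ∧ ∀ i, ModLBFS.Step G K (f i) (f (i + 1))) ∧
        ∀ s : ModLBFS.LState V, ModLBFS.Reachable G K s →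
          (¬ s.Done → ∃ s', ModLBFS.Step G K s s') ∧
          (s.Done → s.out.Nodup ∧
            ∀ C, C ∈ s.out ↔ C ∈ ModLBFS.undirectedComponents G K)) ∧
    -- the algorithm can be implemented in linear time
    (∃ (P : ModLBFS.Prog) (c : ℕ),
      ∀ (n : ℕ) (G : SimpleGraph (Fin n)) (K : Set (Fin n))
        (adj : Fin n → List (Fin n)) (ks : List (Fin n)),
        ModLBFS.IsChordal G → G.IsClique K →
        ModLBFS.IsAdjList G adj → ModLBFS.IsOrderingOf ks K →
          ∃ (T : ℕ) (t : ModLBFS.Store) (s : ModLBFS.LState (Fin n)),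
            ModLBFS.Exec P (ModLBFS.inputStore n adj ks) T t ∧
            T ≤ c * (n + G.edgeSet.ncard + 1) ∧
            ModLBFS.Reachable G K s ∧ s.Done ∧
            ModLBFS.HoldsOutput t s.order s.out ∧
            (∀ C, C ∈ s.out ↔ C ∈ ModLBFS.undirectedComponents G K)) := by
  refine ⟨fun V _ G K hG hK => ⟨ModLBFS.not_exists_infinite_run hK, fun s hs =>
    ⟨ModLBFS.exists_step, fun hd => ⟨(hs.inv hK).out_nodup, hs.done_iff hG hK hd⟩⟩⟩,
    ModLBFS.searchProg, ModLBFS.visitCost + 2 * ModLBFS.neighbourCost + ModLBFS.initCost,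
    fun n G K adj ks hG hK hadj hks => ?_⟩
  obtain ⟨T, t, s, hT, hle, hs, hd, ho⟩ := ModLBFS.exec_search hK hadj hks
  exact ⟨T, t, s, hT, hle, hs, hd, ho, hs.done_iff hG hK hd⟩
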